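/- Let $\kappa>0$ and let $\mathcal D\subset\mathbb R^2$ be a bounded, star-shaped, closed domain with boundary of class $C^2$ and with $0$ in its interior. Let $\mathbf n$ be the unit normal on $\partial\mathcal D$ that points into $\mathcal D$, and $dS$ arc length. Let $b\in L^\infty(\partial\mathcal D)$ and let $a$ be a bounded harmonic function on $\mathbb R^2\setminus\mathcal D$ with $$a+\kappa\,\frac{\partial a}{\partial\mathbf n}=b\quad\text{on }\partial\mathcal D .$$ Let $H_0$ be a bounded harmonic function on $\mathbb R^2\setminus\mathcal D$, continuous up to $\partial\mathcal D$, with $H_0(x)=\frac1{2\pi}\log|x|$ on $\partial\mathcal D$, let $H(x)=-\frac1{2\pi}\log|x|+H_0(x)$, and let $H^\kappa$ be a bounded harmonic function on $\mathbb R^2\setminus\mathcal D$, continuous up to $\partial\mathcal D$, with $$H^\kappa+\kappa\,\frac{\partial H^\kappa}{\partial\mathbf n}=\frac{\partial H}{\partial\mathbf n}\quad\text{on }\partial\mathcal D .$$ Then $bH^\kappa$ is integrable on $\partial\mathcal D$, $a$ has a limit at infinity, and $$\lim_{|x|\to\infty}a(x)=\int_{\partial\mathcal D}b\,H^\kappa\,dS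 .$$ Moreover, if $\mathcal D$ is the closed unit disc, then $\lim_{|x|\to\infty}a(x)=\frac1{2\pi}\int_{\partial\mathcal D}b\,dS$, the average of the Robin data. Here an equation $u+\kappa\,\partial u/\partial\mathbf n=b$ or $\partial u/\partial\mathbf n=g$ on $\partial\mathcal D$, with integrable right-hand side, means that the values of the left-hand side at $y-t\,\mathbf n(y)$ (with derivative in direction $\mathbf n(y)$) converge to the right-hand side at $y$ in $L^1(\partial\mathcal D,dS(y))$ as $t\downarrow0$; for $u$ of class $C^1$ up to the boundary this is the pointwise equation. -/

import Mathlib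

open MeasureTheory Filter Topology

noncomputable section

/-- The Euclidean plane `ℝ²`. -/
abbrev Plane : Type := EuclideanSpace ℝ (Fin 2)

/-- `ρ` is a defining function of class `C²` of the closed set `D = {ρ ≤ 0}`, with nonvanishing
gradient on `{ρ = 0}`. A compact set has such a function exactly when it is a closed region with
`C²` boundary; then `∂D = {ρ = 0}` and the interior of `D` is `{ρ < 0}`. -/
structure IsDefiningFunction (D : Set Plane) (ρ : Plane → ℝ) : Prop where
  contDiff : ContDiff ℝ 2 ρ
  eq_sublevel : D = {x | ρ x ≤ 0}
  gradient_ne_zero : ∀ x, ρ x = 0 → gradient ρ x ≠ 0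

/-- The unit normal of `∂D = {ρ = 0}` that points into `D = {ρ ≤ 0}`. It depends only on `D`. -/
def inwardNormal (ρ : Plane → ℝ) (y : Plane) : Plane :=
  -(‖gradient ρ y‖⁻¹ • gradient ρ y)

/-- The arc length measure `dS` on `∂D`. -/
def boundaryMeasure (D : Set Plane) : Measure Plane :=
  (Measure.hausdorffMeasure 1).restrict (frontier D)

/-- The directional derivative `∂u/∂v` at `x`. -/
def dirDeriv (u : Plane → ℝ) (v x : Plane) : ℝ := fderiv ℝ u x v

/-- `u + κ ∂u/∂n = b` on `∂D`, for a function `u` on the exterior of `D` and integrable `b`: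
the values of `u + κ ∂u/∂n` at the points `y - t n(y)` of the parallel curves outside `D` converge
to `b(y)` in `L¹(∂D)` as `t ↓ 0`. If `u` is `C¹` up to the boundary this is the pointwise
condition; it also makes sense for data `b` that are merely bounded and measurable. -/
def HasRobinData (D : Set Plane) (ρ : Plane → ℝ) (κ : ℝ) (u b : Plane → ℝ) : Prop :=
  Integrable b (boundaryMeasure D) ∧
  Tendsto (fun t : ℝ => ∫⁻ y,
      ‖u (y - t • inwardNormal ρ y)
        + κ * dirDeriv u (inwardNormal ρ y) (y - t • inwardNormal ρ y) - b y‖ₑ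
      ∂(boundaryMeasure D)) (𝓝[>] 0) (𝓝 0)

/-- `∂u/∂n = g` on `∂D`, for a function `u` on the exterior of `D` and integrable `g`, in the same
sense as in `HasRobinData`. -/
def HasNormalDerivative (D : Set Plane) (ρ : Plane → ℝ) (u g : Plane → ℝ) : Prop :=
  Integrable g (boundaryMeasure D) ∧
  Tendsto (fun t : ℝ => ∫⁻ y,
      ‖dirDeriv u (inwardNormal ρ y) (y - t • inwardNormal ρ y) - g y‖ₑ
      ∂(boundaryMeasure D)) (𝓝[>] 0) (𝓝 0)

/-- `u` is a bounded harmonic function on the exterior `ℝ² ∖ D`. -/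
structure IsBoundedExteriorHarmonic (D : Set Plane) (u : Plane → ℝ) : Prop where
  harmonic : InnerProductSpace.HarmonicOnNhd u Dᶜ
  bounded : ∃ C : ℝ, ∀ x ∈ Dᶜ, |u x| ≤ C

/-- `H₀` is the bounded harmonic function on `ℝ² ∖ D`, continuous up to the boundary, with
Dirichlet data `(1/2π) log |x|` on `∂D`. -/
structure IsGreenCorrector (D : Set Plane) (H₀ : Plane → ℝ) : Prop
    extends IsBoundedExteriorHarmonic D H₀ where
  continuousOn : ContinuousOn H₀ (closure Dᶜ)
  boundary_eq : ∀ x ∈ frontier D, H₀ x = 1 / (2 * Real.pi) * Real.log ‖x‖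

/-- The exterior Green-type function `H = -(1/2π) log |x| + H₀`. -/
def exteriorGreen (H₀ : Plane → ℝ) (x : Plane) : ℝ :=
  -(1 / (2 * Real.pi)) * Real.log ‖x‖ + H₀ x

/-- `Hκ` is the bounded harmonic function on `ℝ² ∖ D`, continuous up to the boundary, with
`Hκ + κ ∂Hκ/∂n = ∂H/∂n` on `∂D`, where `H = -(1/2π) log |x| + H₀`. -/
structure IsRobinKernel (D : Set Plane) (ρ : Plane → ℝ) (κ : ℝ) (H₀ Hκ : Plane → ℝ) : Prop
    extends IsBoundedExteriorHarmonic D Hκ where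
  continuousOn : ContinuousOn Hκ (closure Dᶜ)
  robin : ∃ g : Plane → ℝ,
    HasNormalDerivative D ρ (exteriorGreen H₀) g ∧ HasRobinData D ρ κ Hκ g

end

/-!
Green's identity is applied to `a` and the function `W = H - κ Hκ`. Since `H = 0` and
`∂H/∂n = Hκ + κ ∂Hκ/∂n` on `∂D`, this `W` satisfies the homogeneous Robin condition: `W = -κ Hκ` and
`∂W/∂n = Hκ` on `∂D`. Hence on `∂D`
`a ∂W/∂n - W ∂a/∂n = (a + κ ∂a/∂n) Hκ = b Hκ`,
so that the flux of `a ∇W - W ∇a` through `∂D` is `∫ b Hκ dS`. The flux through large circles only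
sees the pole `-(1/2π) log |x|` of `W`, and gives the value of `a` at infinity.

At infinity, the complex gradient `∂ₓa - i ∂ᵧa` is holomorphic, decays like `1/|z|` by the interior
gradient estimate, and has no residue because `a` is bounded and single valued
(`residue_complexGradient_eq_zero`). So it is `O(|z|⁻²)`, `a` has a limit `L`
(`IsBoundedExteriorHarmonic.exists_limit`), and the flux of `(a, W)` at infinity is `-L`
(`layerFlux_exteriorGreen`).

At the boundary nothing is smooth: the Robin condition for `a` holds only as an `L¹` limit along the
parallel curves `y - t n(y)`. Fluxes are therefore averaged over layers `δ < dist(x, D) < 2δ` by means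
of Lipschitz cutoffs of the distance function, for which Green's identity is needed only in the weak
form `integral_greenForm_gradient_eq_zero`. Integrals over a thin layer are compared with iterated
integrals over `t` and `∂D` in normal coordinates `(y, t) ↦ y - t n(y)`. Instead of a Jacobian
the comparison uses that, the unit normal being Lipschitz, these coordinates are bi-Lipschitz with
constant close to `1` on short arcs and near `∂D`
(`IsDefiningFunction.exists_layer_comparison`). With the almost everywhere identity
`∇ dist(·, D) = -n` in the layer this yields `IsDefiningFunction.layerFlux_eq_neg_of_tendsto`.

For the unit disc `H₀ = 0`, and `Hκ` is the constant `1/2π`.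
-/

open scoped RealInnerProductSpace NNReal ENNReal

/-! ### Bounded harmonic functions near infinity in `ℂ` -/

/-- The complex gradient `∂ₓu - i ∂ᵧu` of a real function on `ℂ`; it is holomorphic where `u` is
harmonic. -/
noncomputable def complexGradient (u : ℂ → ℝ) (z : ℂ) : ℂ :=
  fderiv ℝ u z 1 - Complex.I * fderiv ℝ u z Complex.I

lemma fderiv_eq_re_complexGradient_mul (u : ℂ → ℝ) (z w : ℂ) :
    fderiv ℝ u z w = (complexGradient u z * w).re := by
  have h : w = w.re • (1 : ℂ) + w.im • Complex.I := by simp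
  conv_lhs => rw [h, map_add, map_smul, map_smul]
  simp [complexGradient]
  ring

lemma norm_fderiv_le_norm_complexGradient (u : ℂ → ℝ) (z : ℂ) :
    ‖fderiv ℝ u z‖ ≤ ‖complexGradient u z‖ := by
  refine ContinuousLinearMap.opNorm_le_bound _ (norm_nonneg _) fun w => ?_
  rw [fderiv_eq_re_complexGradient_mul, ← norm_mul]
  exact Complex.abs_re_le_norm _

/-- Interior gradient estimate. If `u = Re h` with `|u| ≤ M`, then both `exp h` and its inverse are
bounded by `exp M`, and Cauchy's estimate for `exp h` bounds `h'`. -/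
lemma norm_complexGradient_le {u : ℂ → ℝ} {z : ℂ} {r M : ℝ} (hr : 0 < r)
    (hu : InnerProductSpace.HarmonicOnNhd u (Metric.ball z r))
    (hM : ∀ x ∈ Metric.ball z r, |u x| ≤ M) :
    ‖complexGradient u z‖ ≤ 2 * Real.exp M ^ 2 / r := by
  obtain ⟨h, hh, hre⟩ := hu.exists_analyticOnNhd_ball_re_eq
  have hz : z ∈ Metric.ball z r := Metric.mem_ball_self hr
  have hd : HasDerivAt h (deriv h z) z := (hh z hz).differentiableAt.hasDerivAt
  have hgrad : complexGradient u z = deriv h z := by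
    have h1 : HasFDerivAt u (Complex.reCLM.comp
        ((ContinuousLinearMap.toSpanSingleton ℂ (deriv h z)).restrictScalars ℝ)) z := by
      have h2 := Complex.reCLM.hasFDerivAt.comp z (hd.hasFDerivAt.restrictScalars ℝ)
      refine h2.congr_of_eventuallyEq ?_
      filter_upwards [Metric.ball_mem_nhds z hr] with x hx
      simpa using (hre hx).symm
    simp only [complexGradient, h1.fderiv]
    apply Complex.ext <;> simp
  have hexp : ∀ x ∈ Metric.ball z r, ‖Complex.exp (h x)‖ ≤ Real.exp M := by
    intro x hx
    rw [Complex.norm_exp]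
    refine Real.exp_le_exp.2 ?_
    have := hre hx
    simp only at this
    rw [this]
    exact (abs_le.1 (hM x hx)).2
  have hCauchy : ‖deriv (fun x => Complex.exp (h x)) z‖ ≤ Real.exp M / (r / 2) := by
    have hsub : Metric.closedBall z (r / 2) ⊆ Metric.ball z r :=
      Metric.closedBall_subset_ball (by linarith)
    refine Complex.norm_deriv_le_of_forall_mem_sphere_norm_le (by positivity) ?_ fun x hx =>
      hexp x (hsub (Metric.sphere_subset_closedBall hx))
    refine DifferentiableOn.diffContOnCl_ball (U := Metric.ball z r) ?_ hsub
    exact fun x hx => ((hh x hx).differentiableAt.cexp).differentiableWithinAt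
  rw [(hd.cexp).deriv, norm_mul, Complex.norm_exp] at hCauchy
  have hlow : Real.exp (-M) ≤ Real.exp (h z).re := by
    refine Real.exp_le_exp.2 ?_
    have := hre hz
    simp only at this
    rw [this]
    exact (abs_le.1 (hM z hz)).1
  rw [hgrad]
  have h3 : Real.exp (-M) * ‖deriv h z‖ ≤ Real.exp M / (r / 2) :=
    (mul_le_mul_of_nonneg_right hlow (norm_nonneg _)).trans hCauchy
  have h4 : Real.exp M * (Real.exp (-M) * ‖deriv h z‖) = ‖deriv h z‖ := by
    rw [← mul_assoc, ← Real.exp_add]; simp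
  rw [← h4]
  calc _ ≤ Real.exp M * (Real.exp M / (r / 2)) := by gcongr
    _ = _ := by field_simp

lemma exists_complexGradient_eq_inv_mul {u : ℂ → ℝ} {R M : ℝ} (hR : 0 < R)
    (hu : ∀ z : ℂ, R < ‖z‖ → InnerProductSpace.HarmonicAt u z)
    (hM : ∀ z : ℂ, R < ‖z‖ → |u z| ≤ M) :
    ∃ (k : ℂ → ℂ) (r : ℝ), 0 < r ∧ r ≤ R⁻¹ ∧ DifferentiableOn ℂ k (Metric.ball 0 r) ∧
      ∀ z : ℂ, r⁻¹ < ‖z‖ → complexGradient u z * z = k z⁻¹ := by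
  set r : ℝ := (2 * R)⁻¹ with hrdef
  have hr : 0 < r := by positivity
  have hlarge : ∀ w ∈ Metric.ball (0 : ℂ) r \ {0}, 2 * R < ‖w⁻¹‖ := by
    rintro w ⟨hw, hw0⟩
    have hw0' : 0 < ‖w‖ := norm_pos_iff.2 hw0
    rw [norm_inv, lt_inv_comm₀ (by positivity) hw0']
    rwa [mem_ball_zero_iff] at hw
  set k₀ : ℂ → ℂ := fun w => complexGradient u w⁻¹ * w⁻¹ with hk₀
  have hbound : ∀ w ∈ Metric.ball (0 : ℂ) r \ {0}, ‖k₀ w‖ ≤ 4 * Real.exp M ^ 2 := by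
    intro w hw
    have h1 := hlarge w hw
    have hpos : 0 < ‖w⁻¹‖ := by linarith
    have hsub : ∀ x ∈ Metric.ball w⁻¹ (‖w⁻¹‖ / 2), R < ‖x‖ := by
      intro x hx
      have h2 : ‖w⁻¹‖ - ‖x‖ ≤ ‖w⁻¹ - x‖ := norm_sub_norm_le _ _
      rw [Metric.mem_ball, dist_comm, dist_eq_norm] at hx
      linarith
    have h3 := norm_complexGradient_le (u := u) (z := w⁻¹) (r := ‖w⁻¹‖ / 2) (M := M)
      (by positivity) (fun x hx => hu x (hsub x hx)) (fun x hx => hM x (hsub x hx))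
    rw [hk₀, norm_mul]
    calc _ ≤ 2 * Real.exp M ^ 2 / (‖w⁻¹‖ / 2) * ‖w⁻¹‖ := by gcongr
      _ = _ := by
        generalize ‖w⁻¹‖ = s at hpos
        field_simp
        norm_num
  have hdiff : DifferentiableOn ℂ k₀ (Metric.ball 0 r \ {0}) := by
    intro w hw
    have h1 := hlarge w hw
    have h2 : DifferentiableAt ℂ (complexGradient u) w⁻¹ :=
      HarmonicAt.differentiableAt_complex_partial (hu _ (by linarith))
    have h3 : DifferentiableAt ℂ (fun w : ℂ => w⁻¹) w := differentiableAt_inv hw.2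
    exact ((h2.comp w h3).mul h3).differentiableWithinAt
  have hk := Complex.differentiableOn_update_limUnder_of_bddAbove
    (Metric.ball_mem_nhds (0 : ℂ) hr) hdiff ⟨4 * Real.exp M ^ 2, by
      rintro _ ⟨w, hw, rfl⟩
      exact hbound w hw⟩
  refine ⟨_, r, hr, ?_, hk, fun z hz => ?_⟩
  · rw [hrdef]; gcongr; linarith
  · have hz0 : z ≠ 0 := by
      rintro rfl
      have : 0 < r⁻¹ := by positivity
      simp at hz; linarith
    rw [Function.update_of_ne (inv_ne_zero hz0)]
    simp [hk₀]

lemma tendsto_comp_inv_cobounded {k : ℂ → ℂ} {r : ℝ} (hr : 0 < r)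
    (hk : DifferentiableOn ℂ k (Metric.ball 0 r)) :
    Tendsto (fun z : ℂ => k z⁻¹) (Bornology.cobounded ℂ) (𝓝 (k 0)) := by
  have h1 : ContinuousAt k 0 :=
    (hk.differentiableAt (Metric.ball_mem_nhds _ hr)).continuousAt
  exact h1.tendsto.comp tendsto_inv₀_cobounded

/-- The residue at infinity of the complex gradient of a bounded harmonic function vanishes: its
real part because `u` would otherwise grow logarithmically along rays, its imaginary part because
`u` is single valued on circles. -/
lemma residue_complexGradient_eq_zero {u : ℂ → ℝ} {R M : ℝ} (hR : 0 < R)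
    (hu : ∀ z : ℂ, R < ‖z‖ → InnerProductSpace.HarmonicAt u z)
    (hM : ∀ z : ℂ, R < ‖z‖ → |u z| ≤ M) {c : ℂ}
    (hc : Tendsto (fun z : ℂ => complexGradient u z * z) (Bornology.cobounded ℂ) (𝓝 c)) :
    c = 0 := by
  have hnear : ∀ ε > 0, ∃ A : ℝ, ∀ z : ℂ, A ≤ ‖z‖ → ‖complexGradient u z * z - c‖ < ε := by
    intro ε hε
    have h1 := (Metric.tendsto_nhds.1 hc) ε hε
    rw [← comap_norm_atTop, eventually_comap] at h1
    obtain ⟨A, hA⟩ := eventually_atTop.1 h1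
    exact ⟨A, fun z hz => by simpa [dist_eq_norm] using hA ‖z‖ hz z rfl⟩
  -- derivative of `u` along the curve `exp (s + θ i)` in logarithmic polar coordinates
  have hder : ∀ (p q : ℂ) (s : ℝ), Real.log R < (p + s * q).re →
      HasDerivAt (fun s : ℝ => u (Complex.exp (p + s * q)))
        ((complexGradient u (Complex.exp (p + s * q)) * Complex.exp (p + s * q)) * q).re s := by
    intro p q s hs
    have hlarge : R < ‖Complex.exp (p + s * q)‖ := by
      rw [Complex.norm_exp]; rwa [← Real.log_lt_iff_lt_exp hR]
    have h1 : HasDerivAt (fun s : ℝ => Complex.exp (p + s * q))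
        (Complex.exp (p + s * q) * q) s := by
      have h2 : HasDerivAt (fun s : ℝ => p + s * q) (1 * q) s :=
        ((Complex.ofRealCLM.hasDerivAt (x := s)).mul_const q).const_add p
      simpa using h2.cexp
    have h3 := ((hu _ hlarge).1.differentiableAt (by norm_num)).hasFDerivAt
    have h4 := h3.comp_hasDerivAt s h1
    rw [fderiv_eq_re_complexGradient_mul, ← mul_assoc] at h4
    exact h4
  -- along a ray the derivative tends to `c.re`, which contradicts boundedness unless it is zero
  have hre : c.re = 0 := by
    by_contra hne
    have hpos : 0 < |c.re| := abs_pos.2 hne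
    obtain ⟨A, hA⟩ := hnear (|c.re| / 2) (by positivity)
    set s : ℝ := max (max (Real.log R + 1) (Real.log (max A 1))) (max 1 (4 * (M + 1) / |c.re| + 1))
    have hs1 : Real.log R < s := lt_of_lt_of_le (by linarith) ((le_max_left _ _).trans (le_max_left _ _))
    have hs2 : Real.log (max A 1) ≤ s := (le_max_right _ _).trans (le_max_left _ _)
    have hs3 : 1 ≤ s := (le_max_left _ _).trans (le_max_right _ _)
    have hs4 : 4 * (M + 1) / |c.re| < s :=
      lt_of_lt_of_le (by linarith) ((le_max_right _ _).trans (le_max_right _ _))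
    have hd : ∀ x : ℝ, s ≤ x → HasDerivAt (fun s : ℝ => u (Complex.exp (0 + s * 1)))
        ((complexGradient u (Complex.exp (0 + x * 1)) * Complex.exp (0 + x * 1)) * 1).re x :=
      fun x hx => hder 0 1 x (by simp; linarith)
    obtain ⟨x, hx, hxe⟩ := exists_hasDerivAt_eq_slope (fun s : ℝ => u (Complex.exp (0 + s * 1)))
      (fun x => ((complexGradient u (Complex.exp (0 + x * 1)) * Complex.exp (0 + x * 1)) * 1).re)
      (show s < 2 * s by linarith)
      (fun x hx => (hd x hx.1).continuousAt.continuousWithinAt)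
      (fun x hx => hd x hx.1.le)
    have hbd : ∀ x : ℝ, s ≤ x → |u (Complex.exp (0 + x * 1))| ≤ M := by
      intro x hx
      refine hM _ ?_
      rw [Complex.norm_exp, ← Real.log_lt_iff_lt_exp hR]
      simp; linarith
    have hAx : A ≤ ‖Complex.exp (0 + x * 1)‖ := by
      rw [Complex.norm_exp]
      have : Real.log (max A 1) ≤ x := hs2.trans hx.1.le
      rw [Real.log_le_iff_le_exp (by positivity)] at this
      simpa using (le_max_left A 1).trans this
    have h5 := hA _ hAx
    set ζ := complexGradient u (Complex.exp (0 + x * 1)) * Complex.exp (0 + x * 1) with hζ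
    have h6 : |ζ.re - c.re| < |c.re| / 2 := by
      have := Complex.abs_re_le_norm (ζ - c)
      rw [Complex.sub_re] at this
      linarith
    have h7 : |ζ.re| ≤ 2 * M / s := by
      have h8 : ζ.re = (u (Complex.exp (0 + (2 * s : ℝ) * 1)) - u (Complex.exp (0 + s * 1))) / s := by
        have h9 := hxe
        rw [mul_one ζ] at h9
        rw [h9]
        congr 1
        ring
      rw [h8, abs_div, abs_of_pos (by linarith : 0 < s)]
      have e1 := hbd (2 * s) (by linarith)
      have e2 := hbd s le_rfl
      gcongr
      rw [abs_le] at *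
      constructor <;> linarith [e1.1, e1.2, e2.1, e2.2]
    have hM0 : 0 ≤ M := (abs_nonneg _).trans (hbd s le_rfl)
    have h10 : 2 * M / s < |c.re| / 2 := by
      rw [div_lt_iff₀ hpos] at hs4
      rw [div_lt_iff₀ (by linarith)]
      nlinarith
    have h11 : |c.re| ≤ |ζ.re - c.re| + |ζ.re| := by
      have := abs_sub_abs_le_abs_sub c.re ζ.re
      rw [abs_sub_comm] at this
      linarith
    linarith
  -- along a circle the derivative is nearly `-c.im`, but `u` returns to its initial value
  have him : c.im = 0 := by
    by_contra hne
    have hpos : 0 < |c.im| := abs_pos.2 hne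
    obtain ⟨A, hA⟩ := hnear |c.im| hpos
    set s : ℝ := max (Real.log R + 1) (Real.log (max A 1))
    have hs1 : Real.log R < s := lt_of_lt_of_le (by linarith) (le_max_left _ _)
    have hs2 : Real.log (max A 1) ≤ s := le_max_right _ _
    have hd : ∀ x : ℝ, HasDerivAt (fun x : ℝ => u (Complex.exp (s + x * Complex.I)))
        ((complexGradient u (Complex.exp (s + x * Complex.I)) * Complex.exp (s + x * Complex.I))
          * Complex.I).re x := fun x => hder s Complex.I x (by simpa using hs1)
    obtain ⟨x, hx, hxe⟩ := exists_hasDerivAt_eq_zero (Real.two_pi_pos)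
      (fun x _ => (hd x).continuousAt.continuousWithinAt)
      (by
        have : Complex.exp (s + (2 * Real.pi : ℝ) * Complex.I) = Complex.exp (s + (0 : ℝ) * Complex.I) := by
          push_cast
          rw [Complex.exp_add, Complex.exp_two_pi_mul_I]; simp
        rw [this])
      (fun x _ => hd x)
    have hAx : A ≤ ‖Complex.exp (s + x * Complex.I)‖ := by
      rw [Complex.norm_exp]
      rw [Real.log_le_iff_le_exp (by positivity)] at hs2
      simpa using (le_max_left A 1).trans hs2
    have h5 := hA _ hAx
    have h6 := (Complex.abs_im_le_norm _).trans_lt h5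
    rw [Complex.sub_im] at h6
    simp only [Complex.mul_re _ Complex.I, Complex.I_re, Complex.I_im, mul_zero, mul_one, zero_sub,
      neg_eq_zero] at hxe
    rw [hxe] at h6
    simp at h6
  exact Complex.ext hre him

/-- A bounded harmonic function near infinity in `ℂ` has a limit at infinity, and its gradient
decays like `|z|⁻²`. -/
lemma exists_limit_and_gradient_decay {u : ℂ → ℝ} {R M : ℝ} (hR : 0 < R)
    (hu : ∀ z : ℂ, R < ‖z‖ → InnerProductSpace.HarmonicAt u z)
    (hM : ∀ z : ℂ, R < ‖z‖ → |u z| ≤ M) :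
    ∃ L C R' : ℝ, Tendsto u (Bornology.cobounded ℂ) (𝓝 L) ∧ 0 < R' ∧
      ∀ z : ℂ, R' < ‖z‖ → ‖fderiv ℝ u z‖ ≤ C / ‖z‖ ^ 2 := by
  obtain ⟨k, r, hr, hrR, hk, hkz⟩ := exists_complexGradient_eq_inv_mul hR hu hM
  have hk0 : k 0 = 0 := by
    refine residue_complexGradient_eq_zero hR hu hM ?_
    refine (tendsto_comp_inv_cobounded hr hk).congr' ?_
    rw [← comap_norm_atTop]
    filter_upwards [preimage_mem_comap (Ioi_mem_atTop r⁻¹)] with z hz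
    exact (hkz z hz).symm
  set m : ℂ → ℂ := dslope k 0
  have hm : DifferentiableOn ℂ m (Metric.ball 0 r) :=
    (Complex.differentiableOn_dslope (Metric.ball_mem_nhds _ hr)).2 hk
  have hkm : ∀ w, k w = w * m w := by
    intro w
    have := sub_smul_dslope k 0 w
    simp only [sub_zero, hk0, smul_eq_mul] at this
    exact this.symm
  have hgrad : ∀ z : ℂ, r⁻¹ < ‖z‖ → complexGradient u z = m z⁻¹ * (z⁻¹) ^ 2 := by
    intro z hz
    have hz0 : z ≠ 0 := by
      rintro rfl
      have : 0 < r⁻¹ := by positivity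
      simp at hz; linarith
    have := hkz z hz
    rw [hkm] at this
    field_simp at this ⊢
    exact this
  obtain ⟨G, hG⟩ := hm.isExactOn_ball
  have hinv : ∀ z : ℂ, r⁻¹ < ‖z‖ → z⁻¹ ∈ Metric.ball (0 : ℂ) r := by
    intro z hz
    have : 0 < r⁻¹ := by positivity
    rw [mem_ball_zero_iff, norm_inv, inv_lt_comm₀ (by linarith) hr]
    exact hz
  -- `u + Re G(1/z)` is locally constant on the connected set `{|z| > 1/r}`
  have hconst : ∃ c : ℝ, ∀ z ∈ {z : ℂ | r⁻¹ < ‖z‖}, u z + (G z⁻¹).re = c := by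
    have hopen : IsOpen {z : ℂ | r⁻¹ < ‖z‖} := isOpen_lt continuous_const continuous_norm
    have hpre : IsPreconnected {z : ℂ | r⁻¹ < ‖z‖} := by
      have h1 : {z : ℂ | r⁻¹ < ‖z‖} = Complex.exp '' {z : ℂ | Real.log r⁻¹ < z.re} := by
        ext z
        constructor
        · intro hz
          have h0 : 0 < r⁻¹ := by positivity
          have hz' : r⁻¹ < ‖z‖ := hz
          have hz0 : z ≠ 0 := norm_pos_iff.1 (by linarith)
          refine ⟨Complex.log z, ?_, Complex.exp_log hz0⟩
          simp only [Set.mem_ofPred_eq, Complex.log_re]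
          exact Real.log_lt_log h0 hz'
        · rintro ⟨w, hw, rfl⟩
          simp only [Set.mem_ofPred_eq, Complex.norm_exp] at *
          rwa [← Real.log_lt_iff_lt_exp (by positivity)]
      rw [h1]
      exact (convex_halfSpace_re_gt _).isPreconnected.image _ Complex.continuous_exp.continuousOn
    have hder : ∀ z ∈ {z : ℂ | r⁻¹ < ‖z‖},
        HasFDerivAt (fun z => u z + (G z⁻¹).re) (0 : ℂ →L[ℝ] ℝ) z := by
      intro z hz
      have hz' : r⁻¹ < ‖z‖ := hz
      have hRz : R < ‖z‖ := lt_of_le_of_lt (by rwa [le_inv_comm₀ hR hr]) hz'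
      have h0 : 0 < r⁻¹ := by positivity
      have hz0 : z ≠ 0 := norm_pos_iff.1 (by linarith)
      have h1 := ((hu z hRz).1.differentiableAt (by norm_num)).hasFDerivAt
      have h2 : HasDerivAt (fun z => G z⁻¹) (m z⁻¹ * (-(z ^ 2)⁻¹)) z :=
        (hG _ (hinv z hz')).comp z (hasDerivAt_inv hz0)
      have h3 := Complex.reCLM.hasFDerivAt.comp z (h2.hasFDerivAt.restrictScalars ℝ)
      refine (h1.add h3).congr_fderiv ?_
      ext w
      simp only [add_apply, fderiv_eq_re_complexGradient_mul, hgrad z hz',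
        ContinuousLinearMap.comp_apply, ContinuousLinearMap.coe_restrictScalars',
        Complex.reCLM_apply, zero_apply]
      rw [← Complex.add_re]
      simp
      ring
    obtain ⟨c, hc⟩ := hopen.exists_is_const_of_fderiv_eq_zero (𝕜 := ℝ) hpre
      (fun z hz => (hder z hz).differentiableAt.differentiableWithinAt)
      (fun z hz => (hder z hz).fderiv)
    exact ⟨c, hc⟩
  obtain ⟨c, hc⟩ := hconst
  have hGc : ContinuousAt G 0 := (hG 0 (Metric.mem_ball_self hr)).continuousAt
  have hmc : ContinuousAt m 0 := (hm.differentiableAt (Metric.ball_mem_nhds _ hr)).continuousAt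
  have hev : ∀ᶠ z : ℂ in Bornology.cobounded ℂ, r⁻¹ < ‖z‖ := by
    rw [← comap_norm_atTop]
    exact preimage_mem_comap (Ioi_mem_atTop r⁻¹)
  have hlim : Tendsto (fun z : ℂ => c - (G z⁻¹).re) (Bornology.cobounded ℂ)
      (𝓝 (c - (G 0).re)) :=
    tendsto_const_nhds.sub ((Complex.continuous_re.tendsto _).comp
      (hGc.tendsto.comp tendsto_inv₀_cobounded))
  have hmb : ∀ᶠ z : ℂ in Bornology.cobounded ℂ, ‖m z⁻¹‖ < ‖m 0‖ + 1 :=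
    ((hmc.tendsto.comp tendsto_inv₀_cobounded).norm).eventually_lt_const (by linarith)
  have hall := hev.and hmb
  rw [← comap_norm_atTop, eventually_comap] at hall
  obtain ⟨A, hA⟩ := eventually_atTop.1 hall
  refine ⟨c - (G 0).re, ‖m 0‖ + 1, max A 1, hlim.congr' ?_, by positivity, ?_⟩
  · filter_upwards [hev] with z hz
    rw [← hc z hz]; ring
  · intro z hz
    obtain ⟨h1, h2⟩ := hA ‖z‖ ((le_max_left _ _).trans hz.le) z rfl
    refine (norm_fderiv_le_norm_complexGradient u z).trans ?_
    rw [hgrad z h1, norm_mul, norm_pow, norm_inv, inv_pow, ← div_eq_mul_inv]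
    gcongr

/-! ### Bounded harmonic functions outside a bounded subset of the plane -/

/-- The Laplacian is invariant under linear isometries. -/
lemma laplacian_comp_linearIsometryEquiv {E E' F : Type*} [NormedAddCommGroup E]
    [InnerProductSpace ℝ E] [FiniteDimensional ℝ E] [NormedAddCommGroup E'] [InnerProductSpace ℝ E']
    [FiniteDimensional ℝ E'] [NormedAddCommGroup F] [NormedSpace ℝ F] (e : E ≃ₗᵢ[ℝ] E')
    (f : E' → F) (x : E) : Laplacian.laplacian (f ∘ e) x = Laplacian.laplacian f (e x) := by
  rw [InnerProductSpace.laplacian_eq_iteratedFDeriv_orthonormalBasis (f ∘ e)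
      (stdOrthonormalBasis ℝ E),
    InnerProductSpace.laplacian_eq_iteratedFDeriv_orthonormalBasis f
      ((stdOrthonormalBasis ℝ E).map e)]
  refine Finset.sum_congr rfl fun i _ => ?_
  have h : iteratedFDeriv ℝ 2 (f ∘ e) x
      = (iteratedFDeriv ℝ 2 f (e x)).compContinuousLinearMap
          fun _ => (e.toContinuousLinearEquiv : E →L[ℝ] E') := by
    have := e.toContinuousLinearEquiv.iteratedFDerivWithin_comp_right f uniqueDiffOn_univ
      (Set.mem_univ (e x)) 2
    simpa only [Set.preimage_univ, iteratedFDerivWithin_univ] using! this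
  rw [h]
  simp only [ContinuousMultilinearMap.compContinuousLinearMap_apply]
  congr 1
  ext j
  fin_cases j <;> simp

lemma InnerProductSpace.HarmonicAt.comp_linearIsometryEquiv {E E' F : Type*} [NormedAddCommGroup E]
    [InnerProductSpace ℝ E] [FiniteDimensional ℝ E] [NormedAddCommGroup E'] [InnerProductSpace ℝ E']
    [FiniteDimensional ℝ E'] [NormedAddCommGroup F] [NormedSpace ℝ F] {e : E ≃ₗᵢ[ℝ] E'}
    {f : E' → F} {x : E} (h : InnerProductSpace.HarmonicAt f (e x)) :
    InnerProductSpace.HarmonicAt (f ∘ e) x := by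
  refine ⟨h.1.comp x e.contDiff.contDiffAt, ?_⟩
  filter_upwards [e.continuous.continuousAt.eventually h.2] with y hy
  rw [laplacian_comp_linearIsometryEquiv, hy]
  rfl

/-- The standard isometry between `ℂ` and the plane. -/
noncomputable def complexToPlane : ℂ ≃ₗᵢ[ℝ] Plane := Complex.orthonormalBasisOneI.repr

lemma harmonicAt_log_norm {x : Plane} (hx : x ≠ 0) :
    InnerProductSpace.HarmonicAt (fun x : Plane => Real.log ‖x‖) x := by
  have h1 : InnerProductSpace.HarmonicAt (fun z : ℂ => Real.log ‖z‖) (complexToPlane.symm x) :=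
    analyticAt_id.harmonicAt_log_norm (by simpa using hx)
  have h2 := h1.comp_linearIsometryEquiv
  simpa [Function.comp_def] using! h2

/-- A bounded harmonic function on the exterior of a bounded set has a limit at infinity, and its
gradient decays like `|x|⁻²`. -/
lemma IsBoundedExteriorHarmonic.exists_limit {D : Set Plane} (hD : Bornology.IsBounded D)
    {u : Plane → ℝ} (hu : IsBoundedExteriorHarmonic D u) :
    ∃ L C R : ℝ, Tendsto u (Bornology.cobounded Plane) (𝓝 L) ∧ 0 < R ∧ 0 ≤ C ∧
      ∀ x : Plane, R < ‖x‖ → ‖fderiv ℝ u x‖ ≤ C / ‖x‖ ^ 2 := by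
  obtain ⟨M, hM⟩ := hu.bounded
  obtain ⟨R₀, hR₀⟩ := hD.subset_closedBall 0
  set R₁ := max R₀ 1
  have hout : ∀ x : Plane, R₁ < ‖x‖ → x ∈ Dᶜ := by
    intro x hx hxD
    have := hR₀ hxD
    rw [mem_closedBall_zero_iff] at this
    exact absurd (this.trans (le_max_left _ 1)) (not_le.2 hx)
  obtain ⟨L, C, R, hL, hR, hC⟩ := exists_limit_and_gradient_decay (u := u ∘ complexToPlane)
    (R := R₁) (M := M) (by positivity)
    (fun z hz => (hu.harmonic _ (hout _ (by simpa using hz))).comp_linearIsometryEquiv)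
    (fun z hz => hM _ (hout _ (by simpa using hz)))
  refine ⟨L, |C|, R, ?_, hR, abs_nonneg C, fun x hx => ?_⟩
  · have h1 : Tendsto complexToPlane.symm (Bornology.cobounded Plane) (Bornology.cobounded ℂ) := by
      rw [← tendsto_norm_atTop_iff_cobounded]
      simpa using tendsto_norm_cobounded_atTop
    refine (hL.comp h1).congr fun x => by simp
  · have h2 := hC (complexToPlane.symm x) (by simpa using hx)
    have h3 : fderiv ℝ (u ∘ complexToPlane) (complexToPlane.symm x)
        = (fderiv ℝ u x).comp (complexToPlane.toContinuousLinearEquiv : ℂ →L[ℝ] Plane) := by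
      have := complexToPlane.toContinuousLinearEquiv.comp_right_fderiv (f := u)
        (x := complexToPlane.symm x)
      simpa using! this
    rw [h3, LinearIsometryEquiv.norm_map] at h2
    refine le_trans ?_ (h2.trans (by gcongr; exact le_abs_self C))
    refine ContinuousLinearMap.opNorm_le_bound _ (norm_nonneg _) fun w => ?_
    have h4 := ((fderiv ℝ u x).comp
      (complexToPlane.toContinuousLinearEquiv : ℂ →L[ℝ] Plane)).le_opNorm (complexToPlane.symm w)
    simpa using h4

/-! ### Green's second identity in weak form -/

/-- The integrand `u ∂v/∂w - v ∂u/∂w` of Green's second identity in direction `w` at `x`. -/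
noncomputable def greenForm (u v : Plane → ℝ) (x w : Plane) : ℝ :=
  u x * fderiv ℝ v x w - v x * fderiv ℝ u x w

lemma greenForm_smul (u v : Plane → ℝ) (x w : Plane) (c : ℝ) :
    greenForm u v x (c • w) = c * greenForm u v x w := by
  simp [greenForm]; ring

lemma greenForm_neg (u v : Plane → ℝ) (x w : Plane) :
    greenForm u v x (-w) = - greenForm u v x w := by
  simp [greenForm]; ring

/-- The vector field `u ∇v - v ∇u` is divergence free. -/
lemma sum_fderiv_greenForm_eq_zero {u v : Plane → ℝ} {x : Plane}
    (hu : InnerProductSpace.HarmonicAt u x) (hv : InnerProductSpace.HarmonicAt v x) :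
    ∑ i, fderiv ℝ (fun y => greenForm u v y (EuclideanSpace.basisFun (Fin 2) ℝ i)) x
      (EuclideanSpace.basisFun (Fin 2) ℝ i) = 0 := by
  have key : ∀ w : Plane, fderiv ℝ (fun y => greenForm u v y w) x w
      = u x * fderiv ℝ (fderiv ℝ v) x w w - v x * fderiv ℝ (fderiv ℝ u) x w w := by
    intro w
    have hu0 : DifferentiableAt ℝ u x := hu.1.differentiableAt (by norm_num)
    have hv0 : DifferentiableAt ℝ v x := hv.1.differentiableAt (by norm_num)
    have hu1 : DifferentiableAt ℝ (fderiv ℝ u) x :=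
      (hu.1.fderiv_right (m := 1) (by norm_num)).differentiableAt (by norm_num)
    have hv1 : DifferentiableAt ℝ (fderiv ℝ v) x :=
      (hv.1.fderiv_right (m := 1) (by norm_num)).differentiableAt (by norm_num)
    have h := ((hu0.hasFDerivAt.mul (hv1.hasFDerivAt.clm_apply (hasFDerivAt_const w x))).sub
      (hv0.hasFDerivAt.mul (hu1.hasFDerivAt.clm_apply (hasFDerivAt_const w x)))).fderiv
    have h' : fderiv ℝ (fun y => greenForm u v y w) x = _ := h
    rw [h']
    simp
    ring
  have hlu := hu.2.self_of_nhds
  have hlv := hv.2.self_of_nhds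
  rw [InnerProductSpace.laplacian_eq_iteratedFDeriv_orthonormalBasis _
    (EuclideanSpace.basisFun (Fin 2) ℝ)] at hlu hlv
  simp only [iteratedFDeriv_two_apply, Matrix.cons_val_zero, Matrix.cons_val_one,
    Pi.zero_apply] at hlu hlv
  simp only [key, Finset.sum_sub_distrib, ← Finset.mul_sum]
  rw [hlu, hlv]
  ring

lemma contDiffAt_greenForm {u v : Plane → ℝ} {x : Plane}
    (hu : InnerProductSpace.HarmonicAt u x) (hv : InnerProductSpace.HarmonicAt v x) (w : Plane) :
    ContDiffAt ℝ 1 (fun y => greenForm u v y w) x := by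
  have h1 : ContDiffAt ℝ 1 (fderiv ℝ u) x := hu.1.fderiv_right (by norm_num)
  have h2 : ContDiffAt ℝ 1 (fderiv ℝ v) x := hv.1.fderiv_right (by norm_num)
  exact ((hu.1.of_le (by norm_num)).mul (h2.clm_apply contDiffAt_const)).sub
    ((hv.1.of_le (by norm_num)).mul (h1.clm_apply contDiffAt_const))

/-- Green's second identity in weak form: `u ∇v - v ∇u` is orthogonal to the gradients of
Lipschitz functions with compact support in the set where `u` and `v` are harmonic. -/
theorem integral_greenForm_gradient_eq_zero {U : Set Plane} (hU : IsOpen U) {u v χ : Plane → ℝ}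
    (hu : InnerProductSpace.HarmonicOnNhd u U) (hv : InnerProductSpace.HarmonicOnNhd v U)
    {C : NNReal} (hχ : LipschitzWith C χ) (hχc : HasCompactSupport χ) (hχU : tsupport χ ⊆ U) :
    ∫ x, greenForm u v x (gradient χ x) = 0 := by
  obtain ⟨K, hK, hsK, hKU⟩ := exists_compact_between hχc hU hχU
  obtain ⟨ψ, hψ1, hψ0, -⟩ := exists_contMDiffMap_one_nhds_of_subset_interior
    (I := modelWithCornersSelf ℝ Plane) (n := 1) (isClosed_tsupport χ) hsK
  have hψ : ContDiff ℝ 1 ψ := ψ.contMDiff.contDiff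
  have hψK : tsupport ψ ⊆ K := closure_minimal (fun x hx => by
    by_contra hxK; exact hx (hψ0 x hxK)) hK.isClosed
  set e := EuclideanSpace.basisFun (Fin 2) ℝ
  -- the components of the vector field, cut off to be globally defined
  set G : Fin 2 → Plane → ℝ := fun i x => ψ x * greenForm u v x (e i) with hGdef
  have hG : ∀ i, ContDiff ℝ 1 (G i) := by
    intro i
    rw [contDiff_iff_contDiffAt]
    intro x
    by_cases hx : x ∈ U
    · exact hψ.contDiffAt.mul (contDiffAt_greenForm (hu x hx) (hv x hx) _)
    · have h1 : ψ =ᶠ[𝓝 x] 0 := notMem_tsupport_iff_eventuallyEq.1 fun h => hx (hKU (hψK h))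
      have h2 : G i =ᶠ[𝓝 x] fun _ => 0 := by
        filter_upwards [h1] with y hy
        simp [hGdef, hy]
      exact contDiffAt_const.congr_of_eventuallyEq h2
  have hGc : ∀ i, HasCompactSupport (G i) := fun i =>
    HasCompactSupport.mul_right (HasCompactSupport.of_support_subset_isCompact hK
      ((subset_tsupport _).trans hψK))
  have hnear : ∀ x ∈ tsupport χ, ∀ i, G i =ᶠ[𝓝 x] fun y => greenForm u v y (e i) := by
    intro x hx i
    have h1 : ∀ᶠ y in 𝓝 x, ψ y = 1 := hψ1.filter_mono (nhds_le_nhdsSet hx)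
    filter_upwards [h1] with y hy
    simp [hGdef, hy]
  have hparts : ∀ i, ∫ x, lineDeriv ℝ χ x (e i) * G i x
      = ∫ x, lineDeriv ℝ (G i) x (-e i) * χ x := by
    intro i
    obtain ⟨C', hC'⟩ := ContDiff.lipschitzWith_of_hasCompactSupport (hGc i) (hG i) (by norm_num)
    exact hχ.integral_lineDeriv_mul_eq hC' (hGc i) (e i)
  have hint1 : ∀ i, Integrable (fun x => lineDeriv ℝ χ x (e i) * G i x) := by
    intro i
    refine Integrable.bdd_mul (c := C * ‖e i‖) ((hG i).continuous.integrable_of_hasCompactSupport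
      (hGc i)) ?_ ?_
    · exact (measurable_lineDeriv hχ.continuous).aestronglyMeasurable
    · exact .of_forall fun x => norm_lineDeriv_le_of_lipschitz ℝ hχ
  have hint2 : ∀ i, Integrable (fun x => lineDeriv ℝ (G i) x (-e i) * χ x) := by
    intro i
    have h1 : (fun x => lineDeriv ℝ (G i) x (-e i) * χ x)
        = fun x => fderiv ℝ (G i) x (-e i) * χ x := by
      ext x
      rw [((hG i).differentiable (by norm_num) x).lineDeriv_eq_fderiv]
    rw [h1]
    refine Continuous.integrable_of_hasCompactSupport ?_ hχc.mul_left
    exact (((hG i).continuous_fderiv (by norm_num)).clm_apply continuous_const).mul hχ.continuous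
  calc ∫ x, greenForm u v x (gradient χ x)
      = ∫ x, ∑ i, lineDeriv ℝ χ x (e i) * G i x := by
        refine integral_congr_ae ?_
        filter_upwards [hχ.ae_differentiableAt (μ := volume)] with x hx
        by_cases hxs : x ∈ tsupport χ
        · have h1 : gradient χ x = ∑ i, lineDeriv ℝ χ x (e i) • e i := by
            rw [← e.sum_repr (gradient χ x)]
            refine Finset.sum_congr rfl fun i _ => ?_
            rw [hx.lineDeriv_eq_fderiv, OrthonormalBasis.repr_apply_apply, real_inner_comm,
              inner_gradient_left]
          have h2 : ∀ i, G i x = greenForm u v x (e i) := fun i => (hnear x hxs i).self_of_nhds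
          simp only [h2]
          rw [h1]
          simp only [greenForm, map_sum, map_smul, smul_eq_mul, Finset.mul_sum,
            ← Finset.sum_sub_distrib]
          exact Finset.sum_congr rfl fun i _ => by ring
        · have h1 : χ =ᶠ[𝓝 x] fun _ => 0 := notMem_tsupport_iff_eventuallyEq.1 hxs
          have h2 : fderiv ℝ χ x = 0 := by rw [h1.fderiv_eq]; simp
          simp [hx.lineDeriv_eq_fderiv, gradient, h2, greenForm]
    _ = ∑ i, ∫ x, lineDeriv ℝ χ x (e i) * G i x := integral_finsetSum _ fun i _ => hint1 i
    _ = ∑ i, ∫ x, lineDeriv ℝ (G i) x (-e i) * χ x := Finset.sum_congr rfl fun i _ => hparts i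
    _ = ∫ x, ∑ i, lineDeriv ℝ (G i) x (-e i) * χ x := (integral_finsetSum _ fun i _ => hint2 i).symm
    _ = ∫ x : Plane, (0 : ℝ) := by
        refine integral_congr_ae (.of_forall fun x => ?_)
        simp only
        rw [← Finset.sum_mul]
        by_cases hxs : x ∈ tsupport χ
        · have h1 : ∀ i, lineDeriv ℝ (G i) x (-e i)
              = - fderiv ℝ (fun y => greenForm u v y (e i)) x (e i) := by
            intro i
            rw [((hG i).differentiable (by norm_num) x).lineDeriv_eq_fderiv, map_neg,
              (hnear x hxs i).fderiv_eq]
          simp only [h1, Finset.sum_neg_distrib]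
          rw [sum_fderiv_greenForm_eq_zero (hu x (hχU hxs)) (hv x (hχU hxs))]
          simp
        · rw [image_eq_zero_of_notMem_tsupport hxs, mul_zero]
    _ = 0 := by simp

/-! ### Regularity of the boundary of a domain with a defining function -/

namespace IsDefiningFunction

variable {D : Set Plane} {ρ : Plane → ℝ}

lemma isClosed (hρ : IsDefiningFunction D ρ) : IsClosed D := by
  rw [hρ.eq_sublevel]
  exact isClosed_le hρ.contDiff.continuous continuous_const

lemma hasGradientAt (hρ : IsDefiningFunction D ρ) (x : Plane) :
    HasGradientAt ρ (gradient ρ x) x :=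
  (hρ.contDiff.differentiable (by norm_num) x).hasGradientAt

/-- Moving from a point of `{ρ ≤ 0}` in a direction of decrease of `ρ` stays in `D` for a while. -/
lemma eventually_add_smul_mem (hρ : IsDefiningFunction D ρ) {y w : Plane} (hy : y ∈ D)
    (hw : ρ y = 0 → ⟪gradient ρ y, w⟫ < 0) : ∀ᶠ s : ℝ in 𝓝[>] 0, y + s • w ∈ D := by
  have hc : Continuous fun s : ℝ => ρ (y + s • w) :=
    hρ.contDiff.continuous.comp (by fun_prop)
  simp only [hρ.eq_sublevel, Set.mem_ofPred_eq] at hy ⊢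
  rcases hy.lt_or_eq with h | h
  · have h1 : ∀ᶠ s : ℝ in 𝓝 0, ρ (y + s • w) < 0 := by
      refine hc.continuousAt.eventually_lt_const ?_
      simpa using h
    exact (h1.filter_mono nhdsWithin_le_nhds).mono fun s hs => hs.le
  · have h1 : HasDerivAt (fun s : ℝ => ρ (y + s • w)) ⟪gradient ρ y, w⟫ 0 := by
      have h2 : HasDerivAt (fun s : ℝ => y + s • w) w 0 := by
        simpa using ((hasDerivAt_id (0 : ℝ)).smul_const w).const_add y
      have h3 := (hρ.hasGradientAt y).hasFDerivAt
      have h4 := HasFDerivAt.comp_hasDerivAt_of_eq (0 : ℝ) h3 h2 (by simp)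
      simpa using! h4
    have h5 := h1.hasDerivWithinAt (s := Set.Ioi 0)
    rw [hasDerivWithinAt_iff_tendsto_slope' (by simp)] at h5
    filter_upwards [h5.eventually_lt_const (hw h), self_mem_nhdsWithin] with s hs hs0
    have hs0' : (0 : ℝ) < s := hs0
    simp only [slope, vsub_eq_sub, zero_smul, add_zero, h, sub_zero, smul_eq_mul] at hs
    by_contra hcon
    push Not at hcon
    have : 0 ≤ s⁻¹ * ρ (y + s • w) := by positivity
    linarith

lemma frontier_eq (hρ : IsDefiningFunction D ρ) : frontier D = {x | ρ x = 0} := by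
  have hc := hρ.contDiff.continuous
  ext x
  constructor
  · intro hx
    have : frontier {x | ρ x ≤ 0} ⊆ {x | ρ x = 0} := frontier_le_subset_eq hc continuous_const
    rw [hρ.eq_sublevel] at hx
    exact this hx
  · intro hx
    have hx' : ρ x = 0 := hx
    have hxD : x ∈ D := by rw [hρ.eq_sublevel]; exact hx'.le
    refine ⟨subset_closure hxD, fun hint => ?_⟩
    -- at an interior point of `D` with `ρ = 0` the function `ρ` has a local maximum
    have hmax : IsLocalMax ρ x := by
      filter_upwards [mem_interior_iff_mem_nhds.1 hint] with z hz
      rw [hx']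
      rw [hρ.eq_sublevel] at hz
      exact hz
    refine hρ.gradient_ne_zero x hx' ?_
    rw [gradient, hmax.fderiv_eq_zero, map_zero]

lemma frontier_subset (hρ : IsDefiningFunction D ρ) : frontier D ⊆ D :=
  hρ.isClosed.frontier_subset

lemma gradient_ne_zero_of_mem_frontier (hρ : IsDefiningFunction D ρ) {y : Plane}
    (hy : y ∈ frontier D) : gradient ρ y ≠ 0 :=
  hρ.gradient_ne_zero y (by rw [hρ.frontier_eq] at hy; exact hy)

lemma norm_inwardNormal (hρ : IsDefiningFunction D ρ) {y : Plane} (hy : y ∈ frontier D) :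
    ‖inwardNormal ρ y‖ = 1 := by
  have h := norm_pos_iff.2 (hρ.gradient_ne_zero_of_mem_frontier hy)
  rw [inwardNormal, norm_neg, norm_smul, norm_inv, norm_norm, inv_mul_cancel₀ h.ne']

lemma continuous_gradient (hρ : IsDefiningFunction D ρ) : Continuous (gradient ρ) :=
  (InnerProductSpace.toDual ℝ Plane).symm.continuous.comp
    (hρ.contDiff.continuous_fderiv (by norm_num))

lemma measurable_inwardNormal (hρ : IsDefiningFunction D ρ) : Measurable (inwardNormal ρ) := by
  have h := hρ.continuous_gradient.measurable
  exact (h.norm.inv.smul h).neg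

lemma continuousOn_inwardNormal (hρ : IsDefiningFunction D ρ) :
    ContinuousOn (inwardNormal ρ) (frontier D) := by
  have h := hρ.continuous_gradient
  refine ContinuousOn.neg (ContinuousOn.smul (ContinuousOn.inv₀ h.norm.continuousOn ?_)
    h.continuousOn)
  exact fun y hy => norm_ne_zero_iff.2 (hρ.gradient_ne_zero_of_mem_frontier hy)

end IsDefiningFunction

lemma norm_normalize_sub_normalize_le {E : Type*} [NormedAddCommGroup E] [NormedSpace ℝ E]
    {g h : E} (hg : g ≠ 0) :
    ‖‖g‖⁻¹ • g - ‖h‖⁻¹ • h‖ ≤ 2 * ‖g‖⁻¹ * ‖g - h‖ := by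
  have hg' : 0 < ‖g‖ := norm_pos_iff.2 hg
  have h1 : ‖g‖⁻¹ • g - ‖h‖⁻¹ • h = ‖g‖⁻¹ • (g - h) + (‖g‖⁻¹ - ‖h‖⁻¹) • h := by
    module
  have h2 : ‖(‖g‖⁻¹ - ‖h‖⁻¹) • h‖ ≤ ‖g‖⁻¹ * ‖g - h‖ := by
    rcases eq_or_ne h 0 with rfl | hh
    · simp
      positivity
    have hh' : 0 < ‖h‖ := norm_pos_iff.2 hh
    have h3 : (‖g‖⁻¹ - ‖h‖⁻¹) = ‖g‖⁻¹ * (‖h‖ - ‖g‖) * ‖h‖⁻¹ := by field_simp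
    rw [norm_smul, h3, norm_mul, norm_mul, norm_inv, norm_inv, norm_norm, norm_norm, mul_assoc,
      inv_mul_cancel₀ hh'.ne', mul_one, Real.norm_eq_abs, abs_sub_comm]
    gcongr
    exact abs_norm_sub_norm_le g h
  calc _ ≤ ‖‖g‖⁻¹ • (g - h)‖ + ‖(‖g‖⁻¹ - ‖h‖⁻¹) • h‖ := by rw [h1]; exact norm_add_le _ _
    _ ≤ ‖g‖⁻¹ * ‖g - h‖ + ‖g‖⁻¹ * ‖g - h‖ := by
        gcongr
        rw [norm_smul, norm_inv, norm_norm]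
    _ = _ := by ring

/-- Quantitative form of `C²` regularity of `∂D`: up to a quadratic error with constant
`K`, the set `D` lies on the inner side of its tangent lines and `∂D` lies on them, and the normal
is `K`-Lipschitz. -/
structure BoundaryRegularity (D : Set Plane) (ρ : Plane → ℝ) (K : ℝ) : Prop where
  pos : 0 < K
  inner_ge : ∀ y ∈ frontier D, ∀ z ∈ D, -(K * ‖z - y‖ ^ 2) ≤ ⟪inwardNormal ρ y, z - y⟫
  abs_inner_le : ∀ y ∈ frontier D, ∀ z ∈ frontier D,
    |⟪inwardNormal ρ y, z - y⟫| ≤ K * ‖z - y‖ ^ 2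
  norm_sub_le : ∀ y ∈ frontier D, ∀ z ∈ frontier D,
    ‖inwardNormal ρ y - inwardNormal ρ z‖ ≤ K * ‖y - z‖

lemma IsDefiningFunction.exists_boundaryRegularity {D : Set Plane} {ρ : Plane → ℝ}
    (hρ : IsDefiningFunction D ρ) (hD : Bornology.IsBounded D) :
    ∃ K, BoundaryRegularity D ρ K := by
  obtain ⟨R, hR⟩ := hD.subset_closedBall 0
  have hcv : Convex ℝ (Metric.closedBall (0 : Plane) R) := convex_closedBall _ _
  have hf1 : ContDiff ℝ 1 (fderiv ℝ ρ) := hρ.contDiff.fderiv_right (by norm_num)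
  obtain ⟨M₀, hM₀⟩ := (isCompact_closedBall (0 : Plane) R).exists_bound_of_continuousOn
    (hf1.continuous_fderiv (by norm_num)).continuousOn
  set M := max M₀ 1
  have hM : 0 < M := by positivity
  have hlip : ∀ x ∈ Metric.closedBall (0 : Plane) R, ∀ y ∈ Metric.closedBall (0 : Plane) R,
      ‖fderiv ℝ ρ y - fderiv ℝ ρ x‖ ≤ M * ‖y - x‖ := fun x hx y hy =>
    hcv.norm_image_sub_le_of_norm_fderiv_le (𝕜 := ℝ)
      (fun z _ => hf1.differentiable (by norm_num) z)
      (fun z hz => (hM₀ z hz).trans (le_max_left _ _)) hx hy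
  have hgrad : ∀ x y, ‖gradient ρ y - gradient ρ x‖ = ‖fderiv ℝ ρ y - fderiv ℝ ρ x‖ := by
    intro x y
    rw [gradient, gradient, ← map_sub, LinearIsometryEquiv.norm_map]
  have htaylor : ∀ y ∈ Metric.closedBall (0 : Plane) R, ∀ z ∈ Metric.closedBall (0 : Plane) R,
      |ρ z - ρ y - ⟪gradient ρ y, z - y⟫| ≤ M * ‖z - y‖ ^ 2 := by
    intro y hy z hz
    have hseg : segment ℝ y z ⊆ Metric.closedBall (0 : Plane) R := hcv.segment_subset hy hz
    have h1 := (convex_segment y z).norm_image_sub_le_of_norm_fderiv_le' (𝕜 := ℝ) (f := ρ)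
      (φ := fderiv ℝ ρ y) (C := M * ‖z - y‖)
      (fun x _ => hρ.contDiff.differentiable (by norm_num) x)
      (fun x hx => (hlip y hy x (hseg hx)).trans (by
        gcongr
        have := norm_sub_le_of_mem_segment hx
        exact this))
      (left_mem_segment ℝ y z) (right_mem_segment ℝ y z)
    rw [inner_gradient_left]
    rw [Real.norm_eq_abs] at h1
    calc _ ≤ _ := h1
      _ = _ := by ring
  -- a positive lower bound for the gradient on the compact boundary
  obtain ⟨m, hm, hmle⟩ : ∃ m > 0, ∀ y ∈ frontier D, m ≤ ‖gradient ρ y‖ := by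
    have hcomp : IsCompact (frontier D) :=
      Metric.isCompact_of_isClosed_isBounded isClosed_frontier (hD.subset hρ.frontier_subset)
    rcases (frontier D).eq_empty_or_nonempty with h | h
    · exact ⟨1, one_pos, by simp [h]⟩
    · obtain ⟨y, hy, hmin⟩ := hcomp.exists_isMinOn h hρ.continuous_gradient.norm.continuousOn
      exact ⟨_, norm_pos_iff.2 (hρ.gradient_ne_zero_of_mem_frontier hy), fun z hz => hmin hz⟩
  have hball : ∀ z ∈ D, z ∈ Metric.closedBall (0 : Plane) R := fun z hz => hR hz
  have hinner : ∀ y z, ⟪inwardNormal ρ y, z - y⟫ = -(‖gradient ρ y‖⁻¹ * ⟪gradient ρ y, z - y⟫) := by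
    intro y z
    rw [inwardNormal, inner_neg_left, real_inner_smul_left]
  have hscale : ∀ y ∈ frontier D, ∀ q : ℝ, 0 ≤ q →
      ‖gradient ρ y‖⁻¹ * (M * q) ≤ 2 * M / m * q := by
    intro y hy q hq
    have h1 : ‖gradient ρ y‖⁻¹ ≤ m⁻¹ := by
      gcongr
      exact hmle y hy
    calc _ ≤ m⁻¹ * (M * q) := by gcongr
      _ ≤ 2 * (m⁻¹ * (M * q)) := by
        have : 0 ≤ m⁻¹ * (M * q) := by positivity
        linarith
      _ = _ := by field_simp
  have hzero : ∀ y ∈ frontier D, ρ y = 0 := fun y hy => by rw [hρ.frontier_eq] at hy; exact hy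
  refine ⟨2 * M / m, by positivity, fun y hy z hz => ?_, fun y hy z hz => ?_, fun y hy z hz => ?_⟩
  · have h1 := htaylor y (hball y (hρ.frontier_subset hy)) z (hball z hz)
    have hz' : ρ z ≤ 0 := by rw [hρ.eq_sublevel] at hz; exact hz
    rw [hzero y hy] at h1
    have h2 : ⟪gradient ρ y, z - y⟫ ≤ M * ‖z - y‖ ^ 2 := by
      have := (abs_le.1 h1).1
      linarith
    rw [hinner]
    have h3 : ‖gradient ρ y‖⁻¹ * ⟪gradient ρ y, z - y⟫ ≤ ‖gradient ρ y‖⁻¹ * (M * ‖z - y‖ ^ 2) := by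
      gcongr
    have := hscale y hy (‖z - y‖ ^ 2) (by positivity)
    linarith
  · have h1 := htaylor y (hball y (hρ.frontier_subset hy)) z (hball z (hρ.frontier_subset hz))
    rw [hzero y hy, hzero z hz, sub_zero, zero_sub, abs_neg] at h1
    rw [hinner, abs_neg, abs_mul, abs_of_nonneg (by positivity : 0 ≤ ‖gradient ρ y‖⁻¹)]
    refine le_trans ?_ (hscale y hy (‖z - y‖ ^ 2) (by positivity))
    gcongr
  · have h1 : ‖inwardNormal ρ y - inwardNormal ρ z‖
        = ‖‖gradient ρ y‖⁻¹ • gradient ρ y - ‖gradient ρ z‖⁻¹ • gradient ρ z‖ := by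
      rw [inwardNormal, inwardNormal, ← norm_neg]
      congr 1
      abel
    rw [h1]
    refine (norm_normalize_sub_normalize_le (hρ.gradient_ne_zero_of_mem_frontier hy)).trans ?_
    rw [hgrad]
    have h2 := hlip z (hball z (hρ.frontier_subset hz)) y (hball y (hρ.frontier_subset hy))
    have h3 : ‖gradient ρ y‖⁻¹ ≤ m⁻¹ := by
      gcongr
      exact hmle y hy
    calc _ ≤ 2 * m⁻¹ * (M * ‖y - z‖) := by gcongr
      _ = _ := by field_simp

/-! ### Normal coordinates -/

/-- The point at signed distance `t` from `y` along the outward normal, as a function of `(y, t)`;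
these are normal coordinates near `∂D`. -/
noncomputable def parallelPoint (ρ : Plane → ℝ) (p : Plane × ℝ) : Plane :=
  p.1 - p.2 • inwardNormal ρ p.1

lemma IsDefiningFunction.measurable_parallelPoint {D : Set Plane} {ρ : Plane → ℝ}
    (hρ : IsDefiningFunction D ρ) : Measurable (parallelPoint ρ) :=
  measurable_fst.sub (measurable_snd.smul (hρ.measurable_inwardNormal.comp measurable_fst))

lemma IsDefiningFunction.continuousOn_parallelPoint {D : Set Plane} {ρ : Plane → ℝ}
    (hρ : IsDefiningFunction D ρ) :
    ContinuousOn (parallelPoint ρ) (frontier D ×ˢ Set.univ) := by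
  refine continuousOn_fst.sub (continuousOn_snd.smul ?_)
  exact hρ.continuousOn_inwardNormal.comp continuousOn_fst fun p hp => hp.1

lemma IsDefiningFunction.dist_parallelPoint {D : Set Plane} {ρ : Plane → ℝ}
    (hρ : IsDefiningFunction D ρ) {y : Plane} (hy : y ∈ frontier D) (t : ℝ) :
    dist (parallelPoint ρ (y, t)) y = |t| := by
  rw [dist_eq_norm, parallelPoint]
  simp [norm_smul, hρ.norm_inwardNormal hy]

/-- A nearest point in `D` to an exterior point lies on `∂D`, and the connecting segment is normal
to `∂D`. -/
lemma IsDefiningFunction.eq_parallelPoint_of_nearest {D : Set Plane} {ρ : Plane → ℝ}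
    (hρ : IsDefiningFunction D ρ) {x y : Plane} (hx : x ≠ y) (hy : y ∈ D)
    (hmin : ∀ z ∈ D, dist x y ≤ dist x z) :
    y ∈ frontier D ∧ x = parallelPoint ρ (y, dist x y) := by
  -- `x - y` makes no acute angle with any direction that enters `D`
  have hangle : ∀ w : Plane, (ρ y = 0 → ⟪gradient ρ y, w⟫ < 0) → ⟪x - y, w⟫ ≤ 0 := by
    intro w hw
    have h1 : ∀ᶠ s : ℝ in 𝓝[>] 0, 2 * ⟪x - y, w⟫ ≤ s * ‖w‖ ^ 2 := by
      filter_upwards [hρ.eventually_add_smul_mem hy hw, self_mem_nhdsWithin] with s hs hs0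
      have hs0' : (0 : ℝ) < s := hs0
      have h2 := hmin _ hs
      rw [dist_eq_norm, dist_eq_norm] at h2
      have h3 : ‖x - y‖ ^ 2 ≤ ‖x - (y + s • w)‖ ^ 2 := by gcongr
      have h4 : x - (y + s • w) = (x - y) - s • w := by abel
      rw [h4, norm_sub_sq_real (x - y), norm_smul, real_inner_smul_right, mul_pow,
        Real.norm_eq_abs, sq_abs] at h3
      have h5 : s * (2 * ⟪x - y, w⟫) ≤ s * (s * ‖w‖ ^ 2) := by nlinarith
      exact le_of_mul_le_mul_left h5 hs0'
    have h2 : Tendsto (fun s : ℝ => s * ‖w‖ ^ 2) (𝓝[>] 0) (𝓝 0) := by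
      have : Tendsto (fun s : ℝ => s * ‖w‖ ^ 2) (𝓝 0) (𝓝 (0 * ‖w‖ ^ 2)) :=
        (continuous_id.mul continuous_const).tendsto 0
      rw [zero_mul] at this
      exact this.mono_left nhdsWithin_le_nhds
    have := ge_of_tendsto h2 h1
    linarith
  have hxy : 0 < ‖x - y‖ := norm_pos_iff.2 (sub_ne_zero.2 hx)
  have hρy : ρ y = 0 := by
    by_contra h
    have h1 := hangle (x - y) (fun h' => absurd h' h)
    rw [real_inner_self_eq_norm_sq] at h1
    nlinarith
  have hyf : y ∈ frontier D := by rw [hρ.frontier_eq]; exact hρy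
  refine ⟨hyf, ?_⟩
  set g := gradient ρ y
  have hg : 0 < ‖g‖ := norm_pos_iff.2 (hρ.gradient_ne_zero_of_mem_frontier hyf)
  set α : ℝ := ⟪g, x - y⟫ / ‖g‖ ^ 2
  set q : Plane := (x - y) - α • g
  have hgq : ⟪g, q⟫ = 0 := by
    simp only [q, α, inner_sub_right, real_inner_smul_right, real_inner_self_eq_norm_sq]
    field_simp
    ring
  have hxq : x - y = α • g + q := by simp [q]
  have hqg : ⟪q, g⟫ = 0 := by rw [real_inner_comm, hgq]
  clear_value q α
  have hq : q = 0 := by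
    have h1 : ∀ᶠ ε : ℝ in 𝓝[>] 0, ‖q‖ ^ 2 ≤ ε * (α * ‖g‖ ^ 2) := by
      filter_upwards [self_mem_nhdsWithin] with ε hε
      have hε' : (0 : ℝ) < ε := hε
      have h2 := hangle (q - ε • g) (fun _ => by
        rw [inner_sub_right, hgq, real_inner_smul_right, real_inner_self_eq_norm_sq]
        have : 0 < ε * ‖g‖ ^ 2 := by positivity
        linarith)
      simp only [hxq, inner_add_left, inner_sub_right, real_inner_smul_left, real_inner_smul_right,
        real_inner_self_eq_norm_sq, hgq, hqg] at h2
      linarith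
    have h2 : Tendsto (fun ε : ℝ => ε * (α * ‖g‖ ^ 2)) (𝓝[>] 0) (𝓝 0) := by
      have : Tendsto (fun s : ℝ => s * (α * ‖g‖ ^ 2)) (𝓝 0) (𝓝 (0 * (α * ‖g‖ ^ 2))) :=
        (continuous_id.mul continuous_const).tendsto 0
      rw [zero_mul] at this
      exact this.mono_left nhdsWithin_le_nhds
    have h3 := ge_of_tendsto h2 h1
    have h4 : ‖q‖ = 0 := by nlinarith [norm_nonneg q]
    exact norm_eq_zero.1 h4
  have hα : 0 ≤ α := by
    have h1 := hangle (-g) (fun _ => by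
      rw [inner_neg_right, real_inner_self_eq_norm_sq]
      have : 0 < ‖g‖ ^ 2 := by positivity
      linarith)
    rw [hxq, hq, add_zero, inner_neg_right, real_inner_smul_left, real_inner_self_eq_norm_sq] at h1
    have : 0 < ‖g‖ ^ 2 := by positivity
    nlinarith
  have hdist : dist x y = α * ‖g‖ := by
    rw [dist_eq_norm, hxq, hq, add_zero, norm_smul, Real.norm_eq_abs, abs_of_nonneg hα]
  have hx' : x = y + α • g := by
    have := hxq
    rw [hq, add_zero] at this
    rw [← this]; abel
  rw [hdist, parallelPoint, inwardNormal]
  conv_lhs => rw [hx']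
  simp only [smul_neg, smul_smul, sub_neg_eq_add]
  rw [mul_assoc, mul_inv_cancel₀ hg.ne', mul_one]

namespace BoundaryRegularity

variable {D : Set Plane} {ρ : Plane → ℝ} {K : ℝ}

lemma sq_add_le_dist_sq (hK : BoundaryRegularity D ρ K) (hρ : IsDefiningFunction D ρ) {y z : Plane}
    (hy : y ∈ frontier D) (hz : z ∈ D) {t : ℝ} (ht : 0 ≤ t) :
    t ^ 2 + (1 - 2 * K * t) * dist y z ^ 2 ≤ dist (parallelPoint ρ (y, t)) z ^ 2 := by
  have h1 := hK.inner_ge y hy z hz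
  rw [dist_eq_norm, dist_eq_norm]
  have h2 : parallelPoint ρ (y, t) - z = (y - z) - t • inwardNormal ρ y := by
    simp only [parallelPoint]; abel
  rw [h2, norm_sub_sq_real (y - z), norm_smul, hρ.norm_inwardNormal hy, mul_one,
    Real.norm_eq_abs, sq_abs, real_inner_smul_right, real_inner_comm]
  have h3 : ⟪inwardNormal ρ y, y - z⟫ = - ⟪inwardNormal ρ y, z - y⟫ := by
    rw [← inner_neg_right]; congr 1; abel
  rw [h3]
  rw [norm_sub_rev z y] at h1
  nlinarith

lemma infDist_parallelPoint (hK : BoundaryRegularity D ρ K) (hρ : IsDefiningFunction D ρ)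
    {y : Plane} (hy : y ∈ frontier D) {t : ℝ} (ht : 0 ≤ t) (htK : 2 * K * t < 1) :
    Metric.infDist (parallelPoint ρ (y, t)) D = t := by
  have hyD := hρ.frontier_subset hy
  refine le_antisymm ?_ ?_
  · refine (Metric.infDist_le_dist_of_mem hyD).trans ?_
    rw [hρ.dist_parallelPoint hy, abs_of_nonneg ht]
  · rw [Metric.le_infDist ⟨y, hyD⟩]
    intro z hz
    have h1 := hK.sq_add_le_dist_sq hρ hy hz ht
    have h2 : 0 ≤ (1 - 2 * K * t) * dist y z ^ 2 := by
      have : 0 ≤ 1 - 2 * K * t := by linarith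
      positivity
    exact abs_le_of_sq_le_sq' (by linarith) dist_nonneg |>.2

lemma eq_of_dist_parallelPoint_eq (hK : BoundaryRegularity D ρ K) (hρ : IsDefiningFunction D ρ)
    {y z : Plane} (hy : y ∈ frontier D) (hz : z ∈ D) {t : ℝ} (ht : 0 ≤ t) (htK : 2 * K * t < 1)
    (h : dist (parallelPoint ρ (y, t)) z = t) : y = z := by
  have h1 := hK.sq_add_le_dist_sq hρ hy hz ht
  rw [h] at h1
  have h2 : 0 < 1 - 2 * K * t := by linarith
  have h3 : dist y z ^ 2 ≤ 0 := by nlinarith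
  exact dist_eq_zero.1 (by nlinarith [dist_nonneg (x := y) (y := z)])

lemma injOn_parallelPoint (hK : BoundaryRegularity D ρ K) (hρ : IsDefiningFunction D ρ) {δ : ℝ}
    (hδ : 2 * K * δ ≤ 1) :
    Set.InjOn (parallelPoint ρ) (frontier D ×ˢ Set.Ioo 0 δ) := by
  have hlt : ∀ t ∈ Set.Ioo 0 δ, 2 * K * t < 1 := fun t ht => by
    have := hK.pos
    nlinarith [ht.2]
  rintro ⟨y, t⟩ ⟨hy, ht⟩ ⟨y', t'⟩ ⟨hy', ht'⟩ h
  simp only at hy ht hy' ht'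
  have h1 := hK.infDist_parallelPoint hρ hy ht.1.le (hlt t ht)
  have h2 := hK.infDist_parallelPoint hρ hy' ht'.1.le (hlt t' ht')
  have htt : t = t' := by rw [← h1, ← h2, h]
  subst htt
  have h3 : dist (parallelPoint ρ (y, t)) y' = t := by
    rw [h, hρ.dist_parallelPoint hy', abs_of_nonneg ht.1.le]
  rw [hK.eq_of_dist_parallelPoint_eq hρ hy (hρ.frontier_subset hy') ht.1.le (hlt t ht) h3]

/-- Near `∂D`, the exterior is parametrized by normal coordinates. -/
lemma image_parallelPoint (hK : BoundaryRegularity D ρ K) (hρ : IsDefiningFunction D ρ)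
    (hD : Bornology.IsBounded D) (hne : D.Nonempty) {s t : ℝ} (hs : 0 ≤ s) (ht : 2 * K * t ≤ 1) :
    parallelPoint ρ '' (frontier D ×ˢ Set.Ioo s t)
      = {x | Metric.infDist x D ∈ Set.Ioo s t} := by
  ext x
  constructor
  · rintro ⟨⟨y, r⟩, ⟨hy, hr⟩, rfl⟩
    simp only at hy hr
    have : 2 * K * r < 1 := by
      have := hK.pos
      nlinarith [hr.2]
    simp only [Set.mem_ofPred_eq]
    rw [hK.infDist_parallelPoint hρ hy (hs.trans hr.1.le) this]
    exact hr
  · intro hx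
    have hx' : Metric.infDist x D ∈ Set.Ioo s t := hx
    obtain ⟨y, hy, hxy⟩ := (Metric.isCompact_of_isClosed_isBounded hρ.isClosed hD).exists_infDist_eq_dist
      hne x
    have hne' : x ≠ y := by
      rintro rfl
      rw [dist_self] at hxy
      have := hx'.1
      linarith
    obtain ⟨hyf, hxe⟩ := hρ.eq_parallelPoint_of_nearest hne' hy
      (fun z hz => hxy ▸ Metric.infDist_le_dist_of_mem hz)
    exact ⟨(y, dist x y), ⟨hyf, hxy ▸ hx'⟩, hxe.symm⟩

lemma gradient_infDist_parallelPoint (hK : BoundaryRegularity D ρ K) (hρ : IsDefiningFunction D ρ)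
    {y : Plane} (hy : y ∈ frontier D) {t : ℝ} (ht : 0 < t) (htK : 2 * K * t < 1)
    (hd : DifferentiableAt ℝ (fun x => Metric.infDist x D) (parallelPoint ρ (y, t))) :
    gradient (fun x => Metric.infDist x D) (parallelPoint ρ (y, t)) = -inwardNormal ρ y := by
  set n := inwardNormal ρ y
  set d : Plane → ℝ := fun x => Metric.infDist x D
  set x := parallelPoint ρ (y, t)
  have h1 : fderiv ℝ d x (-n) = 1 := by
    have h2 : HasDerivAt (fun s : ℝ => parallelPoint ρ (y, s)) (-n) t := by
      have := ((hasDerivAt_id t).smul_const n).const_sub y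
      simpa [parallelPoint] using! this
    have h3 : HasDerivAt (fun s : ℝ => d (parallelPoint ρ (y, s))) (fderiv ℝ d x (-n)) t :=
      HasFDerivAt.comp_hasDerivAt (l := d) (l' := fderiv ℝ d x) t hd.hasFDerivAt h2
    have h4 : (fun s : ℝ => d (parallelPoint ρ (y, s))) =ᶠ[𝓝 t] fun s => s := by
      have e1 : ∀ᶠ s : ℝ in 𝓝 t, 0 < s := eventually_gt_nhds ht
      have e2 : ∀ᶠ s : ℝ in 𝓝 t, 2 * K * s < 1 :=
        (continuous_const.mul continuous_id).continuousAt.eventually_lt_const htK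
      filter_upwards [e1, e2] with s hs hs2
      exact hK.infDist_parallelPoint hρ hy hs.le hs2
    exact h3.unique ((hasDerivAt_id t).congr_of_eventuallyEq h4)
  have h5 : ‖gradient d x‖ ≤ 1 := by
    rw [gradient, LinearIsometryEquiv.norm_map]
    have := norm_fderiv_le_of_lipschitz ℝ (f := d) (x₀ := x) (Metric.lipschitz_infDist_pt D)
    simpa using this
  rw [← inner_gradient_left, inner_neg_right] at h1
  have hn : ‖n‖ = 1 := hρ.norm_inwardNormal hy
  have h6 : ‖gradient d x + n‖ ^ 2 ≤ 0 := by
    rw [norm_add_sq_real, hn]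
    nlinarith [norm_nonneg (gradient d x)]
  have h7 : ‖gradient d x + n‖ = 0 := by nlinarith [norm_nonneg (gradient d x + n)]
  exact eq_neg_of_add_eq_zero_left (norm_eq_zero.1 h7)

/-- In normal coordinates the metric is nearly Euclidean on short arcs and near the boundary. -/
lemma parallelPoint_near_isometry (hK : BoundaryRegularity D ρ K) (hρ : IsDefiningFunction D ρ)
    {y y' : Plane} (hy : y ∈ frontier D) (hy' : y' ∈ frontier D) {θ t t' : ℝ} (hθ : 0 < θ)
    (hθ1 : θ < 1) (hyy : K * dist y y' ≤ θ) (ht' : 0 ≤ t') (ht'K : K * t' ≤ θ) :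
    (1 - 2 * θ) * √(dist y y' ^ 2 + (t - t') ^ 2)
        ≤ dist (parallelPoint ρ (y, t)) (parallelPoint ρ (y', t')) ∧
      dist (parallelPoint ρ (y, t)) (parallelPoint ρ (y', t'))
        ≤ (1 + 2 * θ) * √(dist y y' ^ 2 + (t - t') ^ 2) := by
  set P := dist y y' ^ 2 + (t - t') ^ 2 with hP
  have hP0 : 0 ≤ P := by positivity
  set A : Plane := (y - y') - (t - t') • inwardNormal ρ y
  set E : Plane := t' • (inwardNormal ρ y - inwardNormal ρ y')
  have hdec : parallelPoint ρ (y, t) - parallelPoint ρ (y', t') = A - E := by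
    simp only [parallelPoint, A, E]
    module
  have hE : ‖E‖ ≤ θ * √P := by
    have h1 : dist y y' ≤ √P := Real.le_sqrt_of_sq_le (by rw [hP]; nlinarith [sq_nonneg (t - t')])
    rw [norm_smul, Real.norm_eq_abs, abs_of_nonneg ht']
    calc t' * ‖inwardNormal ρ y - inwardNormal ρ y'‖ ≤ t' * (K * ‖y - y'‖) := by
          gcongr; exact hK.norm_sub_le y hy y' hy'
      _ = (K * t') * dist y y' := by rw [dist_eq_norm]; ring
      _ ≤ θ * √P := by gcongr
  have hA : |‖A‖ ^ 2 - P| ≤ θ * P := by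
    have h1 := hK.abs_inner_le y hy y' hy'
    have h2 : ⟪inwardNormal ρ y, y - y'⟫ = - ⟪inwardNormal ρ y, y' - y⟫ := by
      rw [← inner_neg_right]; congr 1; abel
    have h3 : ‖A‖ ^ 2 - P = 2 * ((t - t') * ⟪inwardNormal ρ y, y' - y⟫) := by
      simp only [A]
      rw [norm_sub_sq_real (y - y'), norm_smul, hρ.norm_inwardNormal hy, mul_one,
        Real.norm_eq_abs, sq_abs, real_inner_smul_right, real_inner_comm, h2, hP, dist_eq_norm]
      ring
    rw [h3, abs_mul, abs_mul, abs_two]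
    have h4 : |⟪inwardNormal ρ y, y' - y⟫| ≤ θ * dist y y' := by
      refine h1.trans ?_
      rw [← dist_eq_norm, dist_comm y' y]
      calc _ = K * dist y y' * dist y y' := by ring
        _ ≤ _ := by gcongr
    calc 2 * (|t - t'| * |⟪inwardNormal ρ y, y' - y⟫|) ≤ 2 * (|t - t'| * (θ * dist y y')) := by gcongr
      _ = θ * (2 * |t - t'| * dist y y') := by ring
      _ ≤ θ * P := by
        gcongr
        rw [hP, ← sq_abs (t - t')]
        nlinarith [sq_nonneg (|t - t'| - dist y y')]
  have hsq : √P ^ 2 = P := Real.sq_sqrt hP0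
  have hA1 : ‖A‖ ≤ (1 + θ) * √P := by
    refine abs_le_of_sq_le_sq' ?_ (by positivity) |>.2
    rw [mul_pow, hsq]
    nlinarith [(abs_le.1 hA).2, mul_nonneg hθ.le hP0, mul_nonneg (mul_nonneg hθ.le hθ.le) hP0]
  have hA2 : (1 - θ) * √P ≤ ‖A‖ := by
    refine abs_le_of_sq_le_sq' ?_ (norm_nonneg _) |>.2
    rw [mul_pow, hsq]
    nlinarith [(abs_le.1 hA).1, mul_nonneg hθ.le hP0,
      mul_nonneg (mul_nonneg hθ.le (by linarith : 0 ≤ 1 - θ)) hP0]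
  rw [dist_eq_norm, hdec]
  constructor
  · have := norm_sub_norm_le A E
    linarith
  · have := _root_.norm_sub_le A E
    linarith

/-- Along short arcs of `∂D`, the distance is nearly the distance of the projections to a tangent
line. -/
lemma tangent_near_isometry (hK : BoundaryRegularity D ρ K) {y₀ y y' τ : Plane}
    (hy₀ : y₀ ∈ frontier D) (hy : y ∈ frontier D) (hy' : y' ∈ frontier D)
    (hsq : ∀ w : Plane, ‖w‖ ^ 2 = ⟪τ, w⟫ ^ 2 + ⟪inwardNormal ρ y₀, w⟫ ^ 2) {θ : ℝ} (hθ : 0 < θ)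
    (hθ1 : 2 * θ ≤ 1) (hyy : K * dist y y' ≤ θ) (hyy₀ : K * dist y y₀ ≤ θ) :
    (1 - 2 * θ) * dist y y' ^ 2 ≤ (⟪τ, y⟫ - ⟪τ, y'⟫) ^ 2 := by
  have h1 := hK.abs_inner_le y hy y' hy'
  have h2 : |⟪inwardNormal ρ y₀, y' - y⟫| ≤ 2 * θ * dist y y' := by
    have h3 : ⟪inwardNormal ρ y₀, y' - y⟫
        = ⟪inwardNormal ρ y, y' - y⟫ - ⟪inwardNormal ρ y - inwardNormal ρ y₀, y' - y⟫ := by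
      rw [inner_sub_left]; ring
    have h4 : |⟪inwardNormal ρ y - inwardNormal ρ y₀, y' - y⟫| ≤ θ * dist y y' := by
      refine (abs_real_inner_le_norm _ _).trans ?_
      rw [← dist_eq_norm y' y, dist_comm y' y]
      gcongr
      refine (hK.norm_sub_le y hy y₀ hy₀).trans ?_
      rwa [← dist_eq_norm]
    have h5 : |⟪inwardNormal ρ y, y' - y⟫| ≤ θ * dist y y' := by
      refine h1.trans ?_
      rw [← dist_eq_norm, dist_comm y' y]
      calc _ = K * dist y y' * dist y y' := by ring
        _ ≤ _ := by gcongr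
    rw [h3]
    refine (abs_sub _ _).trans ?_
    linarith
  have h6 := hsq (y' - y)
  rw [← dist_eq_norm, dist_comm, inner_sub_right] at h6
  have h7 : ⟪inwardNormal ρ y₀, y' - y⟫ ^ 2 ≤ (2 * θ * dist y y') ^ 2 := by
    rw [← sq_abs]
    gcongr
  have h8 : (2 * θ * dist y y') ^ 2 ≤ 2 * θ * dist y y' ^ 2 := by
    rw [mul_pow]
    have : (2 * θ) ^ 2 ≤ 2 * θ := by nlinarith
    gcongr
  nlinarith

end BoundaryRegularity

/-- Orthonormal coordinates with prescribed unit vector `n`. -/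
lemma exists_orthogonal_coordinate {n : Plane} (hn : ‖n‖ = 1) :
    ∃ τ : Plane, ∀ w : Plane, ‖w‖ ^ 2 = ⟪τ, w⟫ ^ 2 + ⟪n, w⟫ ^ 2 := by
  refine ⟨!₂[-(n 1), n 0], fun w => ?_⟩
  have h1 : n 0 ^ 2 + n 1 ^ 2 = 1 := by
    have := EuclideanSpace.norm_sq_eq n
    rw [hn, Fin.sum_univ_two] at this
    simpa using this.symm
  rw [EuclideanSpace.norm_sq_eq, Fin.sum_univ_two]
  simp only [PiLp.inner_apply, Fin.sum_univ_two, Real.norm_eq_abs, sq_abs]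
  simp
  linear_combination (-(w 0 ^ 2 + w 1 ^ 2)) * h1

/-! ### Area near a short boundary arc in normal coordinates -/

lemma hausdorffMeasure_image_le_of_dist_le {X Y Z : Type*} [MetricSpace Y] [MeasurableSpace Y]
    [BorelSpace Y] [MetricSpace Z] [MeasurableSpace Z] [BorelSpace Z] {f : X → Y} {g : X → Z}
    {E : Set X} {c : ℝ≥0} {d : ℝ} (hd : 0 ≤ d)
    (h : ∀ p ∈ E, ∀ q ∈ E, dist (f p) (f q) ≤ c * dist (g p) (g q)) :
    Measure.hausdorffMeasure d (f '' E) ≤ (c : ℝ≥0∞) ^ d * Measure.hausdorffMeasure d (g '' E) := by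
  rcases E.eq_empty_or_nonempty with rfl | ⟨p₀, -⟩
  · simp
  have : Nonempty X := ⟨p₀⟩
  have hinv : ∀ p ∈ E, f (Function.invFunOn g E (g p)) = f p := by
    intro p hp
    have h1 := Function.invFunOn_mem (f := g) (s := E) ⟨p, hp, rfl⟩
    have h2 : g (Function.invFunOn g E (g p)) = g p := Function.invFunOn_eq ⟨p, hp, rfl⟩
    have h3 := h _ h1 p hp
    rw [h2, dist_self, mul_zero] at h3
    exact dist_le_zero.1 h3
  have hlip : LipschitzOnWith c (f ∘ Function.invFunOn g E) (g '' E) := by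
    refine LipschitzOnWith.of_dist_le_mul ?_
    rintro _ ⟨p, hp, rfl⟩ _ ⟨q, hq, rfl⟩
    simp only [Function.comp_apply, hinv p hp, hinv q hq]
    exact h p hp q hq
  have him : f '' E = (f ∘ Function.invFunOn g E) '' (g '' E) := by
    rw [Set.image_image]
    exact Set.image_congr fun p hp => (hinv p hp).symm
  rw [him]
  exact hlip.hausdorffMeasure_image_le hd

lemma volume_image_le_of_dist_le {X : Type*} {f g : X → Plane} {E : Set X} {c : ℝ≥0}
    (h : ∀ p ∈ E, ∀ q ∈ E, dist (f p) (f q) ≤ c * dist (g p) (g q)) :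
    volume (f '' E) ≤ (c : ℝ≥0∞) ^ 2 * volume (g '' E) := by
  have h1 := hausdorffMeasure_image_le_of_dist_le (d := (2 : ℕ)) (by norm_num) h
  rw [ENNReal.rpow_natCast] at h1
  rw [← EuclideanSpace.euclideanHausdorffMeasure_eq_volume,
    Measure.euclideanHausdorffMeasure_def, Measure.smul_apply, Measure.smul_apply,
    ENNReal.smul_def, ENNReal.smul_def, smul_eq_mul, smul_eq_mul, mul_left_comm]
  gcongr

/-- The plane as a product of two lines. -/
noncomputable def planeOfProd (p : ℝ × ℝ) : Plane := !₂[p.1, p.2]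

lemma dist_planeOfProd (p q : ℝ × ℝ) :
    dist (planeOfProd p) (planeOfProd q) = √((p.1 - q.1) ^ 2 + (p.2 - q.2) ^ 2) := by
  simp [planeOfProd, EuclideanSpace.dist_eq, Fin.sum_univ_two, Real.dist_eq, sq_abs]

lemma volume_planeOfProd_image (E : Set (ℝ × ℝ)) : volume (planeOfProd '' E) = volume E := by
  have h1 := (EuclideanSpace.volume_preserving_symm_measurableEquiv_toLp (Fin 2)).trans
    (volume_preserving_finTwoArrow ℝ)
  have h2 := h1.measure_preimage_equiv E
  rw [← h2]
  congr 1
  ext x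
  constructor
  · rintro ⟨p, hp, rfl⟩
    simpa [planeOfProd] using! hp
  · intro hx
    refine ⟨_, hx, ?_⟩
    ext i
    fin_cases i <;> simp [planeOfProd, MeasurableEquiv.finTwoArrow]

namespace BoundaryRegularity

variable {D : Set Plane} {ρ : Plane → ℝ} {K : ℝ}

/-- On a short arc `A` of `∂D`, projection to a tangent line and normal coordinates are bi-Lipschitz
with constant close to `1`. -/
lemma exists_chart (hK : BoundaryRegularity D ρ K) (hρ : IsDefiningFunction D ρ) {θ δ : ℝ}
    {c : ℝ≥0} (hθ : 0 < θ) (hθ1 : 2 * θ < 1) (hc : 1 + 2 * θ ≤ c * (1 - 2 * θ))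
    (hδ : K * δ ≤ θ) {A : Set Plane} (hA : A ⊆ frontier D)
    (hdiam : ∀ y ∈ A, ∀ y' ∈ A, K * dist y y' ≤ θ) {y₀ : Plane} (hy₀ : y₀ ∈ A) :
    ∃ τ : Plane,
      (∀ y ∈ A, ∀ y' ∈ A, dist ⟪τ, y⟫ ⟪τ, y'⟫ ≤ (1 : ℝ≥0) * dist y y') ∧
      (∀ y ∈ A, ∀ y' ∈ A, dist y y' ≤ c * dist ⟪τ, y⟫ ⟪τ, y'⟫) ∧
      (∀ p ∈ A ×ˢ Set.Ioo 0 δ, ∀ q ∈ A ×ˢ Set.Ioo 0 δ,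
        dist (parallelPoint ρ p) (parallelPoint ρ q)
          ≤ c * dist (planeOfProd (⟪τ, p.1⟫, p.2)) (planeOfProd (⟪τ, q.1⟫, q.2))) ∧
      (∀ p ∈ A ×ˢ Set.Ioo 0 δ, ∀ q ∈ A ×ˢ Set.Ioo 0 δ,
        dist (planeOfProd (⟪τ, p.1⟫, p.2)) (planeOfProd (⟪τ, q.1⟫, q.2))
          ≤ c * dist (parallelPoint ρ p) (parallelPoint ρ q)) := by
  obtain ⟨τ, hτ⟩ := exists_orthogonal_coordinate (hρ.norm_inwardNormal (hA hy₀))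
  have hθ2 : 0 < 1 - 2 * θ := by linarith
  have hup : ∀ y y' : Plane, (⟪τ, y⟫ - ⟪τ, y'⟫) ^ 2 ≤ dist y y' ^ 2 := by
    intro y y'
    rw [dist_eq_norm, hτ, inner_sub_right]
    nlinarith [sq_nonneg ⟪inwardNormal ρ y₀, y - y'⟫]
  have hlow : ∀ y ∈ A, ∀ y' ∈ A, (1 - 2 * θ) * dist y y' ^ 2 ≤ (⟪τ, y⟫ - ⟪τ, y'⟫) ^ 2 :=
    fun y hy y' hy' => hK.tangent_near_isometry (hA hy₀) (hA hy) (hA hy') hτ hθ hθ1.le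
      (hdiam y hy y' hy') (hdiam y hy y₀ hy₀)
  -- the planar chart is nearly isometric for the product metric
  have hchart : ∀ p ∈ A ×ˢ Set.Ioo 0 δ, ∀ q ∈ A ×ˢ Set.Ioo 0 δ,
      (1 - 2 * θ) * √(dist p.1 q.1 ^ 2 + (p.2 - q.2) ^ 2)
        ≤ dist (planeOfProd (⟪τ, p.1⟫, p.2)) (planeOfProd (⟪τ, q.1⟫, q.2)) ∧
      dist (planeOfProd (⟪τ, p.1⟫, p.2)) (planeOfProd (⟪τ, q.1⟫, q.2))
        ≤ √(dist p.1 q.1 ^ 2 + (p.2 - q.2) ^ 2) := by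
    intro p hp q hq
    rw [dist_planeOfProd]
    constructor
    · refine Real.le_sqrt_of_sq_le ?_
      rw [mul_pow, Real.sq_sqrt (by positivity)]
      have h1 := hlow p.1 hp.1 q.1 hq.1
      have h2 : (1 - 2 * θ) ^ 2 ≤ 1 - 2 * θ := by nlinarith
      have h3 : 0 ≤ dist p.1 q.1 ^ 2 := by positivity
      have h4 : 0 ≤ (p.2 - q.2) ^ 2 := by positivity
      simp only
      nlinarith
    · refine Real.sqrt_le_sqrt ?_
      have := hup p.1 q.1
      simp only
      linarith
  have hpar : ∀ p ∈ A ×ˢ Set.Ioo 0 δ, ∀ q ∈ A ×ˢ Set.Ioo 0 δ,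
      (1 - 2 * θ) * √(dist p.1 q.1 ^ 2 + (p.2 - q.2) ^ 2)
        ≤ dist (parallelPoint ρ p) (parallelPoint ρ q) ∧
      dist (parallelPoint ρ p) (parallelPoint ρ q)
        ≤ (1 + 2 * θ) * √(dist p.1 q.1 ^ 2 + (p.2 - q.2) ^ 2) := by
    intro p hp q hq
    refine hK.parallelPoint_near_isometry hρ (hA hp.1) (hA hq.1) hθ (by linarith)
      (hdiam _ hp.1 _ hq.1) hq.2.1.le ?_
    have := hK.pos
    nlinarith [hq.2.2]
  have hc0 : (0 : ℝ) ≤ c := c.2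
  refine ⟨τ, fun y _ y' _ => ?_, fun y hy y' hy' => ?_, fun p hp q hq => ?_, fun p hp q hq => ?_⟩
  · rw [Real.dist_eq, NNReal.coe_one, one_mul]
    exact abs_le_of_sq_le_sq (hup y y') dist_nonneg
  · rw [Real.dist_eq]
    have h1 : (1 - 2 * θ) * dist y y' ≤ |⟪τ, y⟫ - ⟪τ, y'⟫| := by
      refine abs_le_of_sq_le_sq' ?_ (abs_nonneg _) |>.2
      rw [mul_pow, sq_abs]
      have h2 : (1 - 2 * θ) ^ 2 ≤ 1 - 2 * θ := by nlinarith
      have h3 : 0 ≤ dist y y' ^ 2 := by positivity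
      have := hlow y hy y' hy'
      nlinarith
    have h4 : 0 ≤ dist y y' := dist_nonneg
    calc dist y y' ≤ (1 + 2 * θ) * dist y y' := by nlinarith
      _ ≤ c * (1 - 2 * θ) * dist y y' := by gcongr
      _ = c * ((1 - 2 * θ) * dist y y') := by ring
      _ ≤ _ := by gcongr
  · obtain ⟨-, h1⟩ := hpar p hp q hq
    obtain ⟨h2, -⟩ := hchart p hp q hq
    refine h1.trans ?_
    have h3 := Real.sqrt_nonneg (dist p.1 q.1 ^ 2 + (p.2 - q.2) ^ 2)
    calc _ ≤ c * (1 - 2 * θ) * √(dist p.1 q.1 ^ 2 + (p.2 - q.2) ^ 2) := by gcongr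
      _ = c * ((1 - 2 * θ) * √(dist p.1 q.1 ^ 2 + (p.2 - q.2) ^ 2)) := by ring
      _ ≤ _ := by gcongr
  · obtain ⟨h1, -⟩ := hpar p hp q hq
    obtain ⟨-, h2⟩ := hchart p hp q hq
    refine h2.trans ?_
    have h3 := Real.sqrt_nonneg (dist p.1 q.1 ^ 2 + (p.2 - q.2) ^ 2)
    calc _ ≤ (1 + 2 * θ) * √(dist p.1 q.1 ^ 2 + (p.2 - q.2) ^ 2) := by nlinarith
      _ ≤ c * (1 - 2 * θ) * √(dist p.1 q.1 ^ 2 + (p.2 - q.2) ^ 2) := by gcongr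
      _ = c * ((1 - 2 * θ) * √(dist p.1 q.1 ^ 2 + (p.2 - q.2) ^ 2)) := by ring
      _ ≤ _ := by gcongr

lemma hausdorffMeasure_frontier_lt_top (hK : BoundaryRegularity D ρ K)
    (hρ : IsDefiningFunction D ρ) (hD : Bornology.IsBounded D) :
    Measure.hausdorffMeasure 1 (frontier D) < ∞ := by
  have hcomp : IsCompact (frontier D) :=
    Metric.isCompact_of_isClosed_isBounded isClosed_frontier (hD.subset hρ.frontier_subset)
  refine hcomp.measure_lt_top_of_nhdsWithin fun y₀ hy₀ => ?_
  set r : ℝ := 1 / (10 * K)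
  have hKpos := hK.pos
  have hr : 0 < r := by positivity
  refine ⟨frontier D ∩ Metric.ball y₀ r, inter_mem_nhdsWithin _ (Metric.ball_mem_nhds _ hr), ?_⟩
  set A := frontier D ∩ Metric.ball y₀ r
  have hdiam : ∀ y ∈ A, ∀ y' ∈ A, K * dist y y' ≤ 1 / 5 := by
    intro y hy y' hy'
    have h1 := dist_triangle_right y y' y₀
    have h2 : dist y y₀ < r := hy.2
    have h3 : dist y' y₀ < r := hy'.2
    have h4 : K * r = 1 / 10 := by simp only [r]; field_simp
    nlinarith
  obtain ⟨τ, -, h2, -⟩ := hK.exists_chart hρ (θ := 1 / 5) (δ := 0) (c := 3) (by norm_num)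
    (by norm_num) (by norm_num) (by norm_num) (A := A) Set.inter_subset_left hdiam
    (y₀ := y₀) ⟨hy₀, Metric.mem_ball_self hr⟩
  have h3 := hausdorffMeasure_image_le_of_dist_le (f := fun y : Plane => y)
    (g := fun y : Plane => ⟪τ, y⟫) (d := 1) (by norm_num) h2
  rw [Set.image_id', hausdorffMeasure_real] at h3
  refine h3.trans_lt (ENNReal.mul_lt_top (by simp) ?_)
  have hb : Bornology.IsBounded ((fun y : Plane => ⟪τ, y⟫) '' A) := by
    have : LipschitzWith ‖innerSL ℝ τ‖₊ (fun y : Plane => ⟪τ, y⟫) := (innerSL ℝ τ).lipschitz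
    exact this.isBounded_image (Metric.isBounded_ball.subset Set.inter_subset_right)
  exact hb.measure_lt_top

/-- Comparison of area with the product of arc length and distance, over a short arc. -/
lemma volume_image_parallelPoint_of_small (hK : BoundaryRegularity D ρ K)
    (hρ : IsDefiningFunction D ρ) [SFinite (boundaryMeasure D)] {θ δ : ℝ}
    {c : ℝ≥0} (hθ : 0 < θ) (hθ1 : 2 * θ < 1) (hc : 1 + 2 * θ ≤ c * (1 - 2 * θ))
    (hδ : K * δ ≤ θ) {A : Set Plane} (hA : A ⊆ frontier D)
    (hdiam : ∀ y ∈ A, ∀ y' ∈ A, K * dist y y' ≤ θ) {E : Set (Plane × ℝ)} (hE : MeasurableSet E)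
    (hEA : E ⊆ A ×ˢ Set.Ioo 0 δ) :
    volume (parallelPoint ρ '' E) ≤ (c : ℝ≥0∞) ^ 2 * (boundaryMeasure D).prod volume E ∧
      (boundaryMeasure D).prod volume E ≤ (c : ℝ≥0∞) ^ 3 * volume (parallelPoint ρ '' E) := by
  rcases E.eq_empty_or_nonempty with rfl | ⟨p₀, hp₀⟩
  · simp
  obtain ⟨τ, h1, h2, h3, h4⟩ := hK.exists_chart hρ hθ hθ1 hc hδ hA hdiam (hEA hp₀).1
  set κ : Plane × ℝ → ℝ × ℝ := fun p => (⟪τ, p.1⟫, p.2) with hκ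
  have hκc : Continuous κ := by fun_prop
  have hκinj : Set.InjOn κ E := by
    intro p hp q hq h
    have e1 : ⟪τ, p.1⟫ = ⟪τ, q.1⟫ := congrArg (fun r : ℝ × ℝ => r.1) h
    have e2 : p.2 = q.2 := congrArg (fun r : ℝ × ℝ => r.2) h
    have e3 := h2 p.1 (hEA hp).1 q.1 (hEA hq).1
    rw [e1, dist_self, mul_zero] at e3
    exact Prod.ext (dist_le_zero.1 e3) e2
  have hκE : MeasurableSet (κ '' E) := hE.image_of_continuousOn_injOn hκc.continuousOn hκinj
  have e1 : volume (parallelPoint ρ '' E) ≤ (c : ℝ≥0∞) ^ 2 * volume (κ '' E) := by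
    rw [← volume_planeOfProd_image, Set.image_image]
    exact volume_image_le_of_dist_le fun p hp q hq => h3 p (hEA hp) q (hEA hq)
  have e2 : volume (κ '' E) ≤ (c : ℝ≥0∞) ^ 2 * volume (parallelPoint ρ '' E) := by
    rw [← volume_planeOfProd_image, Set.image_image]
    exact volume_image_le_of_dist_le fun p hp q hq => h4 p (hEA hp) q (hEA hq)
  -- slices of the image are images of slices
  have hslice : ∀ t : ℝ, (fun a => (a, t)) ⁻¹' (κ '' E)
      = (fun y : Plane => ⟪τ, y⟫) '' ((fun y => (y, t)) ⁻¹' E) := by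
    intro t
    ext a
    constructor
    · rintro ⟨⟨y, t'⟩, hp, he⟩
      simp only [hκ, Prod.mk.injEq] at he
      obtain ⟨rfl, rfl⟩ := he
      exact ⟨y, hp, rfl⟩
    · rintro ⟨y, hy, rfl⟩
      exact ⟨(y, t), hy, rfl⟩
  have hS : ∀ t : ℝ, boundaryMeasure D ((fun y => (y, t)) ⁻¹' E)
      = Measure.hausdorffMeasure 1 ((fun y => (y, t)) ⁻¹' E) := by
    intro t
    rw [boundaryMeasure, Measure.restrict_apply (measurable_prodMk_right hE)]
    congr 1
    exact Set.inter_eq_left.2 fun y hy => hA (hEA hy).1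
  have hmem : ∀ t : ℝ, ∀ y ∈ (fun y => (y, t)) ⁻¹' E, y ∈ A := fun t y hy => (hEA hy).1
  have hv : volume (κ '' E) = ∫⁻ t, volume ((fun a => (a, t)) ⁻¹' (κ '' E)) := by
    rw [Measure.volume_eq_prod, Measure.prod_apply_symm hκE]
  have e3 : volume (κ '' E) ≤ (boundaryMeasure D).prod volume E := by
    rw [hv, Measure.prod_apply_symm hE]
    refine lintegral_mono fun t => ?_
    rw [hslice, hS, ← hausdorffMeasure_real]
    have := hausdorffMeasure_image_le_of_dist_le (f := fun y : Plane => ⟪τ, y⟫)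
      (g := fun y : Plane => y) (E := (fun y => (y, t)) ⁻¹' E) (c := 1) (d := 1) (by norm_num)
      (fun y hy y' hy' => h1 y (hmem t y hy) y' (hmem t y' hy'))
    simpa using this
  have e4 : (boundaryMeasure D).prod volume E ≤ c * volume (κ '' E) := by
    rw [hv, Measure.prod_apply_symm hE, ← lintegral_const_mul' _ _ ENNReal.coe_ne_top]
    refine lintegral_mono fun t => ?_
    simp only
    rw [hslice, hS, ← hausdorffMeasure_real]
    have := hausdorffMeasure_image_le_of_dist_le (g := fun y : Plane => ⟪τ, y⟫)
      (f := fun y : Plane => y) (E := (fun y => (y, t)) ⁻¹' E) (c := c) (d := 1) (by norm_num)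
      (fun y hy y' hy' => h2 y (hmem t y hy) y' (hmem t y' hy'))
    simpa using this
  refine ⟨e1.trans (by gcongr), e4.trans ?_⟩
  calc _ ≤ (c : ℝ≥0∞) * ((c : ℝ≥0∞) ^ 2 * volume (parallelPoint ρ '' E)) := by gcongr
    _ = _ := by ring

end BoundaryRegularity

/-! ### Area near the whole boundary in normal coordinates -/

lemma IsDefiningFunction.isFiniteMeasure_boundaryMeasure {D : Set Plane} {ρ : Plane → ℝ}
    (hρ : IsDefiningFunction D ρ) (hD : Bornology.IsBounded D) :
    IsFiniteMeasure (boundaryMeasure D) := by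
  obtain ⟨K, hK⟩ := hρ.exists_boundaryRegularity hD
  exact ⟨by
    rw [boundaryMeasure, Measure.restrict_apply_univ]
    exact hK.hausdorffMeasure_frontier_lt_top hρ hD⟩

/-- The points whose distance to `D` lies strictly between `s` and `t`. -/
def exteriorLayer (D : Set Plane) (s t : ℝ) : Set Plane := {x | Metric.infDist x D ∈ Set.Ioo s t}

lemma exteriorLayer_subset_compl (D : Set Plane) {s t : ℝ} (hs : 0 ≤ s) :
    exteriorLayer D s t ⊆ Dᶜ := by
  intro x hx hxD
  have h1 := hx.1
  rw [Metric.infDist_zero_of_mem hxD] at h1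
  linarith

/-- The product of arc length and Lebesgue measure on `∂D × (s, t)`. -/
noncomputable def normalMeasure (D : Set Plane) (s t : ℝ) : Measure (Plane × ℝ) :=
  (boundaryMeasure D).prod (volume.restrict (Set.Ioo s t))

lemma normalMeasure_eq_restrict (D : Set Plane) [SFinite (boundaryMeasure D)] (s t : ℝ) :
    normalMeasure D s t
      = ((boundaryMeasure D).prod volume).restrict (frontier D ×ˢ Set.Ioo s t) := by
  have h : boundaryMeasure D = (boundaryMeasure D).restrict (frontier D) := by
    rw [boundaryMeasure, Measure.restrict_restrict isClosed_frontier.measurableSet, Set.inter_self]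
  rw [normalMeasure]
  conv_lhs => rw [h]
  rw [Measure.prod_restrict]

lemma ae_mem_normalMeasure (D : Set Plane) [SFinite (boundaryMeasure D)] (s t : ℝ) :
    ∀ᵐ p ∂(normalMeasure D s t), p ∈ frontier D ×ˢ Set.Ioo s t := by
  rw [normalMeasure_eq_restrict]
  exact ae_restrict_mem (isClosed_frontier.measurableSet.prod measurableSet_Ioo)

namespace BoundaryRegularity

variable {D : Set Plane} {ρ : Plane → ℝ} {K : ℝ}

/-- Comparison of area with the product of arc length and distance, near the whole boundary. -/
lemma volume_image_parallelPoint (hK : BoundaryRegularity D ρ K)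
    (hρ : IsDefiningFunction D ρ) [SFinite (boundaryMeasure D)] {θ δ : ℝ}
    {c : ℝ≥0} (hθ : 0 < θ) (hθ1 : 2 * θ < 1) (hc : 1 + 2 * θ ≤ c * (1 - 2 * θ))
    (hδ : K * δ ≤ θ) {E : Set (Plane × ℝ)} (hE : MeasurableSet E)
    (hED : E ⊆ frontier D ×ˢ Set.Ioo 0 δ) :
    volume (parallelPoint ρ '' E) ≤ (c : ℝ≥0∞) ^ 2 * (boundaryMeasure D).prod volume E ∧
      (boundaryMeasure D).prod volume E ≤ (c : ℝ≥0∞) ^ 3 * volume (parallelPoint ρ '' E) := by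
  have hKpos := hK.pos
  -- decompose along a fine square grid in the plane
  set r : ℝ := θ / (2 * K) with hr
  have hr0 : 0 < r := by positivity
  set q : Plane → ℤ × ℤ := fun y => (⌊y 0 / r⌋, ⌊y 1 / r⌋) with hq
  have hqm : Measurable q := by
    refine Measurable.prodMk ?_ ?_
    · exact Int.measurable_floor.comp (by fun_prop)
    · exact Int.measurable_floor.comp (by fun_prop)
  set P : ℤ × ℤ → Set (Plane × ℝ) := fun k => E ∩ (fun p => q p.1) ⁻¹' {k} with hP
  have hPm : ∀ k, MeasurableSet (P k) := fun k =>
    hE.inter ((hqm.comp measurable_fst) (measurableSet_singleton k))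
  have hPE : E = ⋃ k, P k := by
    rw [hP, ← Set.inter_iUnion]
    refine (Set.inter_eq_left.2 fun p _ => Set.mem_iUnion.2 ⟨q p.1, rfl⟩).symm
  have hPd : Pairwise (Function.onFun Disjoint P) := by
    intro k l hkl
    refine Set.disjoint_left.2 fun p hp hp' => hkl ?_
    rw [← show q p.1 = k from hp.2, ← show q p.1 = l from hp'.2]
  have hcell : ∀ k, ∀ y ∈ frontier D ∩ q ⁻¹' {k}, ∀ y' ∈ frontier D ∩ q ⁻¹' {k},
      K * dist y y' ≤ θ := by
    intro k y hy y' hy'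
    have h1 : q y = q y' := (show q y = k from hy.2).trans (show q y' = k from hy'.2).symm
    simp only [hq, Prod.mk.injEq] at h1
    have hcoord : ∀ a b : ℝ, ⌊a / r⌋ = ⌊b / r⌋ → |a - b| ≤ r := by
      intro a b hab
      have h2 := Int.abs_sub_lt_one_of_floor_eq_floor hab
      rw [← sub_div, abs_div, abs_of_pos hr0, div_lt_one hr0] at h2
      exact h2.le
    have e0 := hcoord _ _ h1.1
    have e1 := hcoord _ _ h1.2
    have h3 : dist y y' ≤ 2 * r := by
      rw [EuclideanSpace.dist_eq, Fin.sum_univ_two]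
      refine Real.sqrt_le_iff.2 ⟨by positivity, ?_⟩
      rw [Real.dist_eq, Real.dist_eq]
      nlinarith [abs_nonneg (y 0 - y' 0), abs_nonneg (y 1 - y' 1)]
    calc K * dist y y' ≤ K * (2 * r) := by gcongr
      _ = θ := by rw [hr]; field_simp
  have hinj : Set.InjOn (parallelPoint ρ) E :=
    (hK.injOn_parallelPoint hρ (by linarith)).mono hED
  have hcont : ContinuousOn (parallelPoint ρ) E :=
    hρ.continuousOn_parallelPoint.mono fun p hp => ⟨(hED hp).1, trivial⟩
  have hsub : ∀ k, P k ⊆ E := fun k => Set.inter_subset_left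
  have himm : ∀ k, MeasurableSet (parallelPoint ρ '' P k) := fun k =>
    (hPm k).image_of_continuousOn_injOn (hcont.mono (hsub k)) (hinj.mono (hsub k))
  have himd : Pairwise (Function.onFun Disjoint fun k => parallelPoint ρ '' P k) := by
    intro k l hkl
    exact (hPd hkl).image hinj (hsub k) (hsub l)
  have hloc : ∀ k, _ := fun k => hK.volume_image_parallelPoint_of_small hρ hθ hθ1 hc hδ
    (A := frontier D ∩ q ⁻¹' {k}) Set.inter_subset_left (hcell k) (hPm k)
    (fun p hp => ⟨⟨(hED hp.1).1, hp.2⟩, (hED hp.1).2⟩)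
  have hvol : volume (parallelPoint ρ '' E) = ∑' k, volume (parallelPoint ρ '' P k) := by
    conv_lhs => rw [hPE, Set.image_iUnion]
    exact measure_iUnion himd himm
  have hprod : (boundaryMeasure D).prod volume E = ∑' k, (boundaryMeasure D).prod volume (P k) := by
    conv_lhs => rw [hPE]
    exact measure_iUnion hPd hPm
  rw [hvol, hprod, ← ENNReal.tsum_mul_left, ← ENNReal.tsum_mul_left]
  exact ⟨ENNReal.tsum_le_tsum fun k => (hloc k).1, ENNReal.tsum_le_tsum fun k => (hloc k).2⟩

end BoundaryRegularity

/-- In normal coordinates, area near `∂D` is asymptotically the product of arc length and distance: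
the two measures agree up to a factor `1 + ε` in a thin enough layer. -/
theorem IsDefiningFunction.exists_layer_comparison {D : Set Plane} {ρ : Plane → ℝ}
    (hρ : IsDefiningFunction D ρ) (hD : Bornology.IsBounded D) (hne : D.Nonempty) {ε : ℝ}
    (hε : 0 < ε) :
    ∃ δ > 0, ∀ s t : ℝ, 0 ≤ s → t ≤ δ →
      volume.restrict (exteriorLayer D s t)
          ≤ ENNReal.ofReal (1 + ε) • (normalMeasure D s t).map (parallelPoint ρ) ∧
        (normalMeasure D s t).map (parallelPoint ρ)
          ≤ ENNReal.ofReal (1 + ε) • volume.restrict (exteriorLayer D s t) := by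
  obtain ⟨K, hK⟩ := hρ.exists_boundaryRegularity hD
  have := hρ.isFiniteMeasure_boundaryMeasure hD
  have hKpos := hK.pos
  set η : ℝ := min 1 (ε / 7)
  have hη0 : 0 < η := by positivity
  have hη1 : η ≤ 1 := min_le_left _ _
  have hηε : 7 * η ≤ ε := by
    have : η ≤ ε / 7 := min_le_right _ _
    linarith
  set c : ℝ≥0 := ⟨1 + η, by positivity⟩
  have hcv : (c : ℝ) = 1 + η := rfl
  -- this value of `θ` makes `(1 + 2θ) / (1 - 2θ) = 1 + η`
  set θ : ℝ := η / (2 * (2 + η)) with hθdef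
  have hθ : 0 < θ := by positivity
  have hθη : 2 * θ * (2 + η) = η := by rw [hθdef]; field_simp
  have hθ1 : 2 * θ < 1 := by nlinarith
  have hc : 1 + 2 * θ ≤ c * (1 - 2 * θ) := by rw [hcv]; nlinarith
  have hc1 : (1 : ℝ≥0∞) ≤ c := by
    rw [← ENNReal.coe_one, ENNReal.coe_le_coe]
    exact NNReal.coe_le_coe.1 (by rw [hcv, NNReal.coe_one]; linarith)
  have hc3 : (c : ℝ≥0∞) ^ 3 ≤ ENNReal.ofReal (1 + ε) := by
    rw [← ENNReal.ofReal_coe_nnreal, ← ENNReal.ofReal_pow c.coe_nonneg, hcv]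
    refine ENNReal.ofReal_le_ofReal ?_
    nlinarith [mul_nonneg hη0.le (sub_nonneg.2 hη1), mul_nonneg (mul_nonneg hη0.le hη0.le)
      (sub_nonneg.2 hη1)]
  have hc2 : (c : ℝ≥0∞) ^ 2 ≤ ENNReal.ofReal (1 + ε) :=
    (pow_le_pow_right₀ hc1 (by norm_num)).trans hc3
  refine ⟨θ / K, by positivity, fun s t hs ht => ?_⟩
  have hδ : K * (θ / K) ≤ θ := by rw [mul_div_cancel₀ _ hKpos.ne']
  have htK : 2 * K * t ≤ 1 := by
    have : K * t ≤ K * (θ / K) := by gcongr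
    linarith
  have hkey : ∀ X : Set Plane, MeasurableSet X →
      volume.restrict (exteriorLayer D s t) X
          ≤ ENNReal.ofReal (1 + ε) * (normalMeasure D s t).map (parallelPoint ρ) X ∧
        (normalMeasure D s t).map (parallelPoint ρ) X
          ≤ ENNReal.ofReal (1 + ε) * volume.restrict (exteriorLayer D s t) X := by
    intro X hX
    set E := parallelPoint ρ ⁻¹' X ∩ frontier D ×ˢ Set.Ioo s t
    have hpre : MeasurableSet (parallelPoint ρ ⁻¹' X) := hρ.measurable_parallelPoint hX
    have hE : MeasurableSet E :=
      hpre.inter (isClosed_frontier.measurableSet.prod measurableSet_Ioo)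
    have hED : E ⊆ frontier D ×ˢ Set.Ioo 0 (θ / K) := fun p hp =>
      ⟨hp.2.1, hs.trans_lt hp.2.2.1, hp.2.2.2.trans_le ht⟩
    have him : parallelPoint ρ '' E = X ∩ exteriorLayer D s t := by
      rw [exteriorLayer, ← hK.image_parallelPoint hρ hD hne hs htK]
      exact Set.image_preimage_inter _ _ _
    have h1 : volume.restrict (exteriorLayer D s t) X = volume (parallelPoint ρ '' E) := by
      rw [Measure.restrict_apply hX, him]
    have h2 : (normalMeasure D s t).map (parallelPoint ρ) X
        = (boundaryMeasure D).prod volume E := by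
      rw [Measure.map_apply hρ.measurable_parallelPoint hX, normalMeasure_eq_restrict,
        Measure.restrict_apply hpre]
    rw [h1, h2]
    obtain ⟨h3, h4⟩ := hK.volume_image_parallelPoint hρ hθ hθ1 hc hδ hE hED
    exact ⟨h3.trans (by gcongr), h4.trans (by gcongr)⟩
  refine ⟨Measure.le_iff.2 fun X hX => ?_, Measure.le_iff.2 fun X hX => ?_⟩
  · exact (hkey X hX).1
  · exact (hkey X hX).2

/-- Integrals against two measures that agree up to a factor `1 + ε` are close. -/
lemma abs_integral_sub_integral_le_of_le {α : Type*} [MeasurableSpace α] {μ ν : Measure α}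
    {ε : ℝ} (hε : 0 ≤ ε) (h1 : μ ≤ ENNReal.ofReal (1 + ε) • ν)
    (h2 : ν ≤ ENNReal.ofReal (1 + ε) • μ) {f : α → ℝ} (hf : Integrable f ν) :
    |∫ x, f x ∂μ - ∫ x, f x ∂ν| ≤ 3 * (ε * (1 + ε)) * ∫ x, |f x| ∂ν := by
  have hfμ : ∀ {g : α → ℝ}, Integrable g ν → Integrable g μ := fun hg =>
    (hg.smul_measure (c := ENNReal.ofReal (1 + ε)) ENNReal.ofReal_ne_top).mono_measure h1
  have hpos : ∀ g : α → ℝ, (∀ x, 0 ≤ g x) → Integrable g ν →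
      |∫ x, g x ∂μ - ∫ x, g x ∂ν| ≤ ε * (1 + ε) * ∫ x, g x ∂ν := by
    intro g hg0 hg
    have e1 : ∫ x, g x ∂μ ≤ (1 + ε) * ∫ x, g x ∂ν := by
      have := integral_mono_measure h1 (.of_forall hg0)
        (hg.smul_measure (c := ENNReal.ofReal (1 + ε)) ENNReal.ofReal_ne_top)
      rwa [integral_smul_measure, ENNReal.toReal_ofReal (by positivity), smul_eq_mul] at this
    have e2 : ∫ x, g x ∂ν ≤ (1 + ε) * ∫ x, g x ∂μ := by
      have := integral_mono_measure h2 (.of_forall hg0)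
        ((hfμ hg).smul_measure (c := ENNReal.ofReal (1 + ε)) ENNReal.ofReal_ne_top)
      rwa [integral_smul_measure, ENNReal.toReal_ofReal (by positivity), smul_eq_mul] at this
    have e3 : 0 ≤ ∫ x, g x ∂ν := integral_nonneg hg0
    have e4 : ε * ∫ x, g x ∂μ ≤ ε * ((1 + ε) * ∫ x, g x ∂ν) := by gcongr
    have e5 : 0 ≤ ε * ε * ∫ x, g x ∂ν := by positivity
    rw [abs_le]
    constructor <;> nlinarith
  have a1 := hpos (fun x => |f x| + f x) (fun x => by linarith [neg_abs_le (f x)]) (hf.abs.add hf)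
  have a2 := hpos (fun x => |f x|) (fun x => abs_nonneg _) hf.abs
  have hle : ∫ x, f x ∂ν ≤ ∫ x, |f x| ∂ν := integral_mono hf hf.abs fun x => le_abs_self _
  rw [integral_add (hfμ hf.abs) (hfμ hf), integral_add hf.abs hf] at a1
  have hc : 0 ≤ ε * (1 + ε) := by positivity
  have a3 : ε * (1 + ε) * (∫ x, |f x| ∂ν + ∫ x, f x ∂ν)
      ≤ ε * (1 + ε) * (∫ x, |f x| ∂ν + ∫ x, |f x| ∂ν) := by gcongr
  rw [abs_le] at *
  constructor <;> nlinarith [a1.1, a1.2, a2.1, a2.2]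

/-! ### The Green flux near the boundary and at infinity -/

/-- The cutoff of `φ` that increases linearly from `0` to `1` where `φ` goes from `a` to `2a`. -/
noncomputable def ramp (a : ℝ) (φ : Plane → ℝ) (x : Plane) : ℝ := max 0 (min 1 (a⁻¹ * (φ x - a)))

lemma ramp_eq_zero {a : ℝ} (ha : 0 < a) {φ : Plane → ℝ} {x : Plane} (h : φ x ≤ a) :
    ramp a φ x = 0 := by
  refine max_eq_left ((min_le_right _ _).trans ?_)
  exact mul_nonpos_of_nonneg_of_nonpos (by positivity) (by linarith)

lemma ramp_eq_one {a : ℝ} (ha : 0 < a) {φ : Plane → ℝ} {x : Plane} (h : 2 * a ≤ φ x) :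
    ramp a φ x = 1 := by
  have h1 : 1 ≤ a⁻¹ * (φ x - a) := by
    rw [← div_eq_inv_mul, le_div_iff₀ ha]; linarith
  rw [ramp, min_eq_left h1, max_eq_right zero_le_one]

lemma lipschitzWith_ramp {a : ℝ} {φ : Plane → ℝ} (hφ : LipschitzWith 1 φ) :
    ∃ C, LipschitzWith C (ramp a φ) := by
  have h1 : LipschitzWith (‖a⁻¹‖₊ * (1 + 0)) fun x => a⁻¹ • (φ x - a) :=
    LipschitzWith.comp (lipschitzWith_smul a⁻¹) (hφ.sub (LipschitzWith.const a))
  exact ⟨_, (h1.const_min 1).const_max 0⟩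

/-- Only the open layer contributes to the gradient of the cutoff: elsewhere it attains its minimum
or its maximum. -/
lemma gradient_ramp {a : ℝ} (ha : 0 < a) {φ : Plane → ℝ} (hφ : Continuous φ) (x : Plane) :
    gradient (ramp a φ) x
      = {x | φ x ∈ Set.Ioo a (2 * a)}.indicator (fun x => a⁻¹ • gradient φ x) x := by
  by_cases hx : φ x ∈ Set.Ioo a (2 * a)
  · rw [Set.indicator_of_mem (by exact hx)]
    have h1 : ramp a φ =ᶠ[𝓝 x] fun x => a⁻¹ • (φ x - a) := by
      filter_upwards [(isOpen_Ioo.preimage hφ).mem_nhds hx] with z hz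
      have hz' : φ z ∈ Set.Ioo a (2 * a) := hz
      have e1 : a⁻¹ * (φ z - a) ≤ 1 := by
        rw [← div_eq_inv_mul, div_le_one ha]; linarith [hz'.2]
      have e2 : 0 ≤ a⁻¹ * (φ z - a) :=
        mul_nonneg (by positivity) (by linarith [hz'.1])
      rw [ramp, min_eq_right e1, max_eq_right e2, smul_eq_mul]
    have h2 : (fun x => a⁻¹ • (φ x - a)) = a⁻¹ • fun x => φ x - a := rfl
    rw [gradient, h1.fderiv_eq, h2, fderiv_const_smul_field, Pi.smul_apply, fderiv_sub_const,
      map_smul]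
    rfl
  · rw [Set.indicator_of_notMem (by exact hx)]
    have h0 : ∀ z, 0 ≤ ramp a φ z := fun z => le_max_left _ _
    have h1 : ∀ z, ramp a φ z ≤ 1 := fun z => max_le zero_le_one (min_le_left _ _)
    have h2 : fderiv ℝ (ramp a φ) x = 0 := by
      rcases le_or_gt (φ x) a with h | h
      · have : IsLocalMin (ramp a φ) x := .of_forall fun z => by
          rw [ramp_eq_zero ha h]; exact h0 z
        exact this.fderiv_eq_zero
      · have h' : 2 * a ≤ φ x := by
          by_contra hcon
          exact hx ⟨h, not_le.1 hcon⟩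
        have : IsLocalMax (ramp a φ) x := .of_forall fun z => by
          rw [ramp_eq_one ha h']; exact h1 z
        exact this.fderiv_eq_zero
    rw [gradient, h2, map_zero]

lemma measurable_gradient_plane (φ : Plane → ℝ) : Measurable (gradient φ) :=
  (InnerProductSpace.toDual ℝ Plane).symm.continuous.measurable.comp (measurable_fderiv ℝ φ)

lemma norm_gradient_le_one {φ : Plane → ℝ} (hφ : LipschitzWith 1 φ) (x : Plane) :
    ‖gradient φ x‖ ≤ 1 := by
  rw [gradient, LinearIsometryEquiv.norm_map]
  simpa using norm_fderiv_le_of_lipschitz ℝ (f := φ) (x₀ := x) hφ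

lemma aestronglyMeasurable_greenForm_gradient {U : Set Plane} (hU : IsOpen U) {u v : Plane → ℝ}
    (hu : InnerProductSpace.HarmonicOnNhd u U) (hv : InnerProductSpace.HarmonicOnNhd v U)
    (φ : Plane → ℝ) :
    AEStronglyMeasurable (fun x => greenForm u v x (gradient φ x)) (volume.restrict U) := by
  have h1 : ∀ w : Plane → ℝ, AEStronglyMeasurable (fun x => fderiv ℝ w x (gradient φ x))
      (volume.restrict U) := by
    intro w
    have : Measurable fun x => ⟪gradient w x, gradient φ x⟫ :=
      (measurable_gradient_plane w).inner (measurable_gradient_plane φ)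
    simpa only [inner_gradient_left] using this.aestronglyMeasurable
  exact ((hu.continuousOn.aestronglyMeasurable hU.measurableSet).mul (h1 v)).sub
    ((hv.continuousOn.aestronglyMeasurable hU.measurableSet).mul (h1 u))

lemma InnerProductSpace.HarmonicOnNhd.continuousOn_fderiv {U : Set Plane} {u : Plane → ℝ}
    (hu : InnerProductSpace.HarmonicOnNhd u U) : ContinuousOn (fderiv ℝ u) U := fun x hx =>
  ((hu x hx).1.fderiv_right (m := 1) (by norm_num)).continuousAt.continuousWithinAt

lemma abs_greenForm_le (u v : Plane → ℝ) (x w : Plane) :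
    |greenForm u v x w| ≤ (|u x| * ‖fderiv ℝ v x‖ + |v x| * ‖fderiv ℝ u x‖) * ‖w‖ := by
  have h1 : ∀ f : Plane → ℝ, |fderiv ℝ f x w| ≤ ‖fderiv ℝ f x‖ * ‖w‖ := fun f => by
    rw [← Real.norm_eq_abs]; exact ContinuousLinearMap.le_opNorm _ _
  calc |greenForm u v x w| ≤ |u x * fderiv ℝ v x w| + |v x * fderiv ℝ u x w| := abs_sub _ _
    _ ≤ |u x| * (‖fderiv ℝ v x‖ * ‖w‖) + |v x| * (‖fderiv ℝ u x‖ * ‖w‖) := by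
      rw [abs_mul, abs_mul]
      gcongr
      · exact h1 v
      · exact h1 u
    _ = _ := by ring

lemma integrableOn_greenForm_gradient {U K : Set Plane} (hU : IsOpen U) (hK : IsCompact K)
    (hKU : K ⊆ U) {u v φ : Plane → ℝ} (hu : InnerProductSpace.HarmonicOnNhd u U)
    (hv : InnerProductSpace.HarmonicOnNhd v U) (hφ : LipschitzWith 1 φ) :
    IntegrableOn (fun x => greenForm u v x (gradient φ x)) K := by
  have hc : ContinuousOn (fun x => |u x| * ‖fderiv ℝ v x‖ + |v x| * ‖fderiv ℝ u x‖) K :=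
    ((hu.continuousOn.abs.mul hv.continuousOn_fderiv.norm).add
      (hv.continuousOn.abs.mul hu.continuousOn_fderiv.norm)).mono hKU
  obtain ⟨C, hC⟩ := hK.exists_bound_of_continuousOn hc
  refine ⟨(aestronglyMeasurable_greenForm_gradient hU hu hv φ).mono_set hKU,
    HasFiniteIntegral.restrict_of_bounded C hK.measure_lt_top ?_⟩
  refine (ae_restrict_iff' hK.measurableSet).2 (.of_forall fun x hx => ?_)
  rw [Real.norm_eq_abs]
  refine (abs_greenForm_le _ _ _ _).trans ?_
  have h1 := hC x hx
  have h2 := norm_gradient_le_one hφ x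
  rw [Real.norm_eq_abs] at h1
  have h3 := (le_abs_self _).trans h1
  have h4 : 0 ≤ |u x| * ‖fderiv ℝ v x‖ + |v x| * ‖fderiv ℝ u x‖ := by positivity
  nlinarith [norm_nonneg (gradient φ x)]

/-- The Green flux of `(u, v)` averaged over the layer at distance between `δ` and `2δ`. -/
noncomputable def layerFlux (D : Set Plane) (u v : Plane → ℝ) (δ : ℝ) : ℝ :=
  δ⁻¹ * ∫ x in exteriorLayer D δ (2 * δ),
    greenForm u v x (gradient (fun x => Metric.infDist x D) x)

/-- The Green flux of `(u, v)` averaged over the annulus `R < |x| < 2R`. -/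
noncomputable def annulusFlux (u v : Plane → ℝ) (R : ℝ) : ℝ :=
  R⁻¹ * ∫ x in {x : Plane | ‖x‖ ∈ Set.Ioo R (2 * R)}, greenForm u v x (gradient (fun x => ‖x‖) x)

lemma integrableOn_annulus_greenForm {U : Set Plane} (hU : IsOpen U) {u v : Plane → ℝ}
    (hu : InnerProductSpace.HarmonicOnNhd u U) (hv : InnerProductSpace.HarmonicOnNhd v U) {R : ℝ}
    (hR : ∀ x, R ≤ ‖x‖ → x ∈ U) :
    IntegrableOn (fun x => greenForm u v x (gradient (fun x => ‖x‖) x))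
      {x : Plane | ‖x‖ ∈ Set.Ioo R (2 * R)} := by
  have hcomp : IsCompact {x : Plane | ‖x‖ ∈ Set.Icc R (2 * R)} := by
    refine Metric.isCompact_of_isClosed_isBounded (isClosed_Icc.preimage continuous_norm) ?_
    refine (Metric.isBounded_closedBall (x := (0 : Plane)) (r := 2 * R)).subset fun x hx => ?_
    rw [mem_closedBall_zero_iff]
    exact hx.2
  exact (integrableOn_greenForm_gradient hU hcomp (fun x hx => hR x hx.1) hu hv
    lipschitzWith_one_norm).mono_set fun x hx => ⟨hx.1.le, hx.2.le⟩

/-- The averaged flux near the boundary equals the averaged flux near infinity. -/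
theorem layerFlux_eq_annulusFlux {D : Set Plane} (hDc : IsClosed D) {u v : Plane → ℝ}
    (hu : InnerProductSpace.HarmonicOnNhd u Dᶜ) (hv : InnerProductSpace.HarmonicOnNhd v Dᶜ)
    {δ R : ℝ} (hδ : 0 < δ) (hR : 0 < R)
    (hδR : ∀ x, Metric.infDist x D ≤ 2 * δ → ‖x‖ < R) :
    layerFlux D u v δ = annulusFlux u v R := by
  set d : Plane → ℝ := fun x => Metric.infDist x D with hd
  have hdl : LipschitzWith 1 d := Metric.lipschitz_infDist_pt D
  have hnl : LipschitzWith 1 (fun x : Plane => ‖x‖) := lipschitzWith_one_norm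
  obtain ⟨C₁, h1⟩ := lipschitzWith_ramp (a := δ) hdl
  obtain ⟨C₂, h2⟩ := lipschitzWith_ramp (a := R) hnl
  have hpos : ∀ x, 0 < d x → x ∈ Dᶜ := fun x hx hxD => by
    simp only [hd, Metric.infDist_zero_of_mem hxD, lt_irrefl] at hx
  have hchi := h1.sub h2
  have hsupp : Function.support (fun x => ramp δ d x - ramp R (fun x => ‖x‖) x)
      ⊆ {x | δ ≤ d x} ∩ Metric.closedBall 0 (2 * R) := by
    intro x hx
    rw [Function.mem_support] at hx
    constructor
    · by_contra hcon
      have hlt : d x < δ := not_le.1 hcon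
      have h3 := hδR x (by show d x ≤ _; linarith)
      rw [ramp_eq_zero hδ hlt.le, ramp_eq_zero hR h3.le, sub_zero] at hx
      exact hx rfl
    · by_contra hcon
      rw [mem_closedBall_zero_iff, not_le] at hcon
      have h3 : 2 * δ ≤ d x := by
        by_contra h4
        have := hδR x (not_le.1 h4).le
        linarith
      rw [ramp_eq_one hδ h3, ramp_eq_one hR hcon.le, sub_self] at hx
      exact hx rfl
  have hclosed : IsClosed ({x | δ ≤ d x} ∩ Metric.closedBall (0 : Plane) (2 * R)) :=
    (isClosed_le continuous_const hdl.continuous).inter Metric.isClosed_closedBall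
  have hts := closure_minimal hsupp hclosed
  have hcs : HasCompactSupport (fun x => ramp δ d x - ramp R (fun x => ‖x‖) x) :=
    HasCompactSupport.of_support_subset_isCompact (isCompact_closedBall 0 (2 * R))
      (hsupp.trans Set.inter_subset_right)
  -- the difference of the two cutoffs has compact support in the exterior of `D`
  have hzero := integral_greenForm_gradient_eq_zero hDc.isOpen_compl hu hv hchi hcs
    (fun x hx => hpos x (hδ.trans_le (hts hx).1))
  set L := {x | d x ∈ Set.Ioo δ (2 * δ)} with hL
  set A := {x : Plane | ‖x‖ ∈ Set.Ioo R (2 * R)} with hA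
  have hLm : MeasurableSet L := (isOpen_Ioo.preimage hdl.continuous).measurableSet
  have hAm : MeasurableSet A := (isOpen_Ioo.preimage continuous_norm).measurableSet
  have hsplit : (fun x => greenForm u v x
      (gradient (fun x => ramp δ d x - ramp R (fun x => ‖x‖) x) x))
      =ᵐ[volume] fun x => L.indicator (fun x => δ⁻¹ * greenForm u v x (gradient d x)) x
        - A.indicator (fun x => R⁻¹ * greenForm u v x (gradient (fun x => ‖x‖) x)) x := by
    filter_upwards [h1.ae_differentiableAt (μ := volume), h2.ae_differentiableAt (μ := volume)]
      with x hx1 hx2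
    have e1 : gradient (fun x => ramp δ d x - ramp R (fun x => ‖x‖) x) x
        = gradient (ramp δ d) x - gradient (ramp R fun x => ‖x‖) x := by
      rw [gradient, gradient, gradient, ← map_sub, fderiv_fun_sub hx1 hx2]
    have e2 : ∀ w w' : Plane, greenForm u v x (w - w') = greenForm u v x w - greenForm u v x w' := by
      intro w w'
      simp only [greenForm, map_sub]; ring
    have e3 : greenForm u v x 0 = 0 := by simp [greenForm]
    rw [e1, e2, gradient_ramp hδ hdl.continuous, gradient_ramp hR continuous_norm]
    congr 1
    · by_cases hx : x ∈ L
      · rw [Set.indicator_of_mem hx, Set.indicator_of_mem hx, greenForm_smul]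
      · rw [Set.indicator_of_notMem hx, Set.indicator_of_notMem hx, e3]
    · by_cases hx : x ∈ A
      · rw [Set.indicator_of_mem hx, Set.indicator_of_mem hx, greenForm_smul]
      · rw [Set.indicator_of_notMem hx, Set.indicator_of_notMem hx, e3]
  have hiL : IntegrableOn (fun x => greenForm u v x (gradient d x)) L := by
    have hcomp : IsCompact {x | d x ∈ Set.Icc δ (2 * δ)} := by
      refine Metric.isCompact_of_isClosed_isBounded (isClosed_Icc.preimage hdl.continuous) ?_
      refine (Metric.isBounded_ball (x := (0 : Plane)) (r := R)).subset fun x hx => ?_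
      rw [mem_ball_zero_iff]
      exact hδR x hx.2
    exact (integrableOn_greenForm_gradient hDc.isOpen_compl hcomp
      (fun x hx => hpos x (hδ.trans_le hx.1)) hu hv hdl).mono_set
      fun x hx => ⟨hx.1.le, hx.2.le⟩
  have hiA : IntegrableOn (fun x => greenForm u v x (gradient (fun x => ‖x‖) x)) A := by
    refine integrableOn_annulus_greenForm hDc.isOpen_compl hu hv fun x hx => hpos x ?_
    by_contra h4
    have h5 := hδR x ((not_lt.1 h4).trans (by positivity))
    linarith
  rw [integral_congr_ae hsplit, integral_sub
    ((integrable_indicator_iff hLm).2 (hiL.const_mul δ⁻¹))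
    ((integrable_indicator_iff hAm).2 (hiA.const_mul R⁻¹)),
    integral_indicator hLm, integral_indicator hAm, integral_const_mul, integral_const_mul] at hzero
  exact sub_eq_zero.1 hzero

/-- Averages over annuli of radius `R` and width `R` of functions that are `o(1/|x|)`, with the
normalization of a flux, tend to zero. -/
lemma tendsto_annulus_average_zero {f : Plane → ℝ}
    (hf : Tendsto (fun x => ‖x‖ * f x) (Bornology.cobounded Plane) (𝓝 0)) :
    Tendsto (fun R : ℝ => R⁻¹ * ∫ x in {x : Plane | ‖x‖ ∈ Set.Ioo R (2 * R)}, f x) atTop (𝓝 0) := by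
  set c : ℝ := volume.real (Metric.ball (0 : Plane) 1)
  have hc : 0 ≤ c := measureReal_nonneg
  rw [Metric.tendsto_nhds]
  intro ε hε
  set η : ℝ := ε / (4 * c + 1)
  have hη : 0 < η := by positivity
  have h1 := Metric.tendsto_nhds.1 hf η hη
  rw [← comap_norm_atTop, eventually_comap] at h1
  obtain ⟨R₀, hR₀⟩ := eventually_atTop.1 h1
  filter_upwards [eventually_ge_atTop R₀, eventually_gt_atTop 0] with R hR hRpos
  have h2 : ∀ x ∈ {x : Plane | ‖x‖ ∈ Set.Ioo R (2 * R)}, ‖f x‖ ≤ η / R := by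
    intro x hx
    have hx' : R < ‖x‖ := hx.1
    have h3 := hR₀ ‖x‖ (hR.trans hx'.le) x rfl
    rw [dist_zero_right, norm_mul, norm_norm] at h3
    rw [le_div_iff₀ hRpos]
    nlinarith [norm_nonneg (f x)]
  have hvol : volume {x : Plane | ‖x‖ ∈ Set.Ioo R (2 * R)} ≤ volume (Metric.ball (0 : Plane) (2 * R)) :=
    measure_mono fun x hx => by rw [mem_ball_zero_iff]; exact hx.2
  have hvol' : volume.real {x : Plane | ‖x‖ ∈ Set.Ioo R (2 * R)} ≤ (2 * R) ^ 2 * c := by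
    have h3 : volume.real (Metric.ball (0 : Plane) (2 * R)) = (2 * R) ^ 2 * c := by
      rw [Measure.real, Measure.addHaar_ball _ _ (by positivity), finrank_euclideanSpace_fin,
        ENNReal.toReal_mul, ENNReal.toReal_ofReal (by positivity)]
      rfl
    rw [← h3]
    exact ENNReal.toReal_mono measure_ball_lt_top.ne hvol
  have h4 := norm_setIntegral_le_of_norm_le_const (hvol.trans_lt measure_ball_lt_top) h2
  rw [dist_zero_right, norm_mul, norm_inv, Real.norm_eq_abs R, abs_of_pos hRpos]
  calc _ ≤ R⁻¹ * (η / R * ((2 * R) ^ 2 * c)) := by gcongr; exact h4.trans (by gcongr)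
    _ = η * (4 * c) := by field_simp; ring
    _ < η * (4 * c + 1) := by gcongr; linarith
    _ = ε := by simp only [η]; field_simp

lemma annulus_integral_inv_norm {R : ℝ} (hR : 0 < R) :
    R⁻¹ * ∫ x in {x : Plane | ‖x‖ ∈ Set.Ioo R (2 * R)}, ‖x‖⁻¹ = 2 * Real.pi := by
  have hm : MeasurableSet {x : Plane | ‖x‖ ∈ Set.Ioo R (2 * R)} :=
    (isOpen_Ioo.preimage continuous_norm).measurableSet
  have h1 := integral_fun_norm_addHaar (volume : Measure Plane)
    ((Set.Ioo R (2 * R)).indicator fun r : ℝ => r⁻¹)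
  have h2 : ∫ x in {x : Plane | ‖x‖ ∈ Set.Ioo R (2 * R)}, ‖x‖⁻¹
      = ∫ x : Plane, (Set.Ioo R (2 * R)).indicator (fun r : ℝ => r⁻¹) ‖x‖ := by
    rw [← integral_indicator hm]
    rfl
  have h3 : ∫ y in Set.Ioi (0 : ℝ), y ^ (Module.finrank ℝ Plane - 1) •
      (Set.Ioo R (2 * R)).indicator (fun r : ℝ => r⁻¹) y = R := by
    have e1 : ∀ y : ℝ, y ^ (Module.finrank ℝ Plane - 1) •
        (Set.Ioo R (2 * R)).indicator (fun r : ℝ => r⁻¹) y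
        = (Set.Ioo R (2 * R)).indicator (fun _ => (1 : ℝ)) y := by
      intro y
      rw [finrank_euclideanSpace_fin]
      by_cases hy : y ∈ Set.Ioo R (2 * R)
      · have : y ≠ 0 := (hR.trans hy.1).ne'
        simp [Set.indicator_of_mem hy, this]
      · simp [Set.indicator_of_notMem hy]
    simp only [e1]
    rw [setIntegral_indicator measurableSet_Ioo]
    have e2 : Set.Ioi (0 : ℝ) ∩ Set.Ioo R (2 * R) = Set.Ioo R (2 * R) :=
      Set.inter_eq_right.2 fun y hy => hR.trans hy.1
    rw [e2]
    simp
    rw [max_eq_left] <;> linarith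
  rw [h2, h1, h3, finrank_euclideanSpace_fin, Measure.real, EuclideanSpace.volume_ball_fin_two]
  simp [Real.pi_pos.le]
  field_simp

lemma layerFlux_eq_of_tendsto_annulusFlux {D : Set Plane} (hDc : IsClosed D) (hne : D.Nonempty)
    (hD : Bornology.IsBounded D) {u v : Plane → ℝ} (hu : InnerProductSpace.HarmonicOnNhd u Dᶜ)
    (hv : InnerProductSpace.HarmonicOnNhd v Dᶜ) {L : ℝ}
    (h : Tendsto (annulusFlux u v) atTop (𝓝 L)) {δ : ℝ} (hδ : 0 < δ) : layerFlux D u v δ = L := by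
  obtain ⟨R₀, hR₀⟩ := hD.subset_closedBall 0
  refine tendsto_nhds_unique (tendsto_const_nhds.congr' ?_) h
  filter_upwards [eventually_gt_atTop 0, eventually_gt_atTop (2 * δ + R₀)] with R hR hR'
  refine layerFlux_eq_annulusFlux hDc hu hv hδ hR fun x hx => ?_
  obtain ⟨y, hy, hxy⟩ := (Metric.isCompact_of_isClosed_isBounded hDc hD).exists_infDist_eq_dist hne x
  have h1 := hR₀ hy
  rw [mem_closedBall_zero_iff] at h1
  rw [hxy, dist_eq_norm] at hx
  have h2 : ‖x‖ ≤ ‖x - y‖ + ‖y‖ := norm_le_norm_sub_add x y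
  linarith

lemma tendsto_norm_mul_zero_of_le {f : Plane → ℝ} {C R : ℝ}
    (h : ∀ x, R < ‖x‖ → |f x| ≤ C / ‖x‖ ^ 2) :
    Tendsto (fun x => ‖x‖ * f x) (Bornology.cobounded Plane) (𝓝 0) := by
  have h1 : Tendsto (fun x : Plane => C * ‖x‖⁻¹) (Bornology.cobounded Plane) (𝓝 0) := by
    simpa using (tendsto_inv_atTop_zero.comp tendsto_norm_cobounded_atTop).const_mul C
  refine squeeze_zero_norm' ?_ h1
  have h2 : Tendsto (fun x : Plane => ‖x‖) (Bornology.cobounded Plane) atTop :=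
    tendsto_norm_cobounded_atTop
  filter_upwards [h2.eventually_gt_atTop R, h2.eventually_gt_atTop 0] with x hx hx0
  rw [norm_mul, norm_norm, Real.norm_eq_abs]
  calc ‖x‖ * |f x| ≤ ‖x‖ * (C / ‖x‖ ^ 2) := by gcongr; exact h x hx
    _ = C * ‖x‖⁻¹ := by field_simp

lemma norm_gradient_norm {x : Plane} (hx : x ≠ 0) : ‖gradient (fun x : Plane => ‖x‖) x‖ = 1 := by
  rw [gradient, LinearIsometryEquiv.norm_map]
  exact norm_fderiv_norm ((contDiffAt_norm (n := 1) ℝ hx).differentiableAt (by norm_num))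

lemma exists_norm_gt_mem_compl {D : Set Plane} (hD : Bornology.IsBounded D) :
    ∃ R : ℝ, 0 < R ∧ ∀ x : Plane, R < ‖x‖ → x ∈ Dᶜ := by
  obtain ⟨R₀, hR₀⟩ := hD.subset_closedBall 0
  refine ⟨max R₀ 1, by positivity, fun x hx hxD => ?_⟩
  have := hR₀ hxD
  rw [mem_closedBall_zero_iff] at this
  exact absurd (this.trans (le_max_left _ 1)) (not_le.2 hx)

/-- The radial Green form of two bounded exterior harmonic functions is `O(|x|⁻²)`. -/
lemma tendsto_norm_mul_greenForm_zero {D : Set Plane} (hD : Bornology.IsBounded D) {u v : Plane → ℝ}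
    (hu : IsBoundedExteriorHarmonic D u) (hv : IsBoundedExteriorHarmonic D v) :
    Tendsto (fun x => ‖x‖ * greenForm u v x (gradient (fun x => ‖x‖) x))
      (Bornology.cobounded Plane) (𝓝 0) := by
  obtain ⟨R₀, hR₀, hout⟩ := exists_norm_gt_mem_compl hD
  obtain ⟨Lu, Cu, Ru, -, hRu, hCu0, hCu⟩ := hu.exists_limit hD
  obtain ⟨Lv, Cv, Rv, -, hRv, hCv0, hCv⟩ := hv.exists_limit hD
  obtain ⟨Mu, hMu⟩ := hu.bounded
  obtain ⟨Mv, hMv⟩ := hv.bounded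
  refine tendsto_norm_mul_zero_of_le (C := Mu * Cv + Mv * Cu) (R := max R₀ (max Ru Rv))
    fun x hx => ?_
  have h0 : R₀ < ‖x‖ := (le_max_left _ _).trans_lt hx
  have h1 : Ru < ‖x‖ := ((le_max_left _ _).trans (le_max_right _ _)).trans_lt hx
  have h2 : Rv < ‖x‖ := ((le_max_right _ _).trans (le_max_right _ _)).trans_lt hx
  have hx0 : x ≠ 0 := norm_pos_iff.1 (hR₀.trans h0)
  have hMu' := hMu x (hout x h0)
  have hMv' := hMv x (hout x h0)
  have hMu0 : 0 ≤ Mu := (abs_nonneg _).trans hMu'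
  have hMv0 : 0 ≤ Mv := (abs_nonneg _).trans hMv'
  refine (abs_greenForm_le _ _ _ _).trans ?_
  rw [norm_gradient_norm hx0, mul_one]
  calc _ ≤ Mu * (Cv / ‖x‖ ^ 2) + Mv * (Cu / ‖x‖ ^ 2) := by
        gcongr
        · exact hCv x h2
        · exact hCu x h1
    _ = _ := by ring

lemma harmonicOnNhd_exteriorGreen {D : Set Plane} (h0 : (0 : Plane) ∈ D) {H₀ : Plane → ℝ}
    (hH₀ : InnerProductSpace.HarmonicOnNhd H₀ Dᶜ) :
    InnerProductSpace.HarmonicOnNhd (exteriorGreen H₀) Dᶜ := by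
  intro x hx
  have hx0 : x ≠ 0 := by rintro rfl; exact hx h0
  exact ((harmonicAt_log_norm hx0).const_smul (c := -(1 / (2 * Real.pi)))).add (hH₀ x hx)

/-- The Green flux of a bounded exterior harmonic function `a` against `H` is minus the value of `a`
at infinity, because `H` has the logarithmic pole `-(1/2π) log |x|` there. -/
theorem layerFlux_exteriorGreen {D : Set Plane} (hDc : IsClosed D) (h0 : (0 : Plane) ∈ D)
    (hD : Bornology.IsBounded D) {a H₀ : Plane → ℝ} (ha : IsBoundedExteriorHarmonic D a)
    (hH₀ : IsBoundedExteriorHarmonic D H₀) {L : ℝ}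
    (hL : Tendsto a (Bornology.cobounded Plane) (𝓝 L)) {δ : ℝ} (hδ : 0 < δ) :
    layerFlux D a (exteriorGreen H₀) δ = -L := by
  have hH := harmonicOnNhd_exteriorGreen h0 hH₀.harmonic
  refine layerFlux_eq_of_tendsto_annulusFlux hDc ⟨0, h0⟩ hD ha.harmonic hH ?_ hδ
  obtain ⟨R₀, hR₀, hout⟩ := exists_norm_gt_mem_compl hD
  obtain ⟨-, C, R₁, -, hR₁, hC0, hC⟩ := ha.exists_limit hD
  set e : Plane → Plane := gradient fun x => ‖x‖
  have hnorm : Tendsto (fun x : Plane => ‖x‖) (Bornology.cobounded Plane) atTop :=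
    tendsto_norm_cobounded_atTop
  -- the flux density differs from that of the constant `L` against the logarithm by `o(1/|x|)`
  set f : Plane → ℝ := fun x =>
    greenForm a (exteriorGreen H₀) x (e x) + L / (2 * Real.pi) * ‖x‖⁻¹ with hf
  have hexp : ∀ x, R₀ < ‖x‖ → ‖x‖ * f x = -(1 / (2 * Real.pi)) * (a x - L)
      + ‖x‖ * greenForm a H₀ x (e x)
      + 1 / (2 * Real.pi) * (‖x‖ * (Real.log ‖x‖ * fderiv ℝ a x (e x))) := by
    intro x hx
    have hx0 : 0 < ‖x‖ := hR₀.trans hx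
    have hx0' : x ≠ 0 := norm_pos_iff.1 hx0
    have hd : DifferentiableAt ℝ (fun x : Plane => ‖x‖) x :=
      (contDiffAt_norm (n := 1) ℝ hx0').differentiableAt (by norm_num)
    have h1 := hd.hasFDerivAt.log hx0.ne'
    have h2 := ((hH₀.harmonic x (hout x hx)).1.differentiableAt (by norm_num)).hasFDerivAt
    have h3 : HasFDerivAt (exteriorGreen H₀) _ x := (h1.const_mul (-(1 / (2 * Real.pi)))).add h2
    have h4 : fderiv ℝ (fun x : Plane => ‖x‖) x (e x) = 1 := by
      rw [← inner_gradient_left, real_inner_self_eq_norm_sq, norm_gradient_norm hx0', one_pow]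
    simp only [hf, greenForm, h3.fderiv, add_apply, smul_apply, h4, smul_eq_mul, exteriorGreen]
    field_simp
    ring
  have hflim : Tendsto (fun x => ‖x‖ * f x) (Bornology.cobounded Plane) (𝓝 0) := by
    have t1 : Tendsto (fun x => -(1 / (2 * Real.pi)) * (a x - L)) (Bornology.cobounded Plane)
        (𝓝 0) := by
      simpa using (hL.sub_const L).const_mul (-(1 / (2 * Real.pi)))
    have t2 := tendsto_norm_mul_greenForm_zero hD ha hH₀
    have t3 : Tendsto (fun x => ‖x‖ * (Real.log ‖x‖ * fderiv ℝ a x (e x)))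
        (Bornology.cobounded Plane) (𝓝 0) := by
      have s1 : Tendsto (fun r : ℝ => Real.log r / r) atTop (𝓝 0) :=
        Real.isLittleO_log_id_atTop.tendsto_div_nhds_zero
      have s2 : Tendsto (fun x : Plane => C * |Real.log ‖x‖ / ‖x‖|) (Bornology.cobounded Plane)
          (𝓝 0) := by
        simpa using (s1.comp hnorm).abs.const_mul C
      refine squeeze_zero_norm' ?_ s2
      filter_upwards [hnorm.eventually_gt_atTop R₁] with x hx
      have hx0 : 0 < ‖x‖ := hR₁.trans hx
      have h5 : ‖fderiv ℝ a x (e x)‖ ≤ C / ‖x‖ ^ 2 := by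
        refine (ContinuousLinearMap.le_opNorm _ _).trans ?_
        rw [norm_gradient_norm (norm_pos_iff.1 hx0), mul_one]
        exact hC x hx
      rw [norm_mul, norm_mul, norm_norm, Real.norm_eq_abs (Real.log ‖x‖), abs_div, abs_norm]
      calc _ ≤ ‖x‖ * (|Real.log ‖x‖| * (C / ‖x‖ ^ 2)) := by gcongr
        _ = _ := by field_simp
    have t4 := (t1.add t2).add (t3.const_mul (1 / (2 * Real.pi)))
    simp only [mul_zero, add_zero] at t4
    refine t4.congr' ?_
    filter_upwards [hnorm.eventually_gt_atTop R₀] with x hx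
    exact (hexp x hx).symm
  have hmain := (tendsto_annulus_average_zero hflim).sub_const L
  rw [zero_sub] at hmain
  refine hmain.congr' ?_
  filter_upwards [eventually_gt_atTop R₀] with R hR
  have hRpos : 0 < R := hR₀.trans hR
  have i1 := integrableOn_annulus_greenForm hDc.isOpen_compl ha.harmonic hH (R := R)
    fun x hx => hout x (hR.trans_le hx)
  have i2 : IntegrableOn (fun x : Plane => ‖x‖⁻¹) {x : Plane | ‖x‖ ∈ Set.Ioo R (2 * R)} := by
    by_contra hcon
    have h6 := annulus_integral_inv_norm hRpos
    rw [integral_undef hcon, mul_zero] at h6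
    exact absurd h6.symm Real.two_pi_pos.ne'
  simp only [hf]
  rw [integral_add i1 (i2.const_mul _), integral_const_mul, mul_add, mul_left_comm,
    annulus_integral_inv_norm hRpos, annulusFlux]
  field_simp
  ring

/-! ### The Green flux in normal coordinates -/

lemma IsDefiningFunction.exists_parallelPoint_mem_compl {D : Set Plane} {ρ : Plane → ℝ}
    (hρ : IsDefiningFunction D ρ) (hD : Bornology.IsBounded D) :
    ∃ δ > 0, ∀ y ∈ frontier D, ∀ t ∈ Set.Ioo 0 δ, parallelPoint ρ (y, t) ∈ Dᶜ ∧
      (DifferentiableAt ℝ (fun x => Metric.infDist x D) (parallelPoint ρ (y, t)) →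
        gradient (fun x => Metric.infDist x D) (parallelPoint ρ (y, t)) = -inwardNormal ρ y) := by
  obtain ⟨K, hK⟩ := hρ.exists_boundaryRegularity hD
  have hKpos := hK.pos
  refine ⟨1 / (2 * K), by positivity, fun y hy t ht => ?_⟩
  have htK : 2 * K * t < 1 := by
    have := ht.2
    rw [lt_div_iff₀ (by positivity)] at this
    linarith
  refine ⟨fun hmem => ?_, hK.gradient_infDist_parallelPoint hρ hy ht.1 htK⟩
  have h1 := hK.infDist_parallelPoint hρ hy ht.1.le htK
  rw [Metric.infDist_zero_of_mem hmem] at h1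
  exact ht.1.ne h1

lemma isCompact_frontier {D : Set Plane} (hDc : IsClosed D) (hD : Bornology.IsBounded D) :
    IsCompact (frontier D) :=
  Metric.isCompact_of_isClosed_isBounded isClosed_frontier (hD.subset hDc.frontier_subset)

lemma integrable_boundaryMeasure_of_continuousOn {D : Set Plane} (hDc : IsClosed D)
    (hD : Bornology.IsBounded D) [IsFiniteMeasure (boundaryMeasure D)] {f : Plane → ℝ}
    (hf : ContinuousOn f (frontier D)) : Integrable f (boundaryMeasure D) := by
  obtain ⟨C, hC⟩ := (isCompact_frontier hDc hD).exists_bound_of_continuousOn hf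
  have h1 : AEStronglyMeasurable f (boundaryMeasure D) :=
    hf.aestronglyMeasurable isClosed_frontier.measurableSet
  exact ⟨h1, HasFiniteIntegral.of_bounded (C := C)
    ((ae_restrict_iff' isClosed_frontier.measurableSet).2 (.of_forall hC))⟩

lemma ae_mem_frontier (D : Set Plane) : ∀ᵐ y ∂(boundaryMeasure D), y ∈ frontier D :=
  ae_restrict_mem isClosed_frontier.measurableSet

section Traces

variable {D : Set Plane} {ρ : Plane → ℝ} {δ : ℝ} {u v : Plane → ℝ}

lemma IsDefiningFunction.continuousOn_comp_parallelPoint (hρ : IsDefiningFunction D ρ)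
    (hδ : ∀ y ∈ frontier D, ∀ t ∈ Set.Ioo 0 δ, parallelPoint ρ (y, t) ∈ Dᶜ)
    (hu : ContinuousOn u Dᶜ) :
    ContinuousOn (fun p => u (parallelPoint ρ p)) (frontier D ×ˢ Set.Ioo 0 δ) :=
  hu.comp (hρ.continuousOn_parallelPoint.mono fun _ hp => ⟨hp.1, trivial⟩)
    fun p hp => hδ p.1 hp.1 p.2 hp.2

lemma IsDefiningFunction.continuousOn_dirDeriv_parallelPoint (hρ : IsDefiningFunction D ρ)
    (hδ : ∀ y ∈ frontier D, ∀ t ∈ Set.Ioo 0 δ, parallelPoint ρ (y, t) ∈ Dᶜ)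
    (hu : InnerProductSpace.HarmonicOnNhd u Dᶜ) :
    ContinuousOn (fun p => dirDeriv u (inwardNormal ρ p.1) (parallelPoint ρ p))
      (frontier D ×ˢ Set.Ioo 0 δ) := by
  have h1 : ContinuousOn (fun p => fderiv ℝ u (parallelPoint ρ p)) (frontier D ×ˢ Set.Ioo 0 δ) :=
    hu.continuousOn_fderiv.comp (hρ.continuousOn_parallelPoint.mono fun _ hp => ⟨hp.1, trivial⟩)
      fun p hp => hδ p.1 hp.1 p.2 hp.2
  exact h1.clm_apply (hρ.continuousOn_inwardNormal.comp continuousOn_fst fun p hp => hp.1)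

lemma ContinuousOn.comp_prodMk_right {f : Plane × ℝ → ℝ}
    (hf : ContinuousOn f (frontier D ×ˢ Set.Ioo 0 δ)) {t : ℝ} (ht : t ∈ Set.Ioo 0 δ) :
    ContinuousOn (fun y => f (y, t)) (frontier D) :=
  hf.comp (by fun_prop) fun _ hy => ⟨hy, ht⟩

lemma IsDefiningFunction.continuousOn_greenForm_parallelPoint (hρ : IsDefiningFunction D ρ)
    (hδ : ∀ y ∈ frontier D, ∀ t ∈ Set.Ioo 0 δ, parallelPoint ρ (y, t) ∈ Dᶜ)
    (hu : InnerProductSpace.HarmonicOnNhd u Dᶜ) (hv : InnerProductSpace.HarmonicOnNhd v Dᶜ) :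
    ContinuousOn (fun p => greenForm u v (parallelPoint ρ p) (inwardNormal ρ p.1))
      (frontier D ×ˢ Set.Ioo 0 δ) :=
  ((hρ.continuousOn_comp_parallelPoint hδ hu.continuousOn).mul
    (hρ.continuousOn_dirDeriv_parallelPoint hδ hv)).sub
  ((hρ.continuousOn_comp_parallelPoint hδ hv.continuousOn).mul
    (hρ.continuousOn_dirDeriv_parallelPoint hδ hu))

lemma integrable_normalMeasure_of_continuousOn (hDc : IsClosed D) (hD : Bornology.IsBounded D)
    [IsFiniteMeasure (boundaryMeasure D)] {f : Plane × ℝ → ℝ}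
    (hf : ContinuousOn f (frontier D ×ˢ Set.Ioo 0 δ)) {s t : ℝ} (hs : 0 < s) (ht : t < δ) :
    Integrable f (normalMeasure D s t) := by
  have hsub : frontier D ×ˢ Set.Icc s t ⊆ frontier D ×ˢ Set.Ioo 0 δ :=
    Set.prod_mono le_rfl fun r hr => ⟨hs.trans_le hr.1, hr.2.trans_lt ht⟩
  have hsub' : frontier D ×ˢ Set.Ioo s t ⊆ frontier D ×ˢ Set.Icc s t :=
    Set.prod_mono le_rfl Set.Ioo_subset_Icc_self
  obtain ⟨C, hC⟩ := ((isCompact_frontier hDc hD).prod isCompact_Icc).exists_bound_of_continuousOn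
    (hf.mono hsub)
  have hfin : IsFiniteMeasure (normalMeasure D s t) := by
    unfold normalMeasure; infer_instance
  refine ⟨?_, HasFiniteIntegral.of_bounded (C := C) ?_⟩
  · rw [normalMeasure_eq_restrict]
    exact (hf.mono (hsub'.trans hsub)).aestronglyMeasurable
      (isClosed_frontier.measurableSet.prod measurableSet_Ioo)
  · filter_upwards [ae_mem_normalMeasure D s t] with p hp
    exact hC p (hsub' hp)

end Traces

/-- Change to normal coordinates: if the Green flux through the layers near `∂D` is `ℓ` and the Green
flux through the parallel curves tends to `I`, then `ℓ = -I`; the sign comes from the direction of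
the normal. -/
theorem IsDefiningFunction.layerFlux_eq_neg_of_tendsto {D : Set Plane} {ρ : Plane → ℝ}
    (hρ : IsDefiningFunction D ρ) (hD : Bornology.IsBounded D) (hne : D.Nonempty)
    {u v : Plane → ℝ} (hu : InnerProductSpace.HarmonicOnNhd u Dᶜ)
    (hv : InnerProductSpace.HarmonicOnNhd v Dᶜ) {ℓ I C : ℝ}
    (hℓ : ∀ δ > 0, layerFlux D u v δ = ℓ)
    (hI : Tendsto (fun t : ℝ => ∫ y, greenForm u v (parallelPoint ρ (y, t)) (inwardNormal ρ y)
      ∂(boundaryMeasure D)) (𝓝[>] 0) (𝓝 I))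
    (hC : ∀ᶠ t : ℝ in 𝓝[>] 0, ∫ y, |greenForm u v (parallelPoint ρ (y, t)) (inwardNormal ρ y)|
      ∂(boundaryMeasure D) ≤ C) : ℓ = -I := by
  have hDc := hρ.isClosed
  have := hρ.isFiniteMeasure_boundaryMeasure hD
  obtain ⟨δ₁, hδ₁, hpar⟩ := hρ.exists_parallelPoint_mem_compl hD
  set F : Plane × ℝ → ℝ := fun p => greenForm u v (parallelPoint ρ p) (inwardNormal ρ p.1)
  have hFc : ContinuousOn F (frontier D ×ˢ Set.Ioo 0 δ₁) :=
    hρ.continuousOn_greenForm_parallelPoint (fun y hy t ht => (hpar y hy t ht).1) hu hv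
  have hC0 : 0 ≤ C := by
    obtain ⟨t, ht⟩ := hC.exists
    exact (integral_nonneg fun y => abs_nonneg _).trans ht
  have hbound : ∀ ε : ℝ, 0 < ε → |ℓ + I| ≤ 3 * (ε * (1 + ε)) * C + ε := by
    intro ε hε
    obtain ⟨δ₂, hδ₂, hcmp⟩ := hρ.exists_layer_comparison hD hne hε
    obtain ⟨δ₃, hδ₃, hsmall⟩ : ∃ δ₃ > 0, ∀ t ∈ Set.Ioo 0 δ₃,
        |∫ y, F (y, t) ∂(boundaryMeasure D) - I| ≤ ε ∧
          ∫ y, |F (y, t)| ∂(boundaryMeasure D) ≤ C := by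
      have h1 : ∀ᶠ t : ℝ in 𝓝[>] 0, |∫ y, F (y, t) ∂(boundaryMeasure D) - I| ≤ ε := by
        filter_upwards [Metric.tendsto_nhds.1 hI ε hε] with t ht
        exact ht.le
      obtain ⟨δ₃, hδ₃, h2⟩ := mem_nhdsGT_iff_exists_Ioo_subset.1 (h1.and hC)
      exact ⟨δ₃, hδ₃, fun t ht => h2 ht⟩
    set δ : ℝ := min δ₁ (min δ₂ δ₃) / 4 with hδdef
    have hmin : 0 < min δ₁ (min δ₂ δ₃) := lt_min hδ₁ (lt_min hδ₂ hδ₃)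
    have hδ : 0 < δ := by positivity
    have e1 : 2 * δ < δ₁ := by
      have := min_le_left δ₁ (min δ₂ δ₃); linarith
    have e2 : 2 * δ < δ₂ := by
      have := (min_le_right δ₁ (min δ₂ δ₃)).trans (min_le_left _ _); linarith
    have e3 : 2 * δ < δ₃ := by
      have := (min_le_right δ₁ (min δ₂ δ₃)).trans (min_le_right _ _); linarith
    obtain ⟨hle1, hle2⟩ := hcmp δ (2 * δ) hδ.le e2.le
    have hFi : Integrable F (normalMeasure D δ (2 * δ)) :=
      integrable_normalMeasure_of_continuousOn hDc hD hFc hδ e1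
    set G : Plane → ℝ := fun x => greenForm u v x (gradient (fun x => Metric.infDist x D) x)
    set ν := (normalMeasure D δ (2 * δ)).map (parallelPoint ρ)
    have hac : ν ≪ volume.restrict (exteriorLayer D δ (2 * δ)) :=
      Measure.absolutelyContinuous_of_le_smul hle2
    have hGm : AEStronglyMeasurable G ν :=
      ((aestronglyMeasurable_greenForm_gradient hDc.isOpen_compl hu hv _).mono_set
        (exteriorLayer_subset_compl D hδ.le)).mono_ac hac
    -- by Rademacher the distance function is differentiable at almost every point of the layer
    have hGF : (fun p => G (parallelPoint ρ p)) =ᵐ[normalMeasure D δ (2 * δ)] fun p => -F p := by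
      have hd : ∀ᵐ x ∂ν, DifferentiableAt ℝ (fun x => Metric.infDist x D) x :=
        hac.ae_le (ae_restrict_of_ae (Metric.lipschitz_infDist_pt D).ae_differentiableAt)
      filter_upwards [ae_of_ae_map hρ.measurable_parallelPoint.aemeasurable hd,
        ae_mem_normalMeasure D δ (2 * δ)] with p hp hpm
      simp only [G, F]
      rw [(hpar p.1 hpm.1 p.2 ⟨hδ.trans hpm.2.1, hpm.2.2.trans e1⟩).2 hp, greenForm_neg]
    have hm := hρ.measurable_parallelPoint.aemeasurable (μ := normalMeasure D δ (2 * δ))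
    have hGi : Integrable G ν :=
      (integrable_map_measure hGm hm).2 (hFi.neg.congr hGF.symm)
    have hG1 : ∫ x, G x ∂ν = -∫ p, F p ∂(normalMeasure D δ (2 * δ)) := by
      rw [integral_map hm hGm, integral_congr_ae hGF, integral_neg]
    have hG2 : ∫ x, |G x| ∂ν = ∫ p, |F p| ∂(normalMeasure D δ (2 * δ)) := by
      rw [integral_map hm (continuous_abs.comp_aestronglyMeasurable hGm)]
      refine integral_congr_ae ?_
      filter_upwards [hGF] with p hp
      rw [hp, abs_neg]
    -- passing from area to `dS dt` costs a small multiple of `∫ |F| ≤ C δ`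
    have hmain := abs_integral_sub_integral_le_of_le hε.le hle1 hle2 hGi
    rw [hG1, hG2] at hmain
    have hvol : volume.real (Set.Ioo δ (2 * δ)) = δ := by
      rw [Real.volume_real_Ioo_of_le (by linarith)]; ring
    have hlt : volume (Set.Ioo δ (2 * δ)) < ∞ := measure_Ioo_lt_top
    have habs : ∫ p, |F p| ∂(normalMeasure D δ (2 * δ)) ≤ C * δ := by
      rw [normalMeasure, integral_prod_symm _ hFi.abs]
      have h1 := norm_setIntegral_le_of_norm_le_const (μ := volume) (C := C)
        (f := fun t => ∫ y, |F (y, t)| ∂(boundaryMeasure D)) hlt fun t ht => by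
          rw [Real.norm_eq_abs, abs_of_nonneg (integral_nonneg fun y => abs_nonneg _)]
          exact (hsmall t ⟨hδ.trans ht.1, ht.2.trans e3⟩).2
      rw [hvol] at h1
      exact (le_abs_self _).trans h1
    have havg : |∫ p, F p ∂(normalMeasure D δ (2 * δ)) - δ * I| ≤ ε * δ := by
      have h0 : Integrable (fun t => ∫ y, F (y, t) ∂(boundaryMeasure D))
          (volume.restrict (Set.Ioo δ (2 * δ))) := hFi.integral_prod_right
      have h1 := norm_setIntegral_le_of_norm_le_const (μ := volume) (C := ε)
        (f := fun t => ∫ y, F (y, t) ∂(boundaryMeasure D) - I) hlt fun t ht => by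
          rw [Real.norm_eq_abs]
          exact (hsmall t ⟨hδ.trans ht.1, ht.2.trans e3⟩).1
      rw [hvol, integral_sub h0 (integrable_const I), setIntegral_const, hvol, smul_eq_mul] at h1
      rw [normalMeasure, integral_prod_symm _ hFi]
      exact h1
    have hℓδ : δ * ℓ = ∫ x in exteriorLayer D δ (2 * δ), G x := by
      rw [← hℓ δ hδ, layerFlux, ← mul_assoc, mul_inv_cancel₀ hδ.ne', one_mul]
    rw [← hℓδ] at hmain
    have h3 : 0 ≤ 3 * (ε * (1 + ε)) := by positivity
    have h4 : δ * |ℓ + I| ≤ δ * (3 * (ε * (1 + ε)) * C + ε) := by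
      have h5 : δ * |ℓ + I| = |δ * (ℓ + I)| := by rw [abs_mul, abs_of_pos hδ]
      have h6 : 3 * (ε * (1 + ε)) * ∫ p, |F p| ∂(normalMeasure D δ (2 * δ))
          ≤ 3 * (ε * (1 + ε)) * (C * δ) := by gcongr
      rw [h5]
      rw [abs_le] at hmain havg ⊢
      constructor <;> nlinarith [hmain.1, hmain.2, havg.1, havg.2]
    exact le_of_mul_le_mul_left h4 hδ
  have hlim : Tendsto (fun ε : ℝ => 3 * (ε * (1 + ε)) * C + ε) (𝓝[>] 0) (𝓝 0) := by
    have h1 : Continuous fun ε : ℝ => 3 * (ε * (1 + ε)) * C + ε := by fun_prop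
    have h2 := (h1.tendsto 0).mono_left (nhdsWithin_le_nhds (s := Set.Ioi 0))
    simpa using h2
  have h1 : |ℓ + I| ≤ 0 := ge_of_tendsto hlim (by
    filter_upwards [self_mem_nhdsWithin] with ε hε
    exact hbound ε hε)
  have h2 := abs_eq_zero.1 (le_antisymm h1 (abs_nonneg _))
  linarith

/-! ### Passage to the boundary under Robin conditions -/

lemma tendsto_integral_abs_of_lintegral {α ι : Type*} [MeasurableSpace α] {μ : Measure α}
    {l : Filter ι} {f : ι → α → ℝ} (h : Tendsto (fun t => ∫⁻ y, ‖f t y‖ₑ ∂μ) l (𝓝 0))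
    (hm : ∀ᶠ t in l, AEStronglyMeasurable (f t) μ) :
    Tendsto (fun t => ∫ y, |f t y| ∂μ) l (𝓝 0) := by
  have h1 := (ENNReal.tendsto_toReal ENNReal.zero_ne_top).comp h
  refine (h1.congr' ?_)
  filter_upwards [hm] with t ht
  exact (integral_norm_eq_lintegral_enorm ht).symm

section Limits

variable {D : Set Plane} {ρ : Plane → ℝ} {κ : ℝ} {u b g : Plane → ℝ}

lemma IsDefiningFunction.eventually_integrable_traces (hρ : IsDefiningFunction D ρ)
    (hD : Bornology.IsBounded D) (hu : InnerProductSpace.HarmonicOnNhd u Dᶜ) :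
    ∀ᶠ t : ℝ in 𝓝[>] 0,
      Integrable (fun y => u (parallelPoint ρ (y, t))) (boundaryMeasure D) ∧
      Integrable (fun y => dirDeriv u (inwardNormal ρ y) (parallelPoint ρ (y, t)))
        (boundaryMeasure D) := by
  have := hρ.isFiniteMeasure_boundaryMeasure hD
  obtain ⟨δ, hδ, hpar⟩ := hρ.exists_parallelPoint_mem_compl hD
  have hmem : ∀ y ∈ frontier D, ∀ t ∈ Set.Ioo 0 δ, parallelPoint ρ (y, t) ∈ Dᶜ :=
    fun y hy t ht => (hpar y hy t ht).1
  filter_upwards [Ioo_mem_nhdsGT hδ] with t ht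
  exact ⟨integrable_boundaryMeasure_of_continuousOn hρ.isClosed hD
      ((hρ.continuousOn_comp_parallelPoint hmem hu.continuousOn).comp_prodMk_right ht),
    integrable_boundaryMeasure_of_continuousOn hρ.isClosed hD
      ((hρ.continuousOn_dirDeriv_parallelPoint hmem hu).comp_prodMk_right ht)⟩

lemma HasRobinData.tendsto_integral (h : HasRobinData D ρ κ u b) (hρ : IsDefiningFunction D ρ)
    (hD : Bornology.IsBounded D) (hu : InnerProductSpace.HarmonicOnNhd u Dᶜ) :
    Tendsto (fun t : ℝ => ∫ y, |u (parallelPoint ρ (y, t))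
      + κ * dirDeriv u (inwardNormal ρ y) (parallelPoint ρ (y, t)) - b y| ∂(boundaryMeasure D))
      (𝓝[>] 0) (𝓝 0) := by
  refine tendsto_integral_abs_of_lintegral h.2 ?_
  filter_upwards [hρ.eventually_integrable_traces hD hu] with t ht
  exact ((ht.1.add (ht.2.const_mul κ)).sub h.1).aestronglyMeasurable

lemma HasNormalDerivative.tendsto_integral (h : HasNormalDerivative D ρ u g)
    (hρ : IsDefiningFunction D ρ) (hD : Bornology.IsBounded D)
    (hu : InnerProductSpace.HarmonicOnNhd u Dᶜ) :
    Tendsto (fun t : ℝ => ∫ y, |dirDeriv u (inwardNormal ρ y) (parallelPoint ρ (y, t)) - g y|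
      ∂(boundaryMeasure D)) (𝓝[>] 0) (𝓝 0) := by
  refine tendsto_integral_abs_of_lintegral h.2 ?_
  filter_upwards [hρ.eventually_integrable_traces hD hu] with t ht
  exact (ht.2.sub h.1).aestronglyMeasurable

lemma frontier_subset_closure_compl (D : Set Plane) : frontier D ⊆ closure Dᶜ := by
  rw [frontier_eq_closure_inter_closure]
  exact Set.inter_subset_right

/-- Functions that are continuous up to `∂D` attain their boundary values uniformly along the
normals. -/
lemma IsDefiningFunction.eventually_abs_sub_le (hρ : IsDefiningFunction D ρ)
    (hD : Bornology.IsBounded D) (hu : ContinuousOn u (closure Dᶜ)) {ε : ℝ} (hε : 0 < ε) :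
    ∀ᶠ t : ℝ in 𝓝[>] 0, ∀ y ∈ frontier D, |u (parallelPoint ρ (y, t)) - u y| ≤ ε := by
  obtain ⟨δ₁, hδ₁, hpar⟩ := hρ.exists_parallelPoint_mem_compl hD
  obtain ⟨R, hR⟩ := hD.subset_closedBall 0
  have hK : IsCompact (closure Dᶜ ∩ Metric.closedBall (0 : Plane) (R + 1)) :=
    (isCompact_closedBall 0 (R + 1)).inter_left isClosed_closure
  have huc := hK.uniformContinuousOn_of_continuous (hu.mono Set.inter_subset_left)
  obtain ⟨δ₂, hδ₂, huc'⟩ := Metric.uniformContinuousOn_iff.1 huc ε hε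
  filter_upwards [Ioo_mem_nhdsGT hδ₁, Ioo_mem_nhdsGT hδ₂, Ioo_mem_nhdsGT (zero_lt_one' ℝ)]
    with t ht1 ht2 ht3 y hy
  have hdist : dist (parallelPoint ρ (y, t)) y = t := by
    rw [hρ.dist_parallelPoint hy, abs_of_pos ht1.1]
  have hy' : dist y 0 ≤ R := hR (hρ.frontier_subset hy)
  have h1 := huc' _ ⟨subset_closure (hpar y hy t ht1).1, by
      rw [Metric.mem_closedBall]
      have := dist_triangle (parallelPoint ρ (y, t)) y 0
      linarith [ht3.2]⟩ y ⟨frontier_subset_closure_compl D hy, by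
      rw [Metric.mem_closedBall]; linarith⟩ (by rw [hdist]; exact ht2.2)
  exact h1.le

/-- If `a + κ ∂a/∂n = b`, `∂W/∂n = h` and `W = -κ h` on `∂D`, the Green flux of `(a, W)` through the
parallel curves tends to `∫ b h`: the integrand is
`a (∂W/∂n - h) + h (a + κ ∂a/∂n) - (W + κ h) ∂a/∂n`. -/
lemma tendsto_integral_abs_greenForm_sub {a W h : Plane → ℝ} (hρ : IsDefiningFunction D ρ)
    (hD : Bornology.IsBounded D) (hκ : 0 < κ) (ha : IsBoundedExteriorHarmonic D a)
    (hab : HasRobinData D ρ κ a b) (hW : InnerProductSpace.HarmonicOnNhd W Dᶜ)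
    (hh : ContinuousOn h (frontier D))
    (hA : Tendsto (fun t : ℝ => ∫ y, |dirDeriv W (inwardNormal ρ y) (parallelPoint ρ (y, t)) - h y|
      ∂(boundaryMeasure D)) (𝓝[>] 0) (𝓝 0))
    (hB : ∀ ε > 0, ∀ᶠ t : ℝ in 𝓝[>] 0, ∀ y ∈ frontier D,
      |W (parallelPoint ρ (y, t)) + κ * h y| ≤ ε) :
    Tendsto (fun t : ℝ => ∫ y, |greenForm a W (parallelPoint ρ (y, t)) (inwardNormal ρ y)
      - b y * h y| ∂(boundaryMeasure D)) (𝓝[>] 0) (𝓝 0) := by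
  have hfin := hρ.isFiniteMeasure_boundaryMeasure hD
  obtain ⟨M, hM⟩ := ha.bounded
  obtain ⟨N, hN⟩ := (isCompact_frontier hρ.isClosed hD).exists_bound_of_continuousOn hh
  obtain ⟨δ, hδ, hpar⟩ := hρ.exists_parallelPoint_mem_compl hD
  have hhi := integrable_boundaryMeasure_of_continuousOn hρ.isClosed hD hh
  set S := boundaryMeasure D
  set B : ℝ := ∫ y, (|b y| + |M|) ∂S
  have hr := hab.tendsto_integral hρ hD ha.harmonic
  set X : ℝ → ℝ := fun t =>
    ∫ y, |dirDeriv W (inwardNormal ρ y) (parallelPoint ρ (y, t)) - h y| ∂S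
  set r : ℝ → ℝ := fun t => ∫ y, |a (parallelPoint ρ (y, t))
      + κ * dirDeriv a (inwardNormal ρ y) (parallelPoint ρ (y, t)) - b y| ∂S
  have hbi : Integrable b S := hab.1
  have key : ∀ ε > 0, ∀ᶠ t : ℝ in 𝓝[>] 0,
      ∫ y, |greenForm a W (parallelPoint ρ (y, t)) (inwardNormal ρ y) - b y * h y| ∂S
        ≤ |M| * X t + |N| * r t + ε * κ⁻¹ * (r t + B) := by
    intro ε hε
    filter_upwards [hB ε hε, hρ.eventually_integrable_traces hD ha.harmonic,
      hρ.eventually_integrable_traces hD hW, Ioo_mem_nhdsGT hδ] with t hBt hta htW htδ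
    have i1 : Integrable (fun y => |dirDeriv W (inwardNormal ρ y) (parallelPoint ρ (y, t)) - h y|) S :=
      (htW.2.sub hhi).abs
    have i2 : Integrable (fun y => |a (parallelPoint ρ (y, t))
        + κ * dirDeriv a (inwardNormal ρ y) (parallelPoint ρ (y, t)) - b y|) S :=
      ((hta.1.add (hta.2.const_mul κ)).sub hbi).abs
    have i3 : Integrable (fun y => |b y| + |M|) S := hbi.abs.add (integrable_const _)
    have e1 : |M| * X t + |N| * r t + ε * κ⁻¹ * (r t + B)
        = ∫ y, (|M| * |dirDeriv W (inwardNormal ρ y) (parallelPoint ρ (y, t)) - h y|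
          + |N| * |a (parallelPoint ρ (y, t))
            + κ * dirDeriv a (inwardNormal ρ y) (parallelPoint ρ (y, t)) - b y|
          + ε * κ⁻¹ * (|a (parallelPoint ρ (y, t))
            + κ * dirDeriv a (inwardNormal ρ y) (parallelPoint ρ (y, t)) - b y|
              + (|b y| + |M|))) ∂S := by
      have j1 : Integrable (fun y => |M| * |dirDeriv W (inwardNormal ρ y) (parallelPoint ρ (y, t)) - h y|
          + |N| * |a (parallelPoint ρ (y, t))
            + κ * dirDeriv a (inwardNormal ρ y) (parallelPoint ρ (y, t)) - b y|) S :=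
        (i1.const_mul _).add (i2.const_mul _)
      have j2 : Integrable (fun y => ε * κ⁻¹ * (|a (parallelPoint ρ (y, t))
            + κ * dirDeriv a (inwardNormal ρ y) (parallelPoint ρ (y, t)) - b y|
              + (|b y| + |M|))) S := (i2.add i3).const_mul _
      rw [integral_add j1 j2, integral_add (i1.const_mul _) (i2.const_mul _), integral_const_mul,
        integral_const_mul, integral_const_mul, integral_add i2 i3]
    rw [e1]
    refine integral_mono_of_nonneg (.of_forall fun y => abs_nonneg _)
      (((i1.const_mul _).add (i2.const_mul _)).add ((i2.add i3).const_mul _)) ?_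
    filter_upwards [ae_mem_frontier D] with y hy
    have hMy : |a (parallelPoint ρ (y, t))| ≤ |M| :=
      (hM _ (hpar y hy t htδ).1).trans (le_abs_self M)
    have hNy : |h y| ≤ |N| := (hN y hy).trans (le_abs_self N)
    have hBy := hBt y hy
    simp only [greenForm]
    change |a (parallelPoint ρ (y, t)) * dirDeriv W (inwardNormal ρ y) (parallelPoint ρ (y, t))
      - W (parallelPoint ρ (y, t)) * dirDeriv a (inwardNormal ρ y) (parallelPoint ρ (y, t))
      - b y * h y| ≤ _
    generalize a (parallelPoint ρ (y, t)) = A at *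
    generalize dirDeriv a (inwardNormal ρ y) (parallelPoint ρ (y, t)) = A' at *
    generalize W (parallelPoint ρ (y, t)) = w at *
    generalize dirDeriv W (inwardNormal ρ y) (parallelPoint ρ (y, t)) = w' at *
    -- the normal derivative of `a` is bounded in `L¹` because `a` is bounded and `b` integrable
    have hA' : |A'| ≤ κ⁻¹ * (|A + κ * A' - b y| + (|b y| + |M|)) := by
      have h1 : A' = κ⁻¹ * ((A + κ * A' - b y) + (b y - A)) := by field_simp; ring
      have h2 : |(A + κ * A' - b y) + (b y - A)| ≤ |A + κ * A' - b y| + (|b y| + |M|) := by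
        refine (abs_add_le _ _).trans ?_
        have := abs_sub (b y) A
        linarith
      calc |A'| = κ⁻¹ * |(A + κ * A' - b y) + (b y - A)| := by
            conv_lhs => rw [h1]
            rw [abs_mul, abs_of_pos (by positivity : 0 < κ⁻¹)]
        _ ≤ _ := by gcongr
    -- each term holds one defect: of `∂W/∂n = h`, of the condition on `a`, and of `W = -κ h`
    have hdec : A * w' - w * A' - b y * h y
        = A * (w' - h y) + h y * (A + κ * A' - b y) - (w + κ * h y) * A' := by ring
    rw [hdec]
    calc |A * (w' - h y) + h y * (A + κ * A' - b y) - (w + κ * h y) * A'|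
        ≤ |A * (w' - h y)| + |h y * (A + κ * A' - b y)| + |(w + κ * h y) * A'| := by
          refine (abs_sub _ _).trans ?_
          gcongr
          exact abs_add_le _ _
      _ ≤ |M| * |w' - h y| + |N| * |A + κ * A' - b y|
          + ε * (κ⁻¹ * (|A + κ * A' - b y| + (|b y| + |M|))) := by
          rw [abs_mul, abs_mul, abs_mul]
          gcongr
      _ = _ := by ring
  have hB0 : 0 ≤ B := integral_nonneg fun y => by positivity
  rw [Metric.tendsto_nhds]
  intro η hη
  -- makes the limit `ε κ⁻¹ B` of the bound smaller than `η`
  set ε : ℝ := η * κ / (2 * (B + 1)) with hεdef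
  have hε : 0 < ε := by positivity
  have hlim : Tendsto (fun t => |M| * X t + |N| * r t + ε * κ⁻¹ * (r t + B)) (𝓝[>] 0)
      (𝓝 (|M| * 0 + |N| * 0 + ε * κ⁻¹ * (0 + B))) :=
    ((hA.const_mul _).add (hr.const_mul _)).add ((hr.add_const B).const_mul _)
  have hlt : |M| * 0 + |N| * 0 + ε * κ⁻¹ * (0 + B) < η := by
    have h1 : |M| * 0 + |N| * 0 + ε * κ⁻¹ * (0 + B) = η * (B / (2 * (B + 1))) := by
      rw [hεdef]; field_simp; ring
    have h2 : B / (2 * (B + 1)) < 1 := by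
      rw [div_lt_one (by positivity)]; linarith
    rw [h1]
    nlinarith
  filter_upwards [key ε hε, hlim.eventually_lt_const hlt] with t h1 h2
  rw [Real.dist_eq, sub_zero, abs_of_nonneg (integral_nonneg fun y => abs_nonneg _)]
  exact h1.trans_lt h2

end Limits

lemma integrable_mul_of_continuousOn_frontier {D : Set Plane} (hDc : IsClosed D)
    (hD : Bornology.IsBounded D) {b h : Plane → ℝ} (hb : Integrable b (boundaryMeasure D))
    (hh : ContinuousOn h (frontier D)) : Integrable (fun y => b y * h y) (boundaryMeasure D) := by
  obtain ⟨N, hN⟩ := (isCompact_frontier hDc hD).exists_bound_of_continuousOn hh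
  refine hb.mul_bdd (c := N) (hh.aestronglyMeasurable isClosed_frontier.measurableSet) ?_
  filter_upwards [ae_mem_frontier D] with y hy using hN y hy

lemma continuousOn_exteriorGreen {D : Set Plane} (h0 : (0 : Plane) ∈ interior D) {H₀ : Plane → ℝ}
    (hH₀ : ContinuousOn H₀ (closure Dᶜ)) : ContinuousOn (exteriorGreen H₀) (closure Dᶜ) := by
  refine ContinuousOn.add (ContinuousOn.mul continuousOn_const
    (ContinuousOn.log continuous_norm.continuousOn fun x hx => ?_)) hH₀
  rw [closure_compl] at hx
  refine norm_ne_zero_iff.2 ?_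
  rintro rfl
  exact hx h0

lemma IsBoundedExteriorHarmonic.sub_const_mul {D : Set Plane} {u v : Plane → ℝ}
    (hu : IsBoundedExteriorHarmonic D u) (hv : IsBoundedExteriorHarmonic D v) (κ : ℝ) :
    IsBoundedExteriorHarmonic D (fun x => u x - κ * v x) := by
  obtain ⟨M, hM⟩ := hu.bounded
  obtain ⟨N, hN⟩ := hv.bounded
  refine ⟨fun x hx => (hu.harmonic x hx).sub ((hv.harmonic x hx).const_smul (c := κ)),
    M + |κ| * N, fun x hx => ?_⟩
  refine (abs_sub _ _).trans ?_
  rw [abs_mul]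
  have h1 := hM x hx
  have h2 := hN x hx
  gcongr

/-- The value at infinity of `a` for general `D`, by Green's identity for `a` and the Green function
`W = H - κ Hκ`, which satisfies the homogeneous Robin condition. -/
theorem tendsto_cobounded_integral_robinKernel {κ : ℝ} (hκ : 0 < κ)
    {D : Set Plane} {ρ : Plane → ℝ} (hρ : IsDefiningFunction D ρ)
    (hD : Bornology.IsBounded D) (h0 : (0 : Plane) ∈ interior D) {a b : Plane → ℝ}
    (ha : IsBoundedExteriorHarmonic D a) (hab : HasRobinData D ρ κ a b) {H₀ Hκ : Plane → ℝ}
    (hH₀ : IsGreenCorrector D H₀) (hHκ : IsRobinKernel D ρ κ H₀ Hκ) :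
    Tendsto a (Bornology.cobounded Plane) (𝓝 (∫ y, b y * Hκ y ∂(boundaryMeasure D))) := by
  have hfin := hρ.isFiniteMeasure_boundaryMeasure hD
  have hDc := hρ.isClosed
  have h0D : (0 : Plane) ∈ D := interior_subset h0
  obtain ⟨g, hg, hgκ⟩ := hHκ.robin
  obtain ⟨L, -, -, hL, -⟩ := ha.exists_limit hD
  have hH := harmonicOnNhd_exteriorGreen h0D hH₀.harmonic
  have hHc := continuousOn_exteriorGreen h0 hH₀.continuousOn
  have hV := hH₀.toIsBoundedExteriorHarmonic.sub_const_mul hHκ.toIsBoundedExteriorHarmonic κ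
  have hW := harmonicOnNhd_exteriorGreen h0D hV.harmonic
  set W := exteriorGreen fun x => H₀ x - κ * Hκ x
  have hWeq : ∀ x, W x = exteriorGreen H₀ x - κ * Hκ x := fun x => by
    simp only [W, exteriorGreen]; ring
  have hHκf : ContinuousOn Hκ (frontier D) :=
    hHκ.continuousOn.mono (frontier_subset_closure_compl D)
  have hHκi := integrable_boundaryMeasure_of_continuousOn hDc hD hHκf
  have hHzero : ∀ y ∈ frontier D, exteriorGreen H₀ y = 0 := fun y hy => by
    rw [exteriorGreen, hH₀.boundary_eq y hy]; ring
  obtain ⟨δ, hδ, hpar⟩ := hρ.exists_parallelPoint_mem_compl hD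
  set S := boundaryMeasure D
  -- `W = -κ Hκ` on `∂D`, uniformly
  have hB : ∀ ε > 0, ∀ᶠ t : ℝ in 𝓝[>] 0, ∀ y ∈ frontier D,
      |W (parallelPoint ρ (y, t)) + κ * Hκ y| ≤ ε := by
    intro ε hε
    filter_upwards [hρ.eventually_abs_sub_le hD hHc (half_pos hε),
      hρ.eventually_abs_sub_le hD hHκ.continuousOn (show 0 < ε / (2 * κ) by positivity)]
      with t h1 h2 y hy
    have e1 := h1 y hy
    have e2 := h2 y hy
    rw [hHzero y hy, sub_zero] at e1
    have e3 : W (parallelPoint ρ (y, t)) + κ * Hκ y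
        = exteriorGreen H₀ (parallelPoint ρ (y, t)) - κ * (Hκ (parallelPoint ρ (y, t)) - Hκ y) := by
      rw [hWeq]; ring
    rw [e3]
    refine (abs_sub _ _).trans ?_
    rw [abs_mul, abs_of_pos hκ]
    calc _ ≤ ε / 2 + κ * (ε / (2 * κ)) := by gcongr
      _ = ε := by field_simp; ring
  -- `∂W/∂n = Hκ` on `∂D` in `L¹`, by subtracting the two conditions with the same datum `g`
  have hA : Tendsto (fun t : ℝ => ∫ y, |dirDeriv W (inwardNormal ρ y) (parallelPoint ρ (y, t))
      - Hκ y| ∂S) (𝓝[>] 0) (𝓝 0) := by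
    have t1 := hg.tendsto_integral hρ hD hH
    have t2 := hgκ.tendsto_integral hρ hD hHκ.harmonic
    have t3 : Tendsto (fun t : ℝ => ∫ y, |Hκ (parallelPoint ρ (y, t)) - Hκ y| ∂S) (𝓝[>] 0)
        (𝓝 0) := by
      rw [Metric.tendsto_nhds]
      intro ε hε
      set η := ε / (S.real Set.univ + 1)
      have hη : 0 < η := by positivity
      filter_upwards [hρ.eventually_abs_sub_le hD hHκ.continuousOn hη] with t ht
      have h1 : ∀ᵐ y ∂S, ‖|Hκ (parallelPoint ρ (y, t)) - Hκ y|‖ ≤ η := by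
        filter_upwards [ae_mem_frontier D] with y hy
        rw [Real.norm_eq_abs, abs_abs]
        exact ht y hy
      have h2 := norm_integral_le_of_norm_le_const h1
      rw [dist_zero_right]
      refine h2.trans_lt ?_
      calc η * S.real Set.univ < η * (S.real Set.univ + 1) := by gcongr; linarith
        _ = ε := by simp only [η]; field_simp
    have t4 := (t1.add t2).add t3
    simp only [add_zero] at t4
    refine squeeze_zero' (.of_forall fun t => integral_nonneg fun y => abs_nonneg _) ?_ t4
    filter_upwards [hρ.eventually_integrable_traces hD hH,
      hρ.eventually_integrable_traces hD hHκ.harmonic, Ioo_mem_nhdsGT hδ] with t hti htκ htδ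
    have i1 := (hti.2.sub hg.1).abs
    have i2 := ((htκ.1.add (htκ.2.const_mul κ)).sub hg.1).abs
    have i3 := (htκ.1.sub hHκi).abs
    refine le_of_le_of_eq (integral_mono_of_nonneg (.of_forall fun y => abs_nonneg _)
      ((i1.add i2).add i3) ?_) ((integral_add (i1.add i2) i3).trans
        (congrArg (· + _) (integral_add i1 i2)))
    filter_upwards [ae_mem_frontier D] with y hy
    have hx := (hpar y hy t htδ).1
    have hd : dirDeriv W (inwardNormal ρ y) (parallelPoint ρ (y, t))
        = dirDeriv (exteriorGreen H₀) (inwardNormal ρ y) (parallelPoint ρ (y, t))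
          - κ * dirDeriv Hκ (inwardNormal ρ y) (parallelPoint ρ (y, t)) := by
      have d1 := ((hH _ hx).1.differentiableAt (by norm_num)).hasFDerivAt
      have d2 := ((hHκ.harmonic _ hx).1.differentiableAt (by norm_num)).hasFDerivAt
      have d3 : HasFDerivAt W _ (parallelPoint ρ (y, t)) :=
        (d1.sub (d2.const_mul κ)).congr_of_eventuallyEq (.of_forall hWeq)
      simp [dirDeriv, d3.fderiv]
    rw [hd]
    simp only [Pi.add_apply, Pi.sub_apply]
    generalize dirDeriv (exteriorGreen H₀) (inwardNormal ρ y) (parallelPoint ρ (y, t)) = p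
    generalize dirDeriv Hκ (inwardNormal ρ y) (parallelPoint ρ (y, t)) = q
    generalize Hκ (parallelPoint ρ (y, t)) = s
    have e1 : p - κ * q - Hκ y = (p - g y) - (s + κ * q - g y) + (s - Hκ y) := by ring
    rw [e1]
    refine (abs_add_le _ _).trans ?_
    gcongr
    exact abs_sub _ _
  have hflux := tendsto_integral_abs_greenForm_sub hρ hD hκ ha hab hW hHκf hA hB
  have hbi := integrable_mul_of_continuousOn_frontier hDc hD hab.1 hHκf
  have hgi : ∀ᶠ t : ℝ in 𝓝[>] 0, Integrable (fun y => greenForm a W (parallelPoint ρ (y, t))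
      (inwardNormal ρ y)) S := by
    filter_upwards [Ioo_mem_nhdsGT hδ] with t ht
    exact integrable_boundaryMeasure_of_continuousOn hDc hD
      ((hρ.continuousOn_greenForm_parallelPoint (fun y hy t ht => (hpar y hy t ht).1)
        ha.harmonic hW).comp_prodMk_right ht)
  have hI : Tendsto (fun t : ℝ => ∫ y, greenForm a W (parallelPoint ρ (y, t)) (inwardNormal ρ y) ∂S)
      (𝓝[>] 0) (𝓝 (∫ y, b y * Hκ y ∂S)) := by
    rw [tendsto_iff_norm_sub_tendsto_zero]
    refine squeeze_zero' (.of_forall fun t => norm_nonneg _) ?_ hflux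
    filter_upwards [hgi] with t ht
    rw [← integral_sub ht hbi]
    exact norm_integral_le_integral_norm _
  have hC : ∀ᶠ t : ℝ in 𝓝[>] 0,
      ∫ y, |greenForm a W (parallelPoint ρ (y, t)) (inwardNormal ρ y)| ∂S
        ≤ 1 + ∫ y, |b y * Hκ y| ∂S := by
    filter_upwards [hgi, hflux.eventually_lt_const one_pos] with t ht h1
    have h2 : ∫ y, |greenForm a W (parallelPoint ρ (y, t)) (inwardNormal ρ y)| ∂S
        ≤ ∫ y, (|greenForm a W (parallelPoint ρ (y, t)) (inwardNormal ρ y) - b y * Hκ y|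
          + |b y * Hκ y|) ∂S := by
      refine integral_mono ht.abs ((ht.sub hbi).abs.add hbi.abs) fun y => ?_
      have := abs_sub_abs_le_abs_sub
        (greenForm a W (parallelPoint ρ (y, t)) (inwardNormal ρ y)) (b y * Hκ y)
      simp only
      linarith
    have hs : Integrable (fun y => |greenForm a W (parallelPoint ρ (y, t)) (inwardNormal ρ y)
        - b y * Hκ y|) S := (ht.sub hbi).abs
    have hs' : Integrable (fun y => |b y * Hκ y|) S := hbi.abs
    rw [integral_add hs hs'] at h2
    linarith
  have hL' := hρ.layerFlux_eq_neg_of_tendsto hD ⟨0, h0D⟩ ha.harmonic hW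
    (fun δ hδ => layerFlux_exteriorGreen hDc h0D hD ha hV hL hδ) hI hC
  rw [neg_inj] at hL'
  rwa [← hL']

/-! ### The unit disc -/

lemma norm_eq_one_of_mem_frontier_closedBall {y : Plane}
    (hy : y ∈ frontier (Metric.closedBall (0 : Plane) 1)) : ‖y‖ = 1 := by
  rw [frontier_closedBall _ one_ne_zero] at hy
  simpa using hy

/-- The inward normal of the unit disc at `y` is `-y`, whatever the defining function. -/
lemma inwardNormal_closedBall {ρ : Plane → ℝ}
    (hρ : IsDefiningFunction (Metric.closedBall (0 : Plane) 1) ρ)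
    {y : Plane} (hy : ‖y‖ = 1) : inwardNormal ρ y = -y := by
  have hd : dist ((2 : ℝ) • y) y = 1 := by
    rw [dist_eq_norm, show (2 : ℝ) • y - y = y by rw [two_smul, add_sub_cancel_right], hy]
  -- `y` is the point of the disc nearest to `2y`
  have h := (hρ.eq_parallelPoint_of_nearest (x := (2 : ℝ) • y) (y := y)
    (fun h => by rw [h, dist_self] at hd; exact zero_ne_one hd) (by simp [hy]) fun z hz => by
      have hz' : ‖z‖ ≤ 1 := by simpa using hz
      have := norm_sub_norm_le ((2 : ℝ) • y) z
      rw [norm_smul, hy, Real.norm_two] at this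
      rw [hd, dist_eq_norm]
      linarith).2
  rw [hd, parallelPoint, one_smul, two_smul] at h
  have h' : y = -inwardNormal ρ y := by simpa [sub_eq_add_neg] using h
  exact neg_eq_iff_eq_neg.mp h'.symm

lemma hasFDerivAt_log_norm {x : Plane} (hx : x ≠ 0) :
    HasFDerivAt (fun x : Plane => Real.log ‖x‖) ((‖x‖ ^ 2)⁻¹ • innerSL ℝ x) x := by
  have h1 : HasFDerivAt (fun x : Plane => Real.log (‖x‖ ^ 2)) ((‖x‖ ^ 2)⁻¹ • (2 • innerSL ℝ x)) x :=
    (hasStrictFDerivAt_norm_sq x).hasFDerivAt.log (by simpa using hx)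
  have h2 : HasFDerivAt (fun x : Plane => Real.log ‖x‖)
      ((1 / 2 : ℝ) • (‖x‖ ^ 2)⁻¹ • (2 • innerSL ℝ x)) x :=
    (h1.const_mul (1 / 2)).congr_of_eventuallyEq (.of_forall fun z => by
      simp only [Real.log_pow]; push_cast; ring)
  have e : (1 / 2 : ℝ) • (‖x‖ ^ 2)⁻¹ • (2 • innerSL ℝ x) = (‖x‖ ^ 2)⁻¹ • innerSL ℝ x := by
    rw [← Nat.cast_smul_eq_nsmul ℝ, smul_smul, smul_smul]
    congr 1
    push_cast
    ring
  rwa [e] at h2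

/-- The derivative of `-(1/2π) log |x|` along the inward normal on a circle about `0`. -/
lemma dirDeriv_exteriorGreen_zero {y : Plane} (hy : ‖y‖ = 1) {t : ℝ} (ht : 0 < t) :
    dirDeriv (exteriorGreen fun _ => 0) (-y) ((1 + t) • y) = 1 / (2 * Real.pi) * (1 + t)⁻¹ := by
  have ht' : 0 < 1 + t := by linarith
  have hn : ‖(1 + t) • y‖ = 1 + t := by
    rw [norm_smul, hy, mul_one, Real.norm_eq_abs, abs_of_pos ht']
  have hx0 : (1 + t) • y ≠ 0 := norm_pos_iff.mp (by rw [hn]; exact ht')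
  have h1 : HasFDerivAt (exteriorGreen fun _ => 0) _ ((1 + t) • y) :=
    ((hasFDerivAt_log_norm (x := (1 + t) • y)
      hx0).const_mul (-(1 / (2 * Real.pi)))).add_const 0
  rw [dirDeriv, h1.fderiv, hn]
  simp only [smul_apply, innerSL_apply_apply, inner_neg_right,
    real_inner_smul_left, real_inner_self_eq_norm_sq, hy, smul_eq_mul]
  field_simp

lemma isGreenCorrector_zero_closedBall :
    IsGreenCorrector (Metric.closedBall (0 : Plane) 1) fun _ => 0 where
  harmonic _ _ := InnerProductSpace.harmonicAt_const 0
  bounded := ⟨0, by simp⟩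
  continuousOn := continuousOn_const
  boundary_eq x hx := by rw [norm_eq_one_of_mem_frontier_closedBall hx]; simp

/-- For the unit disc the Robin kernel is the constant `1/2π`: there `H = -(1/2π) log |x|`. -/
lemma isRobinKernel_const_closedBall {ρ : Plane → ℝ}
    (hρ : IsDefiningFunction (Metric.closedBall (0 : Plane) 1) ρ) (κ : ℝ) :
    IsRobinKernel (Metric.closedBall (0 : Plane) 1) ρ κ (fun _ => 0)
      fun _ => 1 / (2 * Real.pi) where
  harmonic _ _ := InnerProductSpace.harmonicAt_const _
  bounded := ⟨|1 / (2 * Real.pi)|, fun _ _ => le_rfl⟩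
  continuousOn := continuousOn_const
  robin := by
    have hfin := hρ.isFiniteMeasure_boundaryMeasure Metric.isBounded_closedBall
    refine ⟨fun _ => 1 / (2 * Real.pi), ⟨integrable_const _, ?_⟩, integrable_const _, ?_⟩
    · set S := boundaryMeasure (Metric.closedBall (0 : Plane) 1)
      have hlim : Tendsto (fun t : ℝ => ‖1 / (2 * Real.pi) * (1 + t)⁻¹ - 1 / (2 * Real.pi)‖ₑ
          * S Set.univ) (𝓝[>] 0) (𝓝 0) := by
        have h1 : ContinuousAt (fun t : ℝ => 1 / (2 * Real.pi) * (1 + t)⁻¹ - 1 / (2 * Real.pi)) 0 :=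
          ((continuousAt_const.mul ((continuousAt_const.add continuousAt_id).inv₀
            (by simp))).sub continuousAt_const)
        have h2 := (h1.enorm.tendsto.mono_left nhdsWithin_le_nhds : Tendsto _ (𝓝[>] (0 : ℝ)) _)
        have h3 := ENNReal.Tendsto.mul_const (b := S Set.univ) h2 (.inr (measure_ne_top _ _))
        simpa using h3
      refine hlim.congr' ?_
      filter_upwards [self_mem_nhdsWithin] with t ht
      rw [← lintegral_const]
      refine lintegral_congr_ae ?_
      filter_upwards [ae_mem_frontier (Metric.closedBall (0 : Plane) 1)] with y hy
      have hy1 := norm_eq_one_of_mem_frontier_closedBall hy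
      rw [inwardNormal_closedBall hρ hy1, smul_neg, sub_neg_eq_add,
        show y + t • y = (1 + t) • y by rw [add_smul, one_smul],
        dirDeriv_exteriorGreen_zero hy1 ht]
    · simp [dirDeriv]

theorem lemma3 (κ : ℝ) (hκ : 0 < κ)
    (D : Set Plane) (ρ : Plane → ℝ) (hρ : IsDefiningFunction D ρ)
    (hbdd : Bornology.IsBounded D) (hstar : ∃ p ∈ D, StarConvex ℝ p D)
    (h0 : (0 : Plane) ∈ interior D)
    (b : Plane → ℝ) (hb : MemLp b ⊤ (boundaryMeasure D))
    (a : Plane → ℝ) (ha : IsBoundedExteriorHarmonic D a) (hab : HasRobinData D ρ κ a b) :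
    (∀ H₀ Hκ : Plane → ℝ, IsGreenCorrector D H₀ → IsRobinKernel D ρ κ H₀ Hκ →
      Integrable (fun y => b y * Hκ y) (boundaryMeasure D) ∧
      Tendsto a (Bornology.cobounded Plane) (𝓝 (∫ y, b y * Hκ y ∂(boundaryMeasure D)))) ∧
    (D = Metric.closedBall 0 1 →
      Tendsto a (Bornology.cobounded Plane)
        (𝓝 (1 / (2 * Real.pi) * ∫ y, b y ∂(boundaryMeasure D)))) := by
  refine ⟨fun H₀ Hκ hH₀ hHκ => ⟨?_, ?_⟩, ?_⟩
  · exact integrable_mul_of_continuousOn_frontier hρ.isClosed hbdd hab.1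
      (hHκ.continuousOn.mono (frontier_subset_closure_compl D))
  · exact tendsto_cobounded_integral_robinKernel hκ hρ hbdd h0 ha hab hH₀ hHκ
  · rintro rfl
    have h := tendsto_cobounded_integral_robinKernel hκ hρ hbdd h0 ha hab
      isGreenCorrector_zero_closedBall (isRobinKernel_const_closedBall hρ κ)
    rwa [integral_mul_const, mul_comm] at h
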